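/- Let $0<\gamma\le 2$ and $0<T<+\infty$. For $\delta>0$ let $w_\delta(x)=(1+|x|)^{-\delta}$ on $\mathbb{R}^3$ and $L^r_{w_\delta}=L^r(\mathbb{R}^3,w_\delta\,dx)$. Let $\mathbf{u}_0\in L^2_{w_\gamma}$ be a divergence-free vector field on $\mathbb{R}^3$, let $\mathbb{F}=(F_{i,j}(t,x))_{1\le i,j\le 3}$ be a tensor with $\mathbb{F}\in L^2((0,T),L^2_{w_\gamma})$, and let $\mathbf{b}=\mathbf{b}(t,x)$ be a time-dependent divergence-free vector field with $\mathbf{b}\in L^3((0,T),L^3_{w_{3\gamma/2}})$. Assume moreover that $\mathbf{b}\in L^2_tL^\infty_x(K)$ for every compact subset $K$ of $(0,T)\times\mathbb{R}^3$, that is, $\int_0^T\|\mathbf{1}_K(t,\cdot)\,\mathbf{b}(t,\cdot)\|_{L^\infty(\mathbb{R}^3)}^2\,dt<+\infty$. Let $(\mathbf{u}_1,p_1)$ and $(\mathbf{u}_2,p_2)$ be two solutions, in the sense of distributions on $(0,T)\times\mathbb{R}^3$, of the advection-diffusion problem $$\partial_t\mathbf{u}=\Delta\mathbf{u}-(\mathbf{b}\cdot\nabla)\mathbf{u}-\nabla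 p+\nabla\cdot\mathbb{F},\qquad \nabla\cdot\mathbf{u}=0,\qquad \mathbf{u}(0,\cdot)=\mathbf{u}_0,$$ where $(\nabla\cdot\mathbb{F})_j=\sum_{i=1}^3\partial_iF_{i,j}$, such that, for $k=1$ and $k=2$: - $\mathbf{u}_k\in L^\infty((0,T),L^2_{w_\gamma})$ and $\nabla\mathbf{u}_k\in L^2((0,T),L^2_{w_\gamma})$; - the pressure $p_k$, a locally integrable function on $(0,T)\times\mathbb{R}^3$, is given through the Riesz transforms $R_i=\partial_i/\sqrt{-\Delta}$ by $p_k=\sum_{i=1}^3\sum_{j=1}^3R_iR_j(b_iu_{k,j}-F_{i,j})$ for almost every $t\in(0,T)$; - the map $t\in[0,T)\mapsto\mathbf{u}_k(t,\cdot)$ is weakly continuous from $[0,T)$ to $L^2_{w_\gamma}$ and strongly continuous at $t=0$: $\lim_{t\to0^+}\|\mathbf{u}_k(t,\cdot)-\mathbf{u}_0\|_{L^2_{w_\gamma}}=0$. Then $\mathbf{u}_1=\mathbf{u}_2$: for every $t\in[0,T)$, $\mathbf{u}_1(t,x)=\mathbf{u}_2(t,x)$ for almost every $x\in\mathbb{R}^3$.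 -/

import Mathlib

open MeasureTheory Set Filter Topology
open scoped ENNReal FourierTransform ContDiff

namespace AdvDiff

noncomputable section

/-- The space `ℝ³` with its Euclidean norm. -/
abbrev E3 : Type := EuclideanSpace ℝ (Fin 3)

/-- The `i`-th vector of the canonical basis of `ℝ³`. -/
def basisVec (i : Fin 3) : E3 := EuclideanSpace.single i 1

/-- The open slab `(0,T) × ℝ³`. -/
def slab (T : ℝ) : Set (ℝ × E3) := Ioo 0 T ×ˢ univ

/-! ### Weighted Lebesgue spaces -/

/-- The weight `w_δ(x) = 1 / (1 + |x|)^δ`. -/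
def weight (δ : ℝ) (x : E3) : ℝ := 1 / (1 + ‖x‖) ^ δ

/-- The measure `w_δ(x) dx`, so that `L^r_{w_δ} = L^r(weightedVolume δ)`. -/
def weightedVolume (δ : ℝ) : Measure E3 :=
  (volume : Measure E3).withDensity fun x => ENNReal.ofReal (weight δ x)

/-- `f` belongs to `L^q((0,T), L^r(m))`, for a measure `m` on `ℝ³`. -/
def MemLqLr {V : Type*} [NormedAddCommGroup V] (T : ℝ) (q r : ℝ≥0∞) (m : Measure E3)
    (f : ℝ → E3 → V) : Prop :=
  AEStronglyMeasurable (Function.uncurry f) ((volume : Measure (ℝ × E3)).restrict (slab T)) ∧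
    eLpNorm (fun t => eLpNorm (f t) r m) q ((volume : Measure ℝ).restrict (Ioo 0 T)) < ⊤

/-- `f` belongs to `L²_t L^∞_x(K)` for every compact subset `K` of `(0,T) × ℝ³`. -/
def MemLocL2LInfty {V : Type*} [NormedAddCommGroup V] (T : ℝ) (f : ℝ → E3 → V) : Prop :=
  ∀ K : Set (ℝ × E3), IsCompact K → K ⊆ slab T →
    MemLqLr T 2 ⊤ volume (fun t x => K.indicator (Function.uncurry f) (t, x))

/-! ### Test functions and weak derivatives -/

/-- Test functions on `ℝ³`, i.e. elements of `𝒟(ℝ³)`. -/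
def IsTestSpace (ψ : E3 → ℝ) : Prop := ContDiff ℝ ∞ ψ ∧ HasCompactSupport ψ

/-- Test functions on the slab, i.e. elements of `𝒟((0,T) × ℝ³)`. -/
def IsTestSlab (T : ℝ) (φ : ℝ × E3 → ℝ) : Prop :=
  ContDiff ℝ ∞ φ ∧ HasCompactSupport φ ∧ tsupport φ ⊆ slab T

/-- `∂_t φ`. -/
def timeDeriv (φ : ℝ × E3 → ℝ) (z : ℝ × E3) : ℝ := fderiv ℝ φ z (1, 0)

/-- `∂_i φ` (space derivative). -/
def spaceDeriv (i : Fin 3) (φ : ℝ × E3 → ℝ) (z : ℝ × E3) : ℝ := fderiv ℝ φ z (0, basisVec i)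

/-- `Δ φ` (Laplacian in the space variables). -/
def spaceLaplacian (φ : ℝ × E3 → ℝ) (z : ℝ × E3) : ℝ :=
  ∑ i : Fin 3, spaceDeriv i (spaceDeriv i φ) z

/-- `∇ · v = 0` in `𝒟'(ℝ³)`. -/
def DivFreeSpace (v : E3 → E3) : Prop :=
  ∀ ψ : E3 → ℝ, IsTestSpace ψ →
    ∫ x, ∑ i : Fin 3, v x i * fderiv ℝ ψ x (basisVec i) = 0

/-- `∇ · v = 0` in `𝒟'((0,T) × ℝ³)`. -/
def DivFreeSlab (T : ℝ) (v : ℝ → E3 → E3) : Prop :=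
  ∀ φ : ℝ × E3 → ℝ, IsTestSlab T φ →
    ∫ z in slab T, ∑ i : Fin 3, v z.1 z.2 i * spaceDeriv i φ z = 0

/-- `G t x i j = ∂_i u_j (t, x)` in `𝒟'((0,T) × ℝ³)`. -/
def IsWeakGradient (T : ℝ) (u : ℝ → E3 → E3) (G : ℝ → E3 → Fin 3 → Fin 3 → ℝ) : Prop :=
  ∀ i j : Fin 3, ∀ φ : ℝ × E3 → ℝ, IsTestSlab T φ →
    ∫ z in slab T, u z.1 z.2 j * spaceDeriv i φ z = - ∫ z in slab T, G z.1 z.2 i j * φ z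

/-! ### Riesz transforms -/

/-- The Fourier symbol `i ξ_j / |ξ|` of the Riesz transform `R_j = ∂_j / √(-Δ)`. -/
def rieszSymbol (j : Fin 3) (ξ : E3) : ℂ := Complex.I * ((ξ j / ‖ξ‖ : ℝ) : ℂ)

/-- `R_i R_j ψ` for a test function `ψ`, as a Fourier multiplier. It is real valued since its
symbol `-ξ_i ξ_j / |ξ|²` is real and even. -/
def rieszRiesz (i j : Fin 3) (ψ : E3 → ℝ) (x : E3) : ℝ :=
  (𝓕⁻ (fun ξ : E3 => rieszSymbol i ξ * rieszSymbol j ξ * 𝓕 (fun y : E3 => (ψ y : ℂ)) ξ) x).re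

/-- `q = ∑_{i,j} R_i R_j f_{i,j}` on `ℝ³`, where the operators `R_i R_j`, which are symmetric, are
extended from test functions by transposition:
`⟨R_i R_j f, ψ⟩ = ⟨f, R_i R_j ψ⟩` for every `ψ ∈ 𝒟(ℝ³)`. As `R_i R_j ψ = O((1 + |x|)⁻³)`, the
pairing converges for every `f` in `L^p_{w_δ}`, `1 < p < ∞`, `0 < δ < 3`; this extension then is the
bounded operator `R_i R_j` of `L^p_{w_δ}`. -/
def IsRieszSum (f : Fin 3 → Fin 3 → E3 → ℝ) (q : E3 → ℝ) : Prop :=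
  LocallyIntegrable q ∧
    ∀ ψ : E3 → ℝ, IsTestSpace ψ →
      (∀ i j : Fin 3, Integrable (fun x => f i j x * rieszRiesz i j ψ x)) ∧
      ∫ x, q x * ψ x = ∑ i : Fin 3, ∑ j : Fin 3, ∫ x, f i j x * rieszRiesz i j ψ x

/-! ### The advection-diffusion problem -/

/-- The equation `∂_t u = Δ u - (b · ∇) u - ∇ p + ∇ · F` in `𝒟'((0,T) × ℝ³)`, where `G = ∇ u`, that
is `G t x i j = ∂_i u_j`, and `(∇ · F)_j = ∑_i ∂_i F_{i,j}`. -/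
def SolvesMomentum (T : ℝ) (b : ℝ → E3 → E3) (F : ℝ → E3 → Fin 3 → Fin 3 → ℝ)
    (u : ℝ → E3 → E3) (G : ℝ → E3 → Fin 3 → Fin 3 → ℝ) (p : ℝ → E3 → ℝ) : Prop :=
  ∀ j : Fin 3, ∀ φ : ℝ × E3 → ℝ, IsTestSlab T φ →
    - ∫ z in slab T, u z.1 z.2 j * timeDeriv φ z =
      ∫ z in slab T,
        (u z.1 z.2 j * spaceLaplacian φ z
          - (∑ i : Fin 3, b z.1 z.2 i * G z.1 z.2 i j) * φ z
          + p z.1 z.2 * spaceDeriv j φ z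
          - ∑ i : Fin 3, F z.1 z.2 i j * spaceDeriv i φ z)

/-- `t ∈ [0,T) ↦ u(t,·)` is weakly continuous with values in `L²_{w_γ}`. -/
def WeaklyContinuousL2 (γ T : ℝ) (u : ℝ → E3 → E3) : Prop :=
  (∀ t ∈ Ico 0 T, MemLp (u t) 2 (weightedVolume γ)) ∧
    ∀ g : E3 → E3, MemLp g 2 (weightedVolume γ) →
      ContinuousOn (fun t => ∫ x, inner ℝ (u t x) (g x) ∂(weightedVolume γ)) (Ico 0 T)

/-- `(u, p)` is a solution on `(0,T) × ℝ³` of the advection-diffusion problem with drift `b`,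
forcing tensor `F` and initial value `u₀`, in the class `u ∈ L^∞((0,T), L²_{w_γ})`,
`∇ u ∈ L²((0,T), L²_{w_γ})`, with pressure `p = ∑_{i,j} R_i R_j (b_i u_j - F_{i,j})`, weakly
continuous in time and strongly continuous at `t = 0`. -/
structure IsSolution (γ T : ℝ) (u₀ : E3 → E3) (F : ℝ → E3 → Fin 3 → Fin 3 → ℝ)
    (b : ℝ → E3 → E3) (u : ℝ → E3 → E3) (p : ℝ → E3 → ℝ) : Prop where
  memLInftyL2 : MemLqLr T ⊤ 2 (weightedVolume γ) u
  pressure_locallyIntegrable : LocallyIntegrableOn (Function.uncurry p) (slab T)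
  equation : ∃ G : ℝ → E3 → Fin 3 → Fin 3 → ℝ,
    (∀ i j, MemLqLr T 2 2 (weightedVolume γ) (fun t x => G t x i j)) ∧
    IsWeakGradient T u G ∧ SolvesMomentum T b F u G p
  divFree : DivFreeSlab T u
  initial : u 0 =ᵐ[volume] u₀
  pressure_formula : ∀ᵐ t ∂((volume : Measure ℝ).restrict (Ioo 0 T)),
    IsRieszSum (fun i j x => b t x i * u t x j - F t x i j) (p t)
  weaklyContinuous : WeaklyContinuousL2 γ T u
  strongContinuousAtZero :
    Tendsto (fun t => eLpNorm (fun x => u t x - u₀ x) 2 (weightedVolume γ)) (𝓝[>] 0) (𝓝 0)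

end

end AdvDiff

/-- A locally integrable function whose pairings with test functions are bounded in `L²` belongs
to `L²`. -/
theorem eLpNorm_two_le_of_forall_integral_mul_le {E : Type*} [NormedAddCommGroup E]
    [NormedSpace ℝ E] [FiniteDimensional ℝ E] [MeasurableSpace E] [BorelSpace E] {μ : Measure E}
    [IsFiniteMeasureOnCompacts μ] {h : E → ℝ} (hloc : LocallyIntegrable h μ) {C : ℝ}
    (hC : 0 ≤ C)
    (H : ∀ φ : E → ℝ, ContDiff ℝ ∞ φ → HasCompactSupport φ →
      |∫ x, h x * φ x ∂μ| ≤ C * (eLpNorm φ 2 μ).toReal) :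
    eLpNorm h 2 μ ≤ ENNReal.ofReal C := by
  let S : Submodule ℝ (E → ℝ) :=
    { carrier := {φ | ContDiff ℝ ∞ φ ∧ HasCompactSupport φ}
      add_mem' := fun ha hb => ⟨ha.1.add hb.1, ha.2.add hb.2⟩
      zero_mem' := ⟨contDiff_const, HasCompactSupport.zero⟩
      smul_mem' := fun c f hf => ⟨contDiff_const.smul hf.1, hf.2.smul_left (f := fun _ => c)⟩ }
  have hS (φ : S) : MemLp (φ : E → ℝ) 2 μ := φ.2.1.continuous.memLp_of_hasCompactSupport φ.2.2
  have hint (φ : S) : Integrable (fun x => h x * (φ : E → ℝ) x) μ := by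
    simpa [mul_comm] using
      hloc.integrable_smul_left_of_hasCompactSupport φ.2.1.continuous φ.2.2
  let e : S →ₗ[ℝ] Lp ℝ 2 μ :=
    { toFun := fun φ => (hS φ).toLp
      map_add' := fun a b => MemLp.toLp_add (hS a) (hS b)
      map_smul' := fun c a => MemLp.toLp_const_smul c (hS a) }
  let f : S →ₗ[ℝ] ℝ :=
    { toFun := fun φ => ∫ x, h x * (φ : E → ℝ) x ∂μ
      map_add' := fun a b => by
        rw [← integral_add (hint a) (hint b)]; congr 1; ext x; simp [mul_add]
      map_smul' := fun c a => by
        simp only [RingHom.id_apply, smul_eq_mul]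
        rw [← integral_const_mul]; congr 1; ext x; simp; ring }
  have hdense : DenseRange e := by
    refine (MeasureTheory.Lp.dense_hasCompactSupport_contDiff (F := ℝ) (μ := μ) (p := 2)
      (by norm_num)).mono ?_
    rintro g ⟨φ, hφ, hφ1, hφ2⟩
    refine ⟨⟨φ, hφ2, hφ1⟩, ?_⟩
    apply Lp.ext
    exact (hS ⟨φ, hφ2, hφ1⟩).coeFn_toLp.trans hφ.symm
  have hbd : ∀ φ : S, ‖f φ‖ ≤ C * ‖e φ‖ := by
    intro φ
    have : ‖e φ‖ = (eLpNorm (φ : E → ℝ) 2 μ).toReal := Lp.norm_toLp _ (hS φ)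
    rw [this]
    exact H φ φ.2.1 φ.2.2
  let T := f.extendOfNorm e
  have hT : ‖T‖ ≤ C := LinearMap.opNorm_extendOfNorm_le hdense hC hbd
  let g : Lp ℝ 2 μ := (InnerProductSpace.toDual ℝ (Lp ℝ 2 μ)).symm T
  have hg : ‖g‖ ≤ C := by simpa [g] using hT
  have hgh : h =ᵐ[μ] g := by
    refine ae_eq_of_integral_contDiff_smul_eq hloc
      ((Lp.memLp g).locallyIntegrable (by norm_num)) fun φ hφ1 hφ2 => ?_
    have h1 : inner ℝ g (e ⟨φ, hφ1, hφ2⟩) = f ⟨φ, hφ1, hφ2⟩ := by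
      rw [InnerProductSpace.toDual_symm_apply]
      exact LinearMap.extendOfNorm_eq hdense ⟨C, hbd⟩ _
    rw [L2.inner_def] at h1
    have h2 : ∫ x, φ x • g x ∂μ = ∫ x, inner ℝ (g x) (e ⟨φ, hφ1, hφ2⟩ x) ∂μ := by
      refine integral_congr_ae ?_
      filter_upwards [(hS ⟨φ, hφ1, hφ2⟩).coeFn_toLp] with x hx
      change _ = inner ℝ (g x) (((hS ⟨φ, hφ1, hφ2⟩).toLp : Lp ℝ 2 μ) x)
      rw [hx]
      simp
    rw [h2, h1]
    change _ = ∫ x, h x * φ x ∂μ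
    simp [mul_comm]
  rw [eLpNorm_congr_ae hgh, ← Lp.enorm_def, ← ofReal_norm]
  exact ENNReal.ofReal_le_ofReal hg

namespace AdvDiff

theorem IsTestSpace.memLp {ψ : E3 → ℝ} (hψ : IsTestSpace ψ) (p : ℝ≥0∞) :
    MemLp ψ p volume :=
  hψ.1.continuous.memLp_of_hasCompactSupport hψ.2

/-- A test function as a complex Schwartz function. -/
noncomputable def IsTestSpace.toSchwartz {ψ : E3 → ℝ} (hψ : IsTestSpace ψ) :
    SchwartzMap E3 ℂ :=
  (hψ.2.comp_left (g := fun r : ℝ => (r : ℂ)) rfl).toSchwartzMap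
    (Complex.ofRealCLM.contDiff.comp hψ.1)

@[simp] theorem IsTestSpace.toSchwartz_apply {ψ : E3 → ℝ} (hψ : IsTestSpace ψ) (x : E3) :
    hψ.toSchwartz x = (ψ x : ℂ) := rfl

/-- The symbol `-ξ_i ξ_j / |ξ|²` of `R_i R_j`. -/
noncomputable def rrSymbol (i j : Fin 3) (ξ : E3) : ℂ := rieszSymbol i ξ * rieszSymbol j ξ

theorem rrSymbol_eq (i j : Fin 3) (ξ : E3) :
    rrSymbol i j ξ = ((-(ξ i * ξ j / ‖ξ‖ ^ 2) : ℝ) : ℂ) := by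
  simp only [rrSymbol, rieszSymbol]
  rw [show ∀ a b : ℂ, Complex.I * a * (Complex.I * b) = -(a * b) by
    intro a b; linear_combination (a * b) * Complex.I_mul_I]
  push_cast
  field_simp

theorem norm_coord_le (ξ : E3) (i : Fin 3) : |ξ i| ≤ ‖ξ‖ := by
  simpa using PiLp.norm_apply_le ξ i

theorem norm_rrSymbol_le (i j : Fin 3) (ξ : E3) : ‖rrSymbol i j ξ‖ ≤ 1 := by
  rw [rrSymbol_eq, Complex.norm_real, norm_neg, Real.norm_eq_abs, abs_div, abs_mul,
    abs_of_nonneg (sq_nonneg ‖ξ‖)]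
  refine div_le_one_of_le₀ ?_ (sq_nonneg _)
  rw [sq]
  exact mul_le_mul (norm_coord_le ξ i) (norm_coord_le ξ j) (abs_nonneg _) (norm_nonneg _)

theorem measurable_rrSymbol (i j : Fin 3) : Measurable (rrSymbol i j) := by
  have : rrSymbol i j = fun ξ : E3 => ((-(ξ i * ξ j / ‖ξ‖ ^ 2) : ℝ) : ℂ) :=
    funext (rrSymbol_eq i j)
  rw [this]
  fun_prop

/-- A bounded multiplier times a Schwartz function is integrable. -/
theorem integrable_bdd_mul_schwartz {m : E3 → ℂ} (hm : Measurable m) (hb : ∀ ξ, ‖m ξ‖ ≤ 1)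
    (f : SchwartzMap E3 ℂ) : Integrable (fun ξ => m ξ * f ξ) :=
  f.integrable.bdd_mul hm.aestronglyMeasurable (Eventually.of_forall hb)

theorem rieszRiesz_eq (i j : Fin 3) {ψ : E3 → ℝ} (hψ : IsTestSpace ψ) (x : E3) :
    rieszRiesz i j ψ x = (𝓕⁻ (fun ξ => rrSymbol i j ξ * 𝓕 hψ.toSchwartz ξ) x).re := rfl

theorem integral_fourierInv_mul {g f : E3 → ℂ} (hg : Integrable g) (hf : Integrable f) :
    ∫ x, 𝓕⁻ g x * f x = ∫ ξ, g ξ * 𝓕⁻ f ξ := by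
  have h := VectorFourier.integral_bilin_fourierIntegral_eq_flip (ContinuousLinearMap.mul ℂ ℂ)
    (μ := volume) (ν := volume) (L := -innerₗ E3)
    Real.continuous_fourierChar (by simp only [LinearMap.neg_apply]; exact continuous_inner.neg)
    hg hf
  have e2 : ∀ x, 𝓕⁻ f x = VectorFourier.fourierIntegral Real.fourierChar volume
      (-innerₗ E3).flip f x := fun x => by
    rw [Real.fourierInv_eq]
    simp [VectorFourier.fourierIntegral, real_inner_comm]
  simp only [e2]
  exact h

theorem integral_fourierInv_mul_schwartz {g : E3 → ℂ} (hg : Integrable g)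
    (f : SchwartzMap E3 ℂ) :
    ∫ x, 𝓕⁻ g x * f x = ∫ ξ, g ξ * 𝓕⁻ f ξ := by
  rw [SchwartzMap.fourierInv_coe]
  exact integral_fourierInv_mul hg f.integrable

theorem continuous_fourierInv_of_integrable {g : E3 → ℂ} (hg : Integrable g) :
    Continuous (𝓕⁻ g) :=
  VectorFourier.fourierIntegral_continuous Real.continuous_fourierChar
    (by simp only [LinearMap.neg_apply]; exact continuous_inner.neg) hg

theorem continuous_rieszRiesz (i j : Fin 3) {ψ : E3 → ℝ} (hψ : IsTestSpace ψ) :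
    Continuous (rieszRiesz i j ψ) :=
  Complex.continuous_re.comp (continuous_fourierInv_of_integrable
    (integrable_bdd_mul_schwartz (measurable_rrSymbol i j) (norm_rrSymbol_le i j)
      (𝓕 hψ.toSchwartz)))

theorem eLpNorm_fourier_schwartz (f : SchwartzMap E3 ℂ) :
    eLpNorm (𝓕 f : SchwartzMap E3 ℂ) 2 volume = eLpNorm f 2 volume := by
  have h : ‖(𝓕 f : SchwartzMap E3 ℂ).toLp 2 volume‖ = ‖f.toLp 2 volume‖ := 
    SchwartzMap.norm_fourier_toL2_eq f
  have a := SchwartzMap.norm_toLp (p := 2) (μ := (volume : Measure E3)) (f := f)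
  have b := SchwartzMap.norm_toLp (p := 2) (μ := (volume : Measure E3)) (f := (𝓕 f : SchwartzMap E3 ℂ))
  rw [a, b] at h
  have h1 := ((𝓕 f : SchwartzMap E3 ℂ).memLp 2 volume).eLpNorm_ne_top
  have h2 := (f.memLp 2 volume).eLpNorm_ne_top
  exact (ENNReal.toReal_eq_toReal_iff' h1 h2).1 h

theorem eLpNorm_fourierInv_schwartz (f : SchwartzMap E3 ℂ) :
    eLpNorm (𝓕⁻ f : SchwartzMap E3 ℂ) 2 volume = eLpNorm f 2 volume := by
  have := eLpNorm_fourier_schwartz (𝓕⁻ f : SchwartzMap E3 ℂ)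
  rwa [FourierTransform.fourier_fourierInv_eq, eq_comm] at this

theorem IsTestSpace.eLpNorm_toSchwartz {ψ : E3 → ℝ} (hψ : IsTestSpace ψ) :
    eLpNorm hψ.toSchwartz 2 volume = eLpNorm ψ 2 volume :=
  eLpNorm_congr_norm_ae (Eventually.of_forall fun x => by simp)

/-- The operators `R_i R_j` are contractions of `L²`. -/
theorem eLpNorm_rieszRiesz_le (i j : Fin 3) {ψ : E3 → ℝ} (hψ : IsTestSpace ψ) :
    eLpNorm (rieszRiesz i j ψ) 2 volume ≤ eLpNorm ψ 2 volume := by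
  have hcont := continuous_rieszRiesz i j hψ
  rw [← ENNReal.ofReal_toReal (hψ.memLp 2).eLpNorm_ne_top]
  refine eLpNorm_two_le_of_forall_integral_mul_le hcont.locallyIntegrable ENNReal.toReal_nonneg
    fun φ hφ1 hφ2 => ?_
  have hφ : IsTestSpace φ := ⟨hφ1, hφ2⟩
  have hint := integrable_bdd_mul_schwartz (measurable_rrSymbol i j) (norm_rrSymbol_le i j)
      (𝓕 hψ.toSchwartz)
  have hcont' := continuous_fourierInv_of_integrable hint
  have e1 : ∫ x, rieszRiesz i j ψ x * φ x =
      (∫ x, 𝓕⁻ (fun ξ => rrSymbol i j ξ * 𝓕 hψ.toSchwartz ξ) x * hφ.toSchwartz x).re := by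
    have hi : Integrable (fun x => 𝓕⁻ (fun ξ => rrSymbol i j ξ * 𝓕 hψ.toSchwartz ξ) x
        * hφ.toSchwartz x) := by
      refine (hcont'.mul hφ.toSchwartz.continuous).integrable_of_hasCompactSupport ?_
      exact (hφ.2.comp_left (g := fun r : ℝ => (r : ℂ)) rfl).mul_left
    rw [← RCLike.re_eq_complex_re, ← integral_re hi]
    congr 1
    ext x
    simp [rieszRiesz_eq i j hψ]
  rw [e1, integral_fourierInv_mul_schwartz hint]
  refine (Complex.abs_re_le_norm _).trans ?_
  have hm1 : MemLp (fun ξ => rrSymbol i j ξ * 𝓕 hψ.toSchwartz ξ) 2 volume :=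
    ((𝓕 hψ.toSchwartz).memLp 2).of_le hint.aestronglyMeasurable
      (Eventually.of_forall fun ξ => by
        rw [norm_mul]
        exact mul_le_of_le_one_left (norm_nonneg _) (norm_rrSymbol_le i j ξ))
  have hm2 : MemLp (fun ξ => 𝓕⁻ hφ.toSchwartz ξ) 2 volume := (𝓕⁻ hφ.toSchwartz).memLp 2
  have hle : eLpNorm (fun ξ => (rrSymbol i j ξ * 𝓕 hψ.toSchwartz ξ) * 𝓕⁻ hφ.toSchwartz ξ) 1 volume
      ≤ eLpNorm ψ 2 volume * eLpNorm φ 2 volume := by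
    refine (eLpNorm_smul_le_mul_eLpNorm (p := 2) (q := 2) (r := 1) hm2.1 hm1.1).trans ?_
    rw [mul_comm]
    refine (mul_comm _ _).le.trans (mul_le_mul' ?_ ?_)
    · rw [← hψ.eLpNorm_toSchwartz, ← eLpNorm_fourier_schwartz]
      exact eLpNorm_mono fun ξ => by
        rw [norm_mul]
        exact mul_le_of_le_one_left (norm_nonneg _) (norm_rrSymbol_le i j ξ)
    · exact (eLpNorm_fourierInv_schwartz _).le.trans hφ.eLpNorm_toSchwartz.le
  rw [← ENNReal.toReal_mul]
  refine le_trans ?_ (ENNReal.toReal_mono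
    (ENNReal.mul_ne_top (hψ.memLp 2).eLpNorm_ne_top (hφ.memLp 2).eLpNorm_ne_top) hle)
  rw [eLpNorm_one_eq_lintegral_enorm, ← integral_norm_eq_lintegral_enorm]
  · exact norm_integral_le_integral_norm _
  · exact hm1.1.mul hm2.1

end AdvDiff

/-- Integration by parts against a compactly supported function. -/
theorem integral_mul_fderiv_of_hasCompactSupport {E : Type*} [NormedAddCommGroup E]
    [NormedSpace ℝ E] [FiniteDimensional ℝ E] [MeasurableSpace E] [BorelSpace E] {μ : Measure E}
    [μ.IsAddHaarMeasure] {f g : E → ℝ} (hf : ContDiff ℝ 1 f) (hg : ContDiff ℝ 1 g)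
    (hgc : HasCompactSupport g) (v : E) :
    ∫ x, f x * fderiv ℝ g x v ∂μ = -∫ x, fderiv ℝ f x v * g x ∂μ := by
  have hf' : Continuous fun x => fderiv ℝ f x v :=
    (hf.continuous_fderiv (by norm_num)).clm_apply continuous_const
  have hg' : Continuous fun x => fderiv ℝ g x v :=
    (hg.continuous_fderiv (by norm_num)).clm_apply continuous_const
  refine integral_mul_fderiv_eq_neg_fderiv_mul_of_integrable ?_ ?_ ?_
    (fun x _ => hf.differentiable (by norm_num) x) (fun x _ => hg.differentiable (by norm_num) x)
  · exact (hf'.mul hg.continuous).integrable_of_hasCompactSupport hgc.mul_left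
  · exact (hf.continuous.mul hg').integrable_of_hasCompactSupport
      ((hgc.fderiv_apply ℝ v).mul_left)
  · exact (hf.continuous.mul hg.continuous).integrable_of_hasCompactSupport hgc.mul_left

namespace AdvDiff

open Real in
/-- The Fourier transform of `ξ ↦ exp (-a |ξ|²)`. -/
noncomputable def heatKernel (a : ℝ) (z : E3) : ℝ :=
  (π / a) ^ (3 / 2 : ℝ) * rexp (-π ^ 2 * ‖z‖ ^ 2 / a)

open Real in
/-- The kernel of the Fourier multiplier `-ξ_i ξ_j exp (-a |ξ|²)`. -/
noncomputable def hessHeat (i j : Fin 3) (a : ℝ) (z : E3) : ℝ :=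
  heatKernel a z * ((2 * π ^ 2 / a) ^ 2 * z i * z j - (2 * π ^ 2 / a) * if i = j then 1 else 0)
    / (4 * π ^ 2)

theorem IsTestSpace.fderiv_apply {ψ : E3 → ℝ} (hψ : IsTestSpace ψ) (v : E3) :
    IsTestSpace (fun x => fderiv ℝ ψ x v) :=
  ⟨(hψ.1.fderiv_right (m := ∞) (by simp)).clm_apply contDiff_const, hψ.2.fderiv_apply ℝ v⟩

open LineDeriv in
theorem IsTestSpace.toSchwartz_fderiv {ψ : E3 → ℝ} (hψ : IsTestSpace ψ) (v : E3) :
    (hψ.fderiv_apply v).toSchwartz = ∂_{v} hψ.toSchwartz := by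
  ext x
  rw [SchwartzMap.lineDerivOp_apply_eq_fderiv]
  have h : HasFDerivAt (fun x => ((ψ x : ℝ) : ℂ)) (Complex.ofRealCLM.comp (fderiv ℝ ψ x)) x :=
    Complex.ofRealCLM.hasFDerivAt.comp x (hψ.1.differentiable (by simp) x).hasFDerivAt
  change _ = fderiv ℝ (fun x => ((ψ x : ℝ) : ℂ)) x v
  rw [h.fderiv]
  simp

theorem inner_basisVec (x : E3) (i : Fin 3) : inner ℝ x (basisVec i) = x i := by
  simp [basisVec, EuclideanSpace.inner_single_right]

theorem fourier_toSchwartz_fderiv {ψ : E3 → ℝ} (hψ : IsTestSpace ψ) (i : Fin 3) (ξ : E3) :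
    𝓕 (hψ.fderiv_apply (basisVec i)).toSchwartz ξ
      = 2 * Real.pi * Complex.I * ((ξ i : ℝ) : ℂ) * 𝓕 hψ.toSchwartz ξ := by
  rw [hψ.toSchwartz_fderiv, SchwartzMap.fourier_lineDerivOp_eq]
  have : (fun x : E3 => inner ℝ x (basisVec i)).HasTemperateGrowth := by fun_prop
  rw [_root_.smul_apply, SchwartzMap.smulLeftCLM_apply_apply this, inner_basisVec]
  simp [mul_assoc]

theorem hasFDerivAt_heatKernel (a : ℝ) (x y : E3) :
    HasFDerivAt (fun y => heatKernel a (x - y))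
      ((heatKernel a (x - y) * (2 * Real.pi ^ 2 / a)) • innerSL ℝ (x - y)) y := by
  have h1 : HasFDerivAt (fun y : E3 => x - y) (-(ContinuousLinearMap.id ℝ E3)) y :=
    (hasFDerivAt_id y).const_sub x
  have h2 := ((h1.norm_sq.const_mul (-Real.pi ^ 2)).mul_const a⁻¹).exp.const_mul
    ((Real.pi / a) ^ (3 / 2 : ℝ))
  simp only [heatKernel, div_eq_mul_inv _ a]
  refine h2.congr_fderiv ?_
  ext v
  simp
  ring_nf

theorem contDiff_heatKernel (a : ℝ) (x : E3) : ContDiff ℝ ∞ (fun y => heatKernel a (x - y)) := by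
  unfold heatKernel
  have : ContDiff ℝ ∞ (fun y : E3 => ‖x - y‖ ^ 2) :=
    (contDiff_norm_sq ℝ).comp (contDiff_const.sub contDiff_id)
  exact contDiff_const.mul (((contDiff_const.mul this).div_const a).exp)

theorem fderiv_heatKernel (a : ℝ) (x y : E3) (i : Fin 3) :
    fderiv ℝ (fun y => heatKernel a (x - y)) y (basisVec i)
      = heatKernel a (x - y) * (2 * Real.pi ^ 2 / a) * (x - y) i := by
  rw [(hasFDerivAt_heatKernel a x y).fderiv]
  simp only [_root_.smul_apply, innerSL_apply_apply, inner_basisVec, smul_eq_mul]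

theorem fderiv_fderiv_heatKernel (a : ℝ) (x y : E3) (i j : Fin 3) :
    fderiv ℝ (fun y => heatKernel a (x - y) * (2 * Real.pi ^ 2 / a) * (x - y) i) y (basisVec j)
      = 4 * Real.pi ^ 2 * hessHeat i j a (x - y) := by
  have h1 : HasFDerivAt (fun y : E3 => (x - y) i)
      (-(EuclideanSpace.proj i : E3 →L[ℝ] ℝ)) y := by
    have := (EuclideanSpace.proj i : E3 →L[ℝ] ℝ).hasFDerivAt.comp y
      ((hasFDerivAt_id y).const_sub x)
    refine this.congr_fderiv ?_
    ext v; simp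
  have h2 := ((hasFDerivAt_heatKernel a x y).mul_const (2 * Real.pi ^ 2 / a)).mul h1
  change fderiv ℝ ((fun y => heatKernel a (x - y) * (2 * Real.pi ^ 2 / a)) * fun y => (x - y) i) y
    (basisVec j) = _
  rw [h2.fderiv]
  have hp : (EuclideanSpace.proj i : E3 →L[ℝ] ℝ) (basisVec j) = basisVec j i := rfl
  have hb : (basisVec j) i = if i = j then (1 : ℝ) else 0 := by
    simp [basisVec]
  have hπ : Real.pi ≠ 0 := Real.pi_ne_zero
  simp only [_root_.add_apply, _root_.smul_apply, innerSL_apply_apply,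
    inner_basisVec, smul_eq_mul, _root_.neg_apply, hp, hb,
    hessHeat]
  field_simp
  split_ifs <;> ring

/-- The operator with kernel `hessHeat i j a`. -/
noncomputable def heatRiesz (i j : Fin 3) (a : ℝ) (ψ : E3 → ℝ) (x : E3) : ℝ :=
  ∫ y, hessHeat i j a (x - y) * ψ y

theorem heatRiesz_eq_integral_heatKernel (i j : Fin 3) (a : ℝ) {ψ : E3 → ℝ}
    (hψ : IsTestSpace ψ) (x : E3) :
    4 * Real.pi ^ 2 * heatRiesz i j a ψ x = ∫ y, heatKernel a (x - y) *
      fderiv ℝ (fun y => fderiv ℝ ψ y (basisVec j)) y (basisVec i) := by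
  have hψj := hψ.fderiv_apply (basisVec j)
  rw [integral_mul_fderiv_of_hasCompactSupport ((contDiff_heatKernel a x).of_le (by simp))
    (hψj.1.of_le (by simp)) hψj.2]
  simp only [fderiv_heatKernel]
  have hc : ContDiff ℝ 1 (fun y => heatKernel a (x - y) * (2 * Real.pi ^ 2 / a) * (x - y) i) := by
    refine (((contDiff_heatKernel a x).of_le (by simp)).mul contDiff_const).mul ?_
    fun_prop
  rw [integral_mul_fderiv_of_hasCompactSupport hc (hψ.1.of_le (by simp)) hψ.2, neg_neg]
  simp only [fderiv_fderiv_heatKernel]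
  simp only [heatRiesz, mul_assoc, integral_const_mul]

/-- `4π² R_i R_j ψ` and its regularisations are obtained from this function. -/
theorem fourier_toSchwartz_hess {ψ : E3 → ℝ} (hψ : IsTestSpace ψ) (i j : Fin 3) (ξ : E3) :
    𝓕 ((hψ.fderiv_apply (basisVec j)).fderiv_apply (basisVec i)).toSchwartz ξ
      = -(4 * Real.pi ^ 2) * ((ξ i : ℝ) : ℂ) * ((ξ j : ℝ) : ℂ) * 𝓕 hψ.toSchwartz ξ := by
  rw [fourier_toSchwartz_fderiv (hψ.fderiv_apply _), fourier_toSchwartz_fderiv hψ]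
  linear_combination (4 * Real.pi ^ 2) * ((ξ i : ℝ) : ℂ) * ((ξ j : ℝ) : ℂ) * 𝓕 hψ.toSchwartz ξ *
    Complex.I_mul_I

theorem integral_heatKernel_mul {a : ℝ} (ha : 0 < a) {χ : E3 → ℝ} (hχ : IsTestSpace χ) (x : E3) :
    ((∫ y, heatKernel a (x - y) * χ y : ℝ) : ℂ) =
      𝓕⁻ (fun ξ => Complex.exp (-a * ‖ξ‖ ^ 2) * 𝓕 hχ.toSchwartz ξ) x := by
  have hg : Integrable (fun ξ : E3 => Complex.exp (-a * ‖ξ‖ ^ 2 + 2 * Real.pi * Complex.I *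
      (inner ℝ x ξ : ℝ))) :=
    GaussianFourier.integrable_cexp_neg_mul_sq_norm_add (by simpa using ha) _ x
  have h := VectorFourier.integral_bilin_fourierIntegral_eq_flip (ContinuousLinearMap.mul ℂ ℂ)
    (μ := volume) (ν := volume) (L := innerₗ E3)
    Real.continuous_fourierChar continuous_inner hg hχ.toSchwartz.integrable
  have e1 : ∀ y, VectorFourier.fourierIntegral Real.fourierChar volume (innerₗ E3)
      (fun ξ : E3 => Complex.exp (-a * ‖ξ‖ ^ 2 + 2 * Real.pi * Complex.I * (inner ℝ x ξ : ℝ))) y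
      = (heatKernel a (x - y) : ℂ) := fun y => by
    have := fourier_gaussian_innerProductSpace' (b := (a : ℂ)) (by simpa using ha) x y
    refine Eq.trans this ?_
    rw [heatKernel]
    push_cast
    rw [Complex.ofReal_cpow (by positivity)]
    simp
  have e2 : ∀ ξ, VectorFourier.fourierIntegral Real.fourierChar volume (innerₗ E3).flip
      hχ.toSchwartz ξ = 𝓕 hχ.toSchwartz ξ := fun ξ => by
    rw [SchwartzMap.fourier_coe, Real.fourier_eq]
    simp [VectorFourier.fourierIntegral, real_inner_comm]
  simp only [e1, e2, ContinuousLinearMap.mul_apply'] at h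
  rw [Real.fourierInv_eq', ← integral_complex_ofReal]
  simp only [Complex.ofReal_mul]
  refine h.trans (integral_congr_ae (Eventually.of_forall fun ξ => ?_))
  simp only [smul_eq_mul]
  rw [Complex.exp_add, real_inner_comm]
  push_cast
  ring_nf

theorem integral_mul_re_fourierInv {g : E3 → ℂ} (hg : Integrable g) {f : E3 → ℝ}
    (hf : Integrable f) :
    ∫ x, f x * (𝓕⁻ g x).re = (∫ ξ, g ξ * 𝓕⁻ (fun x => (f x : ℂ)) ξ).re := by
  have hf' : Integrable (fun x => (f x : ℂ)) := hf.ofReal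
  rw [← integral_fourierInv_mul hg hf']
  have hc := continuous_fourierInv_of_integrable hg
  have hi : Integrable (fun x => 𝓕⁻ g x * (f x : ℂ)) := by
    refine hf.ofReal.bdd_mul (c := ∫ ξ, ‖g ξ‖) hc.aestronglyMeasurable
      (Eventually.of_forall fun x => ?_)
    rw [Real.fourierInv_eq]
    refine (norm_integral_le_integral_norm _).trans_eq ?_
    simp
  rw [← RCLike.re_eq_complex_re, ← integral_re hi]
  congr 1
  ext x
  simp [mul_comm]

/-- The representation `R_i R_j = ∫₀^∞ (∂_i ∂_j e^{aΔ/4π²}) da / 4π²`, in weak form. -/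
theorem integral_mul_rieszRiesz_eq (i j : Fin 3) {ψ : E3 → ℝ} (hψ : IsTestSpace ψ) {f : E3 → ℝ}
    (hf : Integrable f) :
    IntegrableOn (fun a => ∫ x, f x * heatRiesz i j a ψ x) (Ioi 0) ∧
    ∫ x, f x * rieszRiesz i j ψ x = ∫ a in Ioi 0, ∫ x, f x * heatRiesz i j a ψ x := by
  set χ := (hψ.fderiv_apply (basisVec j)).fderiv_apply (basisVec i) with hχ
  set S : SchwartzMap E3 ℂ := 𝓕 χ.toSchwartz with hS
  set f' : E3 → ℂ := 𝓕⁻ (fun x => (f x : ℂ)) with hf'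
  have hf'c : Continuous f' := continuous_fourierInv_of_integrable hf.ofReal
  have hf'b : ∀ ξ, ‖f' ξ‖ ≤ ∫ x, ‖f x‖ := fun ξ => by
    rw [hf', Real.fourierInv_eq]
    refine (norm_integral_le_integral_norm _).trans_eq ?_
    simp
  have hπ : (4 * Real.pi ^ 2 : ℂ) ≠ 0 := by
    have := Real.pi_ne_zero
    simp [this]
  have hm1 := integrable_bdd_mul_schwartz (measurable_rrSymbol i j) (norm_rrSymbol_le i j)
      (𝓕 hψ.toSchwartz)
  have hm : ∀ ξ : E3, rrSymbol i j ξ * 𝓕 hψ.toSchwartz ξ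
      = ((‖ξ‖ ^ 2)⁻¹ : ℝ) * S ξ * (4 * Real.pi ^ 2 : ℂ)⁻¹ := fun ξ => by
    rw [hS, hχ, fourier_toSchwartz_hess hψ, rrSymbol_eq]
    push_cast
    field_simp
  let Φ : ℝ × E3 → ℂ := fun q => Complex.exp (-q.1 * ‖q.2‖ ^ 2) * S q.2 * f' q.2 * (4 * Real.pi ^ 2 : ℂ)⁻¹
  have hΦm : Continuous Φ := by
    have := S.continuous
    fun_prop
  have hnorm : ∀ (a : ℝ) (ξ : E3), ‖Complex.exp (-a * ‖ξ‖ ^ 2)‖ = Real.exp (-‖ξ‖ ^ 2 * a) := by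
    intro a ξ
    rw [show (-a * ‖ξ‖ ^ 2 : ℂ) = ((-‖ξ‖ ^ 2 * a : ℝ) : ℂ) by push_cast; ring,
      Complex.norm_exp_ofReal]
  have hne : ∀ᵐ ξ : E3, ξ ≠ 0 := by
    have : ({0} : Set E3)ᶜ ∈ ae (volume : Measure E3) := compl_mem_ae_iff.2 (measure_singleton 0)
    exact this
  have hexp : ∀ ξ : E3, ξ ≠ 0 → ∫ a in Ioi (0 : ℝ), Real.exp (-‖ξ‖ ^ 2 * a) = (‖ξ‖ ^ 2)⁻¹ := by
    intro ξ hξ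
    have h2 : 0 < ‖ξ‖ ^ 2 := by have := norm_pos_iff.2 hξ; positivity
    rw [integral_exp_mul_Ioi (by linarith)]
    simp
  have hexpi : ∀ ξ : E3, ξ ≠ 0 → IntegrableOn (fun a => Real.exp (-‖ξ‖ ^ 2 * a)) (Ioi 0) := by
    intro ξ hξ
    have h2 : 0 < ‖ξ‖ ^ 2 := by have := norm_pos_iff.2 hξ; positivity
    exact integrableOn_exp_mul_Ioi (by linarith) 0
  have hΦ : Integrable Φ ((volume.restrict (Ioi 0)).prod volume) := by
    rw [integrable_prod_iff' hΦm.aestronglyMeasurable]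
    constructor
    · filter_upwards [hne] with ξ hξ
      have := hexpi ξ hξ
      refine (this.mul_const (‖S ξ‖ * ‖f' ξ‖ * ‖(4 * Real.pi ^ 2 : ℂ)⁻¹‖)).mono'
        (hΦm.comp (by fun_prop : Continuous fun a : ℝ => (a, ξ))).aestronglyMeasurable
        (Eventually.of_forall fun a => ?_)
      simp only [Φ, norm_mul, hnorm, mul_assoc, le_refl]
    · have hb : Integrable (fun ξ => (∫ x, ‖f x‖) * ‖rrSymbol i j ξ * 𝓕 hψ.toSchwartz ξ‖) :=
        hm1.norm.const_mul _
      refine hb.mono' ?_ ?_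
      · exact (hΦm.norm.stronglyMeasurable.integral_prod_left' (μ := volume.restrict (Ioi 0))
          ).aestronglyMeasurable
      · filter_upwards [hne] with ξ hξ
        rw [Real.norm_of_nonneg (by positivity), hm]
        simp only [Φ, norm_mul, hnorm]
        rw [integral_mul_const, integral_mul_const, integral_mul_const, hexp ξ hξ,
          Complex.norm_real, Real.norm_of_nonneg (by positivity)]
        have := mul_le_mul_of_nonneg_right (hf'b ξ)
          (show 0 ≤ (‖ξ‖ ^ 2)⁻¹ * ‖S ξ‖ * ‖(4 * Real.pi ^ 2 : ℂ)⁻¹‖ by positivity)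
        linarith
  have hheat : ∀ a ∈ Ioi (0 : ℝ), ∫ x, f x * heatRiesz i j a ψ x = (∫ ξ, Φ (a, ξ)).re := by
    intro a ha
    have hint : Integrable (fun ξ : E3 => Complex.exp (-a * ‖ξ‖ ^ 2) * S ξ) := by
      refine integrable_bdd_mul_schwartz (by fun_prop) (fun ξ => ?_) S
      rw [hnorm, Real.exp_le_one_iff]
      have : 0 ≤ ‖ξ‖ ^ 2 * a := mul_nonneg (sq_nonneg _) (le_of_lt ha)
      linarith
    have e1 : ∀ x, heatRiesz i j a ψ x
        = (𝓕⁻ (fun ξ : E3 => Complex.exp (-a * ‖ξ‖ ^ 2) * S ξ) x).re * (4 * Real.pi ^ 2)⁻¹ := fun x => by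
      rw [← integral_heatKernel_mul ha, Complex.ofReal_re, ← heatRiesz_eq_integral_heatKernel _ _ _ hψ]
      have := Real.pi_ne_zero
      field_simp
    simp only [e1, ← mul_assoc]
    rw [integral_mul_const, integral_mul_re_fourierInv hint hf]
    simp only [Φ]
    rw [integral_mul_const]
    rw [show (4 * Real.pi ^ 2 : ℂ)⁻¹ = (((4 * Real.pi ^ 2)⁻¹ : ℝ) : ℂ) by push_cast; rfl,
      Complex.re_mul_ofReal]
  have hre : Integrable (fun a => (∫ ξ, Φ (a, ξ)).re) (volume.restrict (Ioi 0)) :=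
    hΦ.integral_prod_left.re
  refine ⟨hre.congr ?_, ?_⟩
  · filter_upwards [ae_restrict_mem measurableSet_Ioi] with a ha
    exact (hheat a ha).symm
  · rw [setIntegral_congr_fun measurableSet_Ioi hheat]
    simp only [rieszRiesz_eq i j hψ]
    rw [integral_mul_re_fourierInv hm1 hf]
    have := integral_re hΦ.integral_prod_left
    simp only [RCLike.re_eq_complex_re] at this
    rw [this, integral_integral_swap (f := fun a ξ => Φ (a, ξ)) hΦ]
    congr 1
    refine integral_congr_ae ?_
    filter_upwards [hne] with ξ hξ
    rw [hm]
    simp only [Φ]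
    rw [integral_mul_const, integral_mul_const, integral_mul_const]
    have : ∫ a in Ioi (0 : ℝ), Complex.exp (-a * ‖ξ‖ ^ 2) = (((‖ξ‖ ^ 2)⁻¹ : ℝ) : ℂ) := by
      rw [← hexp ξ hξ, ← integral_complex_ofReal]
      congr 1
      ext a
      push_cast
      ring_nf
    rw [this]
    ring

end AdvDiff

namespace AdvDiff

theorem abs_hessHeat_le (i j : Fin 3) {a : ℝ} (ha : 0 < a) (z : E3) :
    |hessHeat i j a z| ≤ 4 * a ^ (-5 / 2 : ℝ) *
      ((2 * (Real.pi ^ 2 * ‖z‖ ^ 2 / a) + 1) * Real.exp (-(Real.pi ^ 2 * ‖z‖ ^ 2 / a))) := by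
  have hπ := Real.pi_pos
  have hK : heatKernel a z ≤ 8 * a ^ (-3 / 2 : ℝ) * Real.exp (-(Real.pi ^ 2 * ‖z‖ ^ 2 / a)) := by
    rw [heatKernel, show -Real.pi ^ 2 * ‖z‖ ^ 2 / a = -(Real.pi ^ 2 * ‖z‖ ^ 2 / a) by ring]
    refine mul_le_mul_of_nonneg_right ?_ (Real.exp_nonneg _)
    rw [Real.div_rpow hπ.le ha.le, div_eq_mul_inv, ← Real.rpow_neg ha.le,
      show (-(3 / 2) : ℝ) = -3 / 2 by ring]
    refine mul_le_mul_of_nonneg_right ?_ (by positivity)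
    calc Real.pi ^ (3 / 2 : ℝ) ≤ 4 ^ (3 / 2 : ℝ) :=
          Real.rpow_le_rpow hπ.le Real.pi_le_four (by norm_num)
      _ = ((4 : ℝ) ^ (1 / 2 : ℝ)) ^ (3 : ℝ) := by rw [← Real.rpow_mul (by norm_num)]; norm_num
      _ = 8 := by
          rw [← Real.sqrt_eq_rpow, show (4 : ℝ) = 2 ^ 2 by norm_num, Real.sqrt_sq (by norm_num)]
          norm_num
  have hK0 : 0 ≤ heatKernel a z := by unfold heatKernel; positivity
  have h1 : |(2 * Real.pi ^ 2 / a) ^ 2 * z i * z j - (2 * Real.pi ^ 2 / a) * if i = j then 1 else 0|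
      ≤ (2 * Real.pi ^ 2 / a) * (2 * (Real.pi ^ 2 * ‖z‖ ^ 2 / a) + 1) := by
    refine (abs_sub _ _).trans ?_
    have hi : |z i| * |z j| ≤ ‖z‖ * ‖z‖ :=
      mul_le_mul (norm_coord_le z i) (norm_coord_le z j) (abs_nonneg _) (norm_nonneg _)
    have hc : 0 ≤ (2 * Real.pi ^ 2 / a) := by positivity
    rw [abs_mul, abs_mul, abs_mul, abs_of_nonneg (sq_nonneg _), abs_of_nonneg hc, mul_assoc]
    have h2 : |if i = j then (1 : ℝ) else 0| ≤ 1 := by split_ifs <;> simp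
    calc (2 * Real.pi ^ 2 / a) ^ 2 * (|z i| * |z j|) + (2 * Real.pi ^ 2 / a) * _
        ≤ (2 * Real.pi ^ 2 / a) ^ 2 * (‖z‖ * ‖z‖) + (2 * Real.pi ^ 2 / a) * 1 := by gcongr
      _ = _ := by ring
  have ha' : a ^ (-5 / 2 : ℝ) = a ^ (-3 / 2 : ℝ) / a := by
    rw [← Real.rpow_sub_one ha.ne']; norm_num
  rw [hessHeat, abs_div, abs_mul, abs_of_nonneg hK0, abs_of_pos (by positivity : 0 < 4 * Real.pi ^ 2),
    div_le_iff₀ (by positivity)]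
  calc _ ≤ (8 * a ^ (-3 / 2 : ℝ) * Real.exp (-(Real.pi ^ 2 * ‖z‖ ^ 2 / a))) *
        ((2 * Real.pi ^ 2 / a) * (2 * (Real.pi ^ 2 * ‖z‖ ^ 2 / a) + 1)) :=
      mul_le_mul hK h1 (abs_nonneg _) (by positivity)
    _ = _ := by rw [ha']; ring

theorem abs_hessHeat_le_of_large (i j : Fin 3) {a : ℝ} (ha : 0 < a) (z : E3) :
    |hessHeat i j a z| ≤ 8 * a ^ (-5 / 2 : ℝ) := by
  refine (abs_hessHeat_le i j ha z).trans ?_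
  set s := Real.pi ^ 2 * ‖z‖ ^ 2 / a
  have hs : 0 ≤ s := by positivity
  have : (2 * s + 1) * Real.exp (-s) ≤ 2 := by
    rw [Real.exp_neg, ← div_eq_mul_inv, div_le_iff₀ (Real.exp_pos _)]
    linarith [Real.add_one_le_exp s]
  have h2 : 0 ≤ a ^ (-5 / 2 : ℝ) := by positivity
  nlinarith

theorem abs_hessHeat_le_of_small (i j : Fin 3) {a : ℝ} (ha : 0 < a) {z : E3} (hz : z ≠ 0) :
    |hessHeat i j a z| ≤ 56 * ‖z‖⁻¹ ^ 4 * a ^ (-1 / 2 : ℝ) := by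
  refine (abs_hessHeat_le i j ha z).trans ?_
  have hz' : 0 < ‖z‖ := norm_pos_iff.2 hz
  set s := Real.pi ^ 2 * ‖z‖ ^ 2 / a with hs_def
  have hs : 0 ≤ s := by positivity
  have h1 : (2 * s + 1) * s ^ 2 ≤ 14 * Real.exp s := by
    have e2 := Real.pow_div_factorial_le_exp s hs 2
    have e3 := Real.pow_div_factorial_le_exp s hs 3
    norm_num [Nat.factorial] at e2 e3
    nlinarith
  have h2 : (2 * s + 1) * Real.exp (-s) ≤ 14 * (a ^ 2 * ‖z‖⁻¹ ^ 4) := by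
    rw [Real.exp_neg, ← div_eq_mul_inv, div_le_iff₀ (Real.exp_pos _)]
    have h3 : 1 ≤ s ^ 2 * (a ^ 2 * ‖z‖⁻¹ ^ 4) := by
      have : s ^ 2 * (a ^ 2 * ‖z‖⁻¹ ^ 4) = Real.pi ^ 4 := by rw [hs_def]; field_simp
      rw [this]
      exact one_le_pow₀ (by linarith [Real.pi_gt_three])
    have h4 : 0 ≤ a ^ 2 * ‖z‖⁻¹ ^ 4 := by positivity
    nlinarith [mul_le_mul_of_nonneg_right h1 h4,
      mul_le_mul_of_nonneg_left h3 (by positivity : 0 ≤ 2 * s + 1)]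
  have ha' : a ^ (-1 / 2 : ℝ) = a ^ (-5 / 2 : ℝ) * a ^ 2 := by
    rw [← Real.rpow_natCast a 2, ← Real.rpow_add ha]; norm_num
  calc _ ≤ 4 * a ^ (-5 / 2 : ℝ) * (14 * (a ^ 2 * ‖z‖⁻¹ ^ 4)) := by gcongr
    _ = _ := by rw [ha']; ring

theorem lintegral_hessHeat_le (i j : Fin 3) {z : E3} (hz : z ≠ 0) :
    ∫⁻ a in Ioi (0 : ℝ), ENNReal.ofReal |hessHeat i j a z| ≤ ENNReal.ofReal (120 * ‖z‖⁻¹ ^ 3) := by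
  have hz' : 0 < ‖z‖ := norm_pos_iff.2 hz
  set r := ‖z‖ ^ 2 with hr
  have hr0 : 0 < r := by positivity
  have hsq : ∀ s : ℝ, r ^ s = ‖z‖ ^ (2 * s) := fun s => by
    rw [hr, ← Real.rpow_natCast, ← Real.rpow_mul hz'.le]; norm_num
  rw [← Ioc_union_Ioi_eq_Ioi hr0.le, lintegral_union measurableSet_Ioi
    (Set.Ioc_disjoint_Ioi le_rfl)]
  have h1 : ∫⁻ a in Ioc 0 r, ENNReal.ofReal |hessHeat i j a z| ≤
      ENNReal.ofReal (112 * ‖z‖⁻¹ ^ 3) := by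
    have hint : IntegrableOn (fun a : ℝ => 56 * ‖z‖⁻¹ ^ 4 * a ^ (-1 / 2 : ℝ)) (Ioc 0 r) :=
      ((intervalIntegrable_iff_integrableOn_Ioc_of_le hr0.le).1
        (intervalIntegral.intervalIntegrable_rpow' (by norm_num))).const_mul _
    calc _ ≤ ∫⁻ a in Ioc 0 r, ENNReal.ofReal (56 * ‖z‖⁻¹ ^ 4 * a ^ (-1 / 2 : ℝ)) :=
          setLIntegral_mono' measurableSet_Ioc fun a ha =>
            ENNReal.ofReal_le_ofReal (abs_hessHeat_le_of_small i j ha.1 hz)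
      _ = ENNReal.ofReal (∫ a in Ioc 0 r, 56 * ‖z‖⁻¹ ^ 4 * a ^ (-1 / 2 : ℝ)) := by
          rw [ofReal_integral_eq_lintegral_ofReal hint]
          filter_upwards [ae_restrict_mem measurableSet_Ioc] with a ha
          have := ha.1
          positivity
      _ = _ := by
          congr 1
          rw [integral_const_mul, ← intervalIntegral.integral_of_le hr0.le,
            integral_rpow (Or.inl (by norm_num)), Real.zero_rpow (by norm_num), hsq]
          norm_num
          field_simp
          norm_num
  have h2 : ∫⁻ a in Ioi r, ENNReal.ofReal |hessHeat i j a z| ≤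
      ENNReal.ofReal (8 * ‖z‖⁻¹ ^ 3) := by
    have hint : IntegrableOn (fun a : ℝ => 8 * a ^ (-5 / 2 : ℝ)) (Ioi r) :=
      (integrableOn_Ioi_rpow_of_lt (by norm_num) hr0).const_mul _
    calc _ ≤ ∫⁻ a in Ioi r, ENNReal.ofReal (8 * a ^ (-5 / 2 : ℝ)) :=
          setLIntegral_mono' measurableSet_Ioi fun a ha =>
            ENNReal.ofReal_le_ofReal (abs_hessHeat_le_of_large i j (hr0.trans ha) z)
      _ = ENNReal.ofReal (∫ a in Ioi r, 8 * a ^ (-5 / 2 : ℝ)) := by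
          rw [ofReal_integral_eq_lintegral_ofReal hint]
          filter_upwards [ae_restrict_mem measurableSet_Ioi] with a ha
          have : 0 < a := hr0.trans ha
          positivity
      _ ≤ _ := by
          refine ENNReal.ofReal_le_ofReal ?_
          rw [integral_const_mul, integral_Ioi_rpow_of_lt (by norm_num) hr0, hsq]
          norm_num
          have : 0 < (‖z‖ ^ 3)⁻¹ := by positivity
          linarith
  refine (add_le_add h1 h2).trans_eq ?_
  rw [← ENNReal.ofReal_add (by positivity) (by positivity)]
  congr 1
  ring

theorem measurable_hessHeat (i j : Fin 3) :
    Measurable (fun q : ℝ × E3 => hessHeat i j q.1 q.2) := by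
  unfold hessHeat heatKernel
  fun_prop

/-- The bracket `(1 + |x|²)^{1/2}`. -/
noncomputable def bracket (x : E3) : ℝ := Real.sqrt (1 + ‖x‖ ^ 2)

theorem bracket_pos (x : E3) : 0 < bracket x := Real.sqrt_pos.2 (by positivity)

theorem one_le_bracket (x : E3) : 1 ≤ bracket x :=
  Real.one_le_sqrt.2 (by nlinarith [sq_nonneg ‖x‖])

theorem bracket_sq (x : E3) : bracket x ^ 2 = 1 + ‖x‖ ^ 2 := Real.sq_sqrt (by positivity)

theorem norm_le_bracket (x : E3) : ‖x‖ ≤ bracket x :=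
  Real.le_sqrt_of_sq_le (by linarith)

theorem contDiff_bracket : ContDiff ℝ ∞ bracket :=
  ContDiff.sqrt (contDiff_const.add (contDiff_norm_sq ℝ)) (fun x => by positivity)

theorem continuous_bracket : Continuous bracket := contDiff_bracket.continuous

theorem bracket_le_add (x y : E3) : bracket x ≤ bracket y + ‖x - y‖ := by
  have h1 : ‖x‖ ≤ ‖y‖ + ‖x - y‖ := by
    have := norm_add_le y (x - y); simpa using this
  refine Real.sqrt_le_iff.2 ⟨by have := bracket_pos y; positivity, ?_⟩
  have h2 := bracket_sq y
  have h3 := norm_le_bracket y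
  have h4 : ‖x‖ ^ 2 ≤ (‖y‖ + ‖x - y‖) ^ 2 := by gcongr
  nlinarith [norm_nonneg (x - y), norm_nonneg y]

/-- The smooth weight `(1 + |x|²)^{-γ/2}`, equivalent to `weight γ`. -/
noncomputable def smoothWeight (γ : ℝ) (x : E3) : ℝ := bracket x ^ (-γ)

theorem smoothWeight_pos (γ : ℝ) (x : E3) : 0 < smoothWeight γ x :=
  Real.rpow_pos_of_pos (bracket_pos x) _

theorem contDiff_smoothWeight (γ : ℝ) : ContDiff ℝ ∞ (smoothWeight γ) :=
  contDiff_bracket.rpow_const_of_ne fun x => (bracket_pos x).ne'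

theorem continuous_smoothWeight (γ : ℝ) : Continuous (smoothWeight γ) :=
  (contDiff_smoothWeight γ).continuous

theorem smoothWeight_div (γ : ℝ) (x y : E3) :
    smoothWeight γ y / smoothWeight γ x = (bracket x / bracket y) ^ γ := by
  rw [smoothWeight, smoothWeight, Real.rpow_neg (bracket_pos x).le, Real.rpow_neg (bracket_pos y).le,
    Real.div_rpow (bracket_pos x).le (bracket_pos y).le]
  field_simp

theorem abs_rpow_sub_one_le {r γ : ℝ} (hr : 0 < r) (hγ : 0 ≤ γ) (hγ2 : γ ≤ 2) :
    |r ^ γ - 1| ≤ |r ^ 2 - 1| := by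
  rcases le_total 1 r with h | h
  · have h1 : 1 ≤ r ^ γ := Real.one_le_rpow h hγ
    have h2 : r ^ γ ≤ r ^ (2 : ℝ) := Real.rpow_le_rpow_of_exponent_le h hγ2
    rw [Real.rpow_two] at h2
    rw [abs_of_nonneg (by linarith), abs_of_nonneg (by linarith)]
    linarith
  · have h1 : r ^ γ ≤ 1 := Real.rpow_le_one hr.le h hγ
    have h2 : r ^ (2 : ℝ) ≤ r ^ γ := Real.rpow_le_rpow_of_exponent_ge hr h hγ2
    rw [Real.rpow_two] at h2
    rw [abs_of_nonpos (by linarith), abs_of_nonpos (by linarith)]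
    linarith

/-- The part near the diagonal of the kernel of the commutator of `R_i R_j` with the weight. -/
noncomputable def nearKernel (x y : E3) : ℝ :=
  if ‖x - y‖ < bracket y / 4 then ‖x - y‖⁻¹ ^ 2 / bracket y else 0

theorem commutator_kernel_le {γ : ℝ} (hγ : 0 ≤ γ) (hγ2 : γ ≤ 2) {x y : E3} (hxy : x ≠ y) :
    ‖x - y‖⁻¹ ^ 3 * |smoothWeight γ y / smoothWeight γ x - 1| ≤
      3 * nearKernel x y + 250 * ((bracket x)⁻¹ * (bracket y)⁻¹ ^ 2) := by
  have hd : 0 < ‖x - y‖ := norm_pos_iff.2 (sub_ne_zero.2 hxy)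
  have hx := bracket_pos x
  have hy := bracket_pos y
  have hxy1 := bracket_le_add x y
  have hxy2 := bracket_le_add y x
  rw [norm_sub_rev y x] at hxy2
  rw [smoothWeight_div]
  have h1 := abs_rpow_sub_one_le (div_pos hx hy) hγ hγ2
  set d := ‖x - y‖
  set X := bracket x
  set Y := bracket y
  by_cases h : d < Y / 4
  · rw [nearKernel, if_pos h]
    have h2 : |(X / Y) ^ 2 - 1| ≤ 3 * (d / Y) := by
      rw [show (X / Y) ^ 2 - 1 = (X / Y + 1) * ((X - Y) / Y) by field_simp; ring, abs_mul, abs_div,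
        abs_of_pos hy, abs_of_pos (by positivity : 0 < X / Y + 1)]
      have h3 : |X - Y| ≤ d := abs_le.2 ⟨by linarith, by linarith⟩
      have h4 : X / Y + 1 ≤ 3 := by
        have : X / Y ≤ 2 := (div_le_iff₀ hy).2 (by linarith)
        linarith
      gcongr
    calc d⁻¹ ^ 3 * |(X / Y) ^ γ - 1| ≤ d⁻¹ ^ 3 * (3 * (d / Y)) := by gcongr; exact h1.trans h2
      _ = 3 * (d⁻¹ ^ 2 / Y) := by field_simp
      _ ≤ _ := by
        have : 0 ≤ 250 * (X⁻¹ * Y⁻¹ ^ 2) := by positivity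
        exact le_add_of_nonneg_right this
  · rw [nearKernel, if_neg h, mul_zero, zero_add]
    push Not at h
    have hX : X ≤ 5 * d := by linarith
    have hY : Y ≤ 5 * d := by linarith
    have h2 : |(X / Y) ^ 2 - 1| ≤ (X / Y) ^ 2 + 1 := by
      refine (abs_sub _ _).trans_eq ?_
      rw [abs_of_nonneg (sq_nonneg _), abs_one]
    refine (mul_le_mul_of_nonneg_left (h1.trans h2) (by positivity)).trans ?_
    have e1 : X ^ 3 ≤ 125 * d ^ 3 := by
      calc X ^ 3 ≤ (5 * d) ^ 3 := by gcongr
        _ = _ := by ring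
    have e2 : Y ^ 2 * X ≤ 125 * d ^ 3 := by
      calc Y ^ 2 * X ≤ (5 * d) ^ 2 * (5 * d) := by gcongr
        _ = _ := by ring
    have : d⁻¹ ^ 3 * ((X / Y) ^ 2 + 1) = (X ^ 3 + Y ^ 2 * X) / (d ^ 3 * (X * Y ^ 2)) := by
      field_simp
    rw [this, div_le_iff₀ (by positivity)]
    have h5 : 250 * (X⁻¹ * Y⁻¹ ^ 2) * (d ^ 3 * (X * Y ^ 2)) = 250 * d ^ 3 := by field_simp
    rw [h5]
    linarith

end AdvDiff

/-- **Schur's test** for the bilinear form with kernel `k`. -/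
theorem lintegral_lintegral_mul_le_of_schur {α β : Type*} [MeasurableSpace α] [MeasurableSpace β]
    {μ : Measure α} {ν : Measure β} [SFinite μ] [SFinite ν] {k : α → β → ℝ≥0∞}
    (hk : Measurable (Function.uncurry k)) {A : ℝ≥0∞} (h₁ : ∀ x, ∫⁻ y, k x y ∂ν ≤ A)
    (h₂ : ∀ y, ∫⁻ x, k x y ∂μ ≤ A) {F : α → ℝ≥0∞} {G : β → ℝ≥0∞} (hF : AEMeasurable F μ)
    (hG : AEMeasurable G ν) :
    ∫⁻ x, ∫⁻ y, F x * G y * k x y ∂ν ∂μ ≤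
      A * ((∫⁻ x, F x ^ (2 : ℝ) ∂μ) ^ (1 / 2 : ℝ) * (∫⁻ y, G y ^ (2 : ℝ) ∂ν) ^ (1 / 2 : ℝ)) := by
  have hF' : AEMeasurable (fun q : α × β => F q.1) (μ.prod ν) := hF.comp_fst
  have hG' : AEMeasurable (fun q : α × β => G q.2) (μ.prod ν) := hG.comp_snd
  have hk' : AEMeasurable (fun q : α × β => k q.1 q.2) (μ.prod ν) := hk.aemeasurable
  have hsq : ∀ a : ℝ≥0∞, a ^ (1 / 2 : ℝ) * a ^ (1 / 2 : ℝ) = a := fun a => by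
    rw [← ENNReal.rpow_add_of_nonneg _ _ (by norm_num) (by norm_num)]; norm_num
  have hsq' : ∀ a : ℝ≥0∞, (a ^ (1 / 2 : ℝ)) ^ (2 : ℝ) = a := fun a => by
    rw [← ENNReal.rpow_mul]; norm_num
  have e1 : ∫⁻ x, ∫⁻ y, F x * G y * k x y ∂ν ∂μ = ∫⁻ q, ((fun q : α × β => F q.1 * k q.1 q.2 ^
      (1 / 2 : ℝ)) * fun q : α × β => G q.2 * k q.1 q.2 ^ (1 / 2 : ℝ)) q ∂(μ.prod ν) := by
    have hm : AEMeasurable ((fun q : α × β => F q.1 * k q.1 q.2 ^ (1 / 2 : ℝ)) *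
        fun q : α × β => G q.2 * k q.1 q.2 ^ (1 / 2 : ℝ)) (μ.prod ν) :=
      (hF'.mul (hk'.pow_const _)).mul (hG'.mul (hk'.pow_const _))
    rw [lintegral_prod _ hm]
    refine lintegral_congr fun x => lintegral_congr fun y => ?_
    simp only [Pi.mul_apply]
    calc _ = F x * G y * (k x y ^ (1 / 2 : ℝ) * k x y ^ (1 / 2 : ℝ)) := by rw [hsq]
      _ = _ := by ring
  rw [e1]
  refine (ENNReal.lintegral_mul_le_Lp_mul_Lq _ Real.HolderConjugate.two_two
    (hF'.mul (hk'.pow_const _)) (hG'.mul (hk'.pow_const _))).trans ?_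
  have hmr : ∀ a b : ℝ≥0∞, (a * b ^ (1 / 2 : ℝ)) ^ (2 : ℝ) = a ^ (2 : ℝ) * b := fun a b => by
    rw [ENNReal.mul_rpow_of_nonneg _ _ (by norm_num), hsq']
  simp only [Pi.mul_apply, hmr]
  have i1 : ∫⁻ q, F q.1 ^ (2 : ℝ) * k q.1 q.2 ∂(μ.prod ν) ≤ A * ∫⁻ x, F x ^ (2 : ℝ) ∂μ := by
    rw [lintegral_prod (fun q : α × β => F q.1 ^ (2 : ℝ) * k q.1 q.2) (by fun_prop)]
    simp only
    calc _ = ∫⁻ x, F x ^ (2 : ℝ) * ∫⁻ y, k x y ∂ν ∂μ := by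
          refine lintegral_congr fun x => lintegral_const_mul _ ?_
          exact hk.comp measurable_prodMk_left
      _ ≤ ∫⁻ x, F x ^ (2 : ℝ) * A ∂μ := by gcongr with x; exact h₁ x
      _ = _ := by rw [lintegral_mul_const'' _ (hF.pow_const _), mul_comm]
  have i2 : ∫⁻ q, G q.2 ^ (2 : ℝ) * k q.1 q.2 ∂(μ.prod ν) ≤ A * ∫⁻ y, G y ^ (2 : ℝ) ∂ν := by
    rw [lintegral_prod_symm (fun q : α × β => G q.2 ^ (2 : ℝ) * k q.1 q.2) (by fun_prop)]
    simp only
    calc _ = ∫⁻ y, G y ^ (2 : ℝ) * ∫⁻ x, k x y ∂μ ∂ν := by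
          refine lintegral_congr fun x => lintegral_const_mul _ ?_
          exact hk.comp measurable_prodMk_right
      _ ≤ ∫⁻ x, G x ^ (2 : ℝ) * A ∂ν := by gcongr with x; exact h₂ x
      _ = _ := by rw [lintegral_mul_const'' _ (hG.pow_const _), mul_comm]
  refine (mul_le_mul' (ENNReal.rpow_le_rpow i1 (by norm_num))
    (ENNReal.rpow_le_rpow i2 (by norm_num))).trans_eq ?_
  rw [ENNReal.mul_rpow_of_nonneg _ _ (by norm_num), ENNReal.mul_rpow_of_nonneg _ _ (by norm_num)]
  calc _ = (A ^ (1 / 2 : ℝ) * A ^ (1 / 2 : ℝ)) * ((∫⁻ x, F x ^ (2 : ℝ) ∂μ) ^ (1 / 2 : ℝ) *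
        (∫⁻ y, G y ^ (2 : ℝ) ∂ν) ^ (1 / 2 : ℝ)) := by ring
    _ = _ := by rw [hsq]

namespace AdvDiff

theorem lintegral_norm_inv_sq_ball (R : ℝ) (hR : 0 ≤ R) :
    ∫⁻ z : E3, (if ‖z‖ < R then ENNReal.ofReal (‖z‖⁻¹ ^ 2) else 0) =
      ENNReal.ofReal (3 * (volume (Metric.ball (0 : E3) 1)).toReal * R) := by
  let f : ℝ → ℝ := fun r => if r < R then r⁻¹ ^ 2 else 0
  have hdim : Module.finrank ℝ E3 = 3 := by simp
  have hcongr : ∀ y ∈ Ioi (0 : ℝ), y ^ (Module.finrank ℝ E3 - 1) • f y =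
      (Ioo 0 R).indicator (fun _ => (1 : ℝ)) y := by
    intro y hy
    have hy' : (0 : ℝ) < y := hy
    simp only [hdim, f, indicator, mem_Ioo, hy', true_and, smul_eq_mul]
    split_ifs
    · field_simp
    · simp
  have hint : Integrable (fun z : E3 => f ‖z‖) := by
    rw [integrable_fun_norm_addHaar volume, integrableOn_congr_fun hcongr measurableSet_Ioi]
    refine IntegrableOn.integrable_indicator ?_ measurableSet_Ioo |>.integrableOn
    exact integrableOn_const (by simp)
  have h := integral_fun_norm_addHaar (volume : Measure E3) f
  rw [setIntegral_congr_fun measurableSet_Ioi hcongr, setIntegral_indicator measurableSet_Ioo,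
    inter_eq_right.2 Ioo_subset_Ioi_self, hdim] at h
  simp only [integral_const, MeasurableSet.univ, measureReal_restrict_apply, univ_inter,
    Real.volume_real_Ioo_of_le hR, smul_eq_mul, mul_one, sub_zero, nsmul_eq_mul] at h
  have h0 : ∀ z : E3, 0 ≤ f ‖z‖ := fun z => by simp only [f]; split_ifs <;> positivity
  calc _ = ∫⁻ z : E3, ENNReal.ofReal (f ‖z‖) := by
        refine lintegral_congr fun z => ?_
        simp only [f]
        split_ifs <;> simp
    _ = ENNReal.ofReal (∫ z : E3, f ‖z‖) :=
        (ofReal_integral_eq_lintegral_ofReal hint (Eventually.of_forall h0)).symm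
    _ = _ := by rw [h]; congr 1; simp [Measure.real]; ring

theorem measurable_nearKernel : Measurable (Function.uncurry nearKernel) := by
  have := continuous_bracket.measurable
  unfold nearKernel Function.uncurry
  refine Measurable.ite (measurableSet_lt (by fun_prop) (by fun_prop)) (by fun_prop) (by fun_prop)

theorem nearKernel_nonneg (x y : E3) : 0 ≤ nearKernel x y := by
  have := bracket_pos y
  unfold nearKernel
  split_ifs <;> positivity

theorem exists_schur_nearKernel : ∃ A : ℝ≥0∞, A ≠ ⊤ ∧
    (∀ x, ∫⁻ y, ENNReal.ofReal (nearKernel x y) ≤ A) ∧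
    (∀ y, ∫⁻ x, ENNReal.ofReal (nearKernel x y) ≤ A) := by
  refine ⟨ENNReal.ofReal (3 * (volume (Metric.ball (0 : E3) 1)).toReal), ENNReal.ofReal_ne_top,
    fun x => ?_, fun y => ?_⟩
  · have hx := bracket_pos x
    have hb : ∀ y, ENNReal.ofReal (nearKernel x y) ≤ ENNReal.ofReal (5 / 4 * (bracket x)⁻¹) *
        (if ‖x - y‖ < bracket x / 3 then ENNReal.ofReal (‖x - y‖⁻¹ ^ 2) else 0) := by
      intro y
      have hy := bracket_pos y
      have h1 := bracket_le_add x y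
      have h2 := bracket_le_add y x
      rw [norm_sub_rev] at h2
      unfold nearKernel
      split_ifs with h h'
      · rw [← ENNReal.ofReal_mul (by positivity)]
        refine ENNReal.ofReal_le_ofReal ?_
        rw [div_eq_mul_inv, mul_comm]
        refine mul_le_mul_of_nonneg_right ?_ (by positivity)
        rw [← div_eq_mul_inv, inv_le_comm₀ hy (by positivity), inv_div, div_le_iff₀ (by norm_num)]
        linarith
      · exact absurd (by linarith : ‖x - y‖ < bracket x / 3) h'
      · simp
      · simp
    refine (lintegral_mono hb).trans ?_
    rw [lintegral_const_mul' _ _ ENNReal.ofReal_ne_top,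
      lintegral_sub_left_eq_self (fun z : E3 => if ‖z‖ < bracket x / 3 then
        ENNReal.ofReal (‖z‖⁻¹ ^ 2) else 0) x, lintegral_norm_inv_sq_ball _ (by positivity),
      ← ENNReal.ofReal_mul (by positivity)]
    refine ENNReal.ofReal_le_ofReal ?_
    field_simp
    norm_num
  · have hy := bracket_pos y
    have hb : ∀ x, ENNReal.ofReal (nearKernel x y) = ENNReal.ofReal ((bracket y)⁻¹) *
        (if ‖x - y‖ < bracket y / 4 then ENNReal.ofReal (‖x - y‖⁻¹ ^ 2) else 0) := by
      intro x
      unfold nearKernel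
      split_ifs with h
      · rw [← ENNReal.ofReal_mul (by positivity), div_eq_mul_inv, mul_comm]
      · simp
    rw [lintegral_congr hb, lintegral_const_mul' _ _ ENNReal.ofReal_ne_top,
      lintegral_sub_right_eq_self (fun z : E3 => if ‖z‖ < bracket y / 4 then
        ENNReal.ofReal (‖z‖⁻¹ ^ 2) else 0) y, lintegral_norm_inv_sq_ball _ (by positivity),
      ← ENNReal.ofReal_mul (by positivity)]
    refine ENNReal.ofReal_le_ofReal ?_
    field_simp
    have : 0 ≤ (volume (Metric.ball (0 : E3) 1)).toReal := ENNReal.toReal_nonneg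
    linarith

theorem lintegral_bracket_rpow_lt_top {r : ℝ} (hr : 3 < r) :
    ∫⁻ x : E3, ENNReal.ofReal ((bracket x)⁻¹) ^ r < ⊤ := by
  have h := integrable_rpow_neg_one_add_norm_sq (E := E3) (μ := volume) (r := r) (by simpa using hr)
  refine lt_of_eq_of_lt (lintegral_congr fun x => ?_) h.lintegral_lt_top
  have := bracket_pos x
  rw [ENNReal.ofReal_rpow_of_nonneg (by positivity) (by linarith)]
  congr 1
  rw [bracket, Real.sqrt_eq_rpow, ← Real.rpow_neg (by positivity), ← Real.rpow_mul (by positivity)]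
  ring_nf

theorem exists_lintegral_mul_bracket_le : ∃ A : ℝ≥0∞, A ≠ ⊤ ∧ ∀ F G : E3 → ℝ≥0∞,
    AEMeasurable F → AEMeasurable G →
    ∫⁻ x, ∫⁻ y, F x * G y * ENNReal.ofReal ((bracket x)⁻¹ * (bracket y)⁻¹ ^ 2) ≤
      A * ((∫⁻ x, F x ^ (6 / 5 : ℝ)) ^ (5 / 6 : ℝ) * (∫⁻ y, G y ^ (2 : ℝ)) ^ (1 / 2 : ℝ)) := by
  have hbm : Measurable fun x : E3 => ENNReal.ofReal ((bracket x)⁻¹) :=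
    continuous_bracket.measurable.inv.ennreal_ofReal
  refine ⟨(∫⁻ x : E3, ENNReal.ofReal ((bracket x)⁻¹) ^ (6 : ℝ)) ^ (1 / 6 : ℝ) *
    (∫⁻ x : E3, ENNReal.ofReal ((bracket x)⁻¹) ^ (4 : ℝ)) ^ (1 / 2 : ℝ), ?_, ?_⟩
  · exact (ENNReal.mul_lt_top
      (ENNReal.rpow_lt_top_of_nonneg (by norm_num) (lintegral_bracket_rpow_lt_top (by norm_num)).ne)
      (ENNReal.rpow_lt_top_of_nonneg (by norm_num)
        (lintegral_bracket_rpow_lt_top (by norm_num)).ne)).ne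
  intro F G hF hG
  have e1 : ∫⁻ x, ∫⁻ y, F x * G y * ENNReal.ofReal ((bracket x)⁻¹ * (bracket y)⁻¹ ^ 2) =
      (∫⁻ x, F x * ENNReal.ofReal ((bracket x)⁻¹)) *
        ∫⁻ y, G y * ENNReal.ofReal ((bracket y)⁻¹) ^ (2 : ℝ) := by
    have hF' : AEMeasurable (fun x => F x * ENNReal.ofReal ((bracket x)⁻¹)) :=
      hF.mul hbm.aemeasurable
    rw [← lintegral_mul_const'' _ hF']
    refine lintegral_congr fun x => ?_
    have hG' : AEMeasurable (fun y => G y * ENNReal.ofReal ((bracket y)⁻¹) ^ (2 : ℝ)) :=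
      hG.mul (hbm.pow_const _).aemeasurable
    rw [← lintegral_const_mul'' _ hG']
    refine lintegral_congr fun y => ?_
    have hx := bracket_pos x
    have hy := bracket_pos y
    rw [ENNReal.ofReal_mul (by positivity), ENNReal.rpow_two, ENNReal.ofReal_pow (by positivity)]
    ring
  have i1 := ENNReal.lintegral_mul_le_Lp_mul_Lq (volume : Measure E3) (p := 6 / 5) (q := 6)
    (Real.holderConjugate_iff.2 (by norm_num)) hF hbm.aemeasurable
  have i2 := ENNReal.lintegral_mul_le_Lp_mul_Lq (volume : Measure E3) Real.HolderConjugate.two_two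
    hG (hbm.pow_const (2 : ℝ)).aemeasurable
  have e2 : ∀ y : E3, (ENNReal.ofReal ((bracket y)⁻¹) ^ (2 : ℝ)) ^ (2 : ℝ)
      = ENNReal.ofReal ((bracket y)⁻¹) ^ (4 : ℝ) := fun y => by
    rw [← ENNReal.rpow_mul]; norm_num
  simp only [Pi.mul_apply, e2] at i1 i2
  rw [show (1 / (6 / 5) : ℝ) = 5 / 6 by norm_num] at i1
  rw [e1]
  refine (mul_le_mul' i1 i2).trans_eq ?_
  ring

end AdvDiff

namespace AdvDiff

theorem eLpNorm_two_eq {α : Type*} [MeasurableSpace α] {μ : Measure α} (F : α → ℝ) :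
    eLpNorm F 2 μ = (∫⁻ x, ‖F x‖ₑ ^ (2 : ℝ) ∂μ) ^ (1 / 2 : ℝ) := by
  rw [eLpNorm_eq_lintegral_rpow_enorm_toReal (by norm_num) (by norm_num)]
  simp

theorem eLpNorm_six_fifths_eq {α : Type*} [MeasurableSpace α] {μ : Measure α} (F : α → ℝ) :
    eLpNorm F (6 / 5) μ = (∫⁻ x, ‖F x‖ₑ ^ (6 / 5 : ℝ) ∂μ) ^ (5 / 6 : ℝ) := by
  rw [eLpNorm_eq_lintegral_rpow_enorm_toReal (by simp) (ENNReal.div_ne_top (by simp) (by simp))]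
  simp

theorem lintegral_commutator_le {γ : ℝ} (hγ : 0 ≤ γ) (hγ2 : γ ≤ 2) (i j : Fin 3) (u v : ℝ)
    (x y : E3) :
    ∫⁻ a in Ioi (0 : ℝ), ‖u * v *
        (hessHeat i j a (x - y) * (smoothWeight γ y / smoothWeight γ x - 1))‖ₑ ≤
      120 * (3 * (‖u‖ₑ * ‖v‖ₑ * ENNReal.ofReal (nearKernel x y)) +
        250 * (‖u‖ₑ * ‖v‖ₑ * ENNReal.ofReal ((bracket x)⁻¹ * (bracket y)⁻¹ ^ 2))) := by
  by_cases hxy : x = y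
  · subst hxy
    simp [div_self (smoothWeight_pos γ x).ne']
  have h1 := lintegral_hessHeat_le i j (sub_ne_zero.2 hxy)
  have h2 := commutator_kernel_le hγ hγ2 hxy
  have hn := nearKernel_nonneg x y
  have hx := bracket_pos x
  have hy := bracket_pos y
  calc _ = (∫⁻ a in Ioi (0 : ℝ), ENNReal.ofReal |hessHeat i j a (x - y)|) *
        (‖u‖ₑ * ‖v‖ₑ * ENNReal.ofReal |smoothWeight γ y / smoothWeight γ x - 1|) := by
        rw [← lintegral_mul_const' _ _ (by finiteness)]
        refine lintegral_congr fun a => ?_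
        simp only [enorm_mul, Real.enorm_eq_ofReal_abs]
        ring
    _ ≤ ENNReal.ofReal (120 * ‖x - y‖⁻¹ ^ 3) *
        (‖u‖ₑ * ‖v‖ₑ * ENNReal.ofReal |smoothWeight γ y / smoothWeight γ x - 1|) := by
        gcongr
    _ = 120 * (‖u‖ₑ * ‖v‖ₑ) * ENNReal.ofReal
        (‖x - y‖⁻¹ ^ 3 * |smoothWeight γ y / smoothWeight γ x - 1|) := by
        rw [ENNReal.ofReal_mul (by positivity), ENNReal.ofReal_mul (by positivity)]
        norm_num
        ring
    _ ≤ 120 * (‖u‖ₑ * ‖v‖ₑ) * ENNReal.ofReal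
        (3 * nearKernel x y + 250 * ((bracket x)⁻¹ * (bracket y)⁻¹ ^ 2)) := by gcongr
    _ = _ := by
        rw [ENNReal.ofReal_add (by positivity) (by positivity), ENNReal.ofReal_mul (by norm_num),
          ENNReal.ofReal_mul (p := 250) (by norm_num)]
        norm_num
        ring

set_option maxHeartbeats 1000000 in
theorem exists_commutator_le : ∃ A : ℝ≥0∞, A ≠ ⊤ ∧ ∀ γ : ℝ, 0 ≤ γ → γ ≤ 2 → ∀ (i j : Fin 3)
    (F G : E3 → ℝ), AEStronglyMeasurable F → AEStronglyMeasurable G →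
    ∫⁻ a in Ioi (0 : ℝ), ∫⁻ q : E3 × E3, ‖F q.1 * G q.2 *
        (hessHeat i j a (q.1 - q.2) * (smoothWeight γ q.2 / smoothWeight γ q.1 - 1))‖ₑ ≤
      A * ((eLpNorm F 2 volume + eLpNorm F (6 / 5) volume) * eLpNorm G 2 volume) := by
  obtain ⟨A₁, hA₁, hs1, hs2⟩ := exists_schur_nearKernel
  obtain ⟨A₂, hA₂, hp⟩ := exists_lintegral_mul_bracket_le
  refine ⟨120 * (3 * A₁ + 250 * A₂), by finiteness, ?_⟩
  intro γ hγ hγ2 i j F G hF hG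
  have hFm : AEMeasurable (fun x => ‖F x‖ₑ) := hF.enorm
  have hGm : AEMeasurable (fun x => ‖G x‖ₑ) := hG.enorm
  have hF' : AEStronglyMeasurable (fun q : E3 × E3 => F q.1) (volume.prod volume) := hF.comp_fst
  have hG' : AEStronglyMeasurable (fun q : E3 × E3 => G q.2) (volume.prod volume) := hG.comp_snd
  have hW := continuous_smoothWeight γ
  have hw : Measurable fun q : E3 × E3 => smoothWeight γ q.2 / smoothWeight γ q.1 - 1 := by
    have := hW.measurable
    fun_prop
  have hk : Measurable fun r : ℝ × (E3 × E3) => hessHeat i j r.1 (r.2.1 - r.2.2) :=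
    (measurable_hessHeat i j).comp (by fun_prop : Measurable fun r : ℝ × (E3 × E3) =>
      (r.1, r.2.1 - r.2.2))
  have hmeas : AEMeasurable (Function.uncurry fun (a : ℝ) (q : E3 × E3) => ‖F q.1 * G q.2 *
      (hessHeat i j a (q.1 - q.2) * (smoothWeight γ q.2 / smoothWeight γ q.1 - 1))‖ₑ)
      ((volume.restrict (Ioi 0)).prod (volume : Measure (E3 × E3))) := by
    have h1 : AEStronglyMeasurable (fun r : ℝ × (E3 × E3) => F r.2.1 * G r.2.2)
        ((volume.restrict (Ioi 0)).prod (volume : Measure (E3 × E3))) :=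
      (hF'.mul hG').comp_snd
    have h2 : AEStronglyMeasurable (fun r : ℝ × (E3 × E3) => hessHeat i j r.1 (r.2.1 - r.2.2) *
        (smoothWeight γ r.2.2 / smoothWeight γ r.2.1 - 1))
        ((volume.restrict (Ioi 0)).prod (volume : Measure (E3 × E3))) :=
      (hk.mul (hw.comp measurable_snd)).aestronglyMeasurable
    exact (h1.mul h2).enorm
  rw [lintegral_lintegral_swap hmeas]
  have hpt := fun q : E3 × E3 => lintegral_commutator_le hγ hγ2 i j (F q.1) (G q.2) q.1 q.2
  have hm0 : AEMeasurable (fun q : E3 × E3 => ‖F q.1‖ₑ * ‖G q.2‖ₑ) (volume.prod volume) :=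
    hF'.enorm.mul hG'.enorm
  have hmn : AEMeasurable (fun q : E3 × E3 => ‖F q.1‖ₑ * ‖G q.2‖ₑ *
      ENNReal.ofReal (nearKernel q.1 q.2)) (volume.prod volume) :=
    hm0.mul measurable_nearKernel.ennreal_ofReal.aemeasurable
  have hmb : AEMeasurable (fun q : E3 × E3 => ‖F q.1‖ₑ * ‖G q.2‖ₑ *
      ENNReal.ofReal ((bracket q.1)⁻¹ * (bracket q.2)⁻¹ ^ 2)) (volume.prod volume) := by
    have := continuous_bracket.measurable
    exact hm0.mul (by fun_prop)
  refine (lintegral_mono hpt).trans ?_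
  rw [Measure.volume_eq_prod, lintegral_const_mul' _ _ (by norm_num),
    lintegral_add_left' (hmn.const_mul _), lintegral_const_mul' _ _ (by norm_num),
    lintegral_const_mul' _ _ (by norm_num), lintegral_prod _ hmn, lintegral_prod _ hmb]
  have e1 := lintegral_lintegral_mul_le_of_schur measurable_nearKernel.ennreal_ofReal hs1 hs2 hFm hGm
  have e2 := hp _ _ hFm hGm
  rw [← eLpNorm_two_eq, ← eLpNorm_two_eq] at e1
  rw [← eLpNorm_two_eq, ← eLpNorm_six_fifths_eq] at e2
  calc _ ≤ 120 * (3 * (A₁ * (eLpNorm F 2 volume * eLpNorm G 2 volume)) +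
        250 * (A₂ * (eLpNorm F (6 / 5) volume * eLpNorm G 2 volume))) := by
        gcongr
    _ ≤ 120 * (3 * (A₁ * ((eLpNorm F 2 volume + eLpNorm F (6 / 5) volume) * eLpNorm G 2 volume)) +
        250 * (A₂ * ((eLpNorm F 2 volume + eLpNorm F (6 / 5) volume) * eLpNorm G 2 volume))) := by
        gcongr
        · exact le_self_add
        · exact le_add_self
    _ = _ := by ring

theorem integrable_hessHeat_mul (i j : Fin 3) {a : ℝ} (ha : 0 < a) {f ψ : E3 → ℝ}
    (hf : Integrable f) (hψ : Integrable ψ) :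
    Integrable (fun q : E3 × E3 => f q.1 * (hessHeat i j a (q.1 - q.2) * ψ q.2))
      (volume.prod volume) := by
  have hk : Measurable fun q : E3 × E3 => hessHeat i j a (q.1 - q.2) :=
    (measurable_hessHeat i j).comp (by fun_prop : Measurable fun q : E3 × E3 => (a, q.1 - q.2))
  refine ((hf.mul_prod hψ).bdd_mul hk.aestronglyMeasurable (c := 8 * a ^ (-5 / 2 : ℝ))
    (Eventually.of_forall fun q => abs_hessHeat_le_of_large i j ha _)).congr
    (Eventually.of_forall fun q => ?_)
  ring

theorem IsTestSpace.integrable {ψ : E3 → ℝ} (hψ : IsTestSpace ψ) : Integrable ψ :=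
  hψ.1.continuous.integrable_of_hasCompactSupport hψ.2

/-- Weighted estimate for `R_i R_j` in weak form, for integrable and square integrable `f`. -/
theorem exists_pairing_rieszRiesz_le_of_memLp : ∃ A : ℝ≥0∞, A ≠ ⊤ ∧ ∀ γ : ℝ, 0 ≤ γ → γ ≤ 2 →
    ∀ (i j : Fin 3) (F f G ψ : E3 → ℝ), Integrable f → Integrable F → IsTestSpace ψ →
    IsTestSpace G → (∀ x, F x = smoothWeight γ x * f x) → (∀ x, ψ x = smoothWeight γ x * G x) →
    ‖∫ x, f x * rieszRiesz i j ψ x‖ₑ ≤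
      A * ((eLpNorm F 2 volume + eLpNorm F (6 / 5) volume) * eLpNorm G 2 volume) := by
  obtain ⟨A, hA, hcomm⟩ := exists_commutator_le
  refine ⟨A + 1, by finiteness, ?_⟩
  intro γ hγ hγ2 i j F f G ψ hf hF hψ hG hFf hψG
  obtain ⟨i1, e1⟩ := integral_mul_rieszRiesz_eq i j hψ hf
  obtain ⟨i2, e2⟩ := integral_mul_rieszRiesz_eq i j hG hF
  have hdiff : ‖(∫ x, f x * rieszRiesz i j ψ x) - ∫ x, F x * rieszRiesz i j G x‖ₑ ≤
      A * ((eLpNorm F 2 volume + eLpNorm F (6 / 5) volume) * eLpNorm G 2 volume) := by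
    rw [e1, e2, ← integral_sub i1 i2]
    refine (enorm_integral_le_lintegral_enorm _).trans
      (le_trans ?_ (hcomm γ hγ hγ2 i j F G hF.1 hG.integrable.1))
    refine setLIntegral_mono' measurableSet_Ioi fun a ha => ?_
    have j1 := integrable_hessHeat_mul i j ha hf hψ.integrable
    have j2 := integrable_hessHeat_mul i j ha hF hG.integrable
    have h1 : ∫ x, f x * heatRiesz i j a ψ x =
        ∫ q : E3 × E3, f q.1 * (hessHeat i j a (q.1 - q.2) * ψ q.2) := by
      rw [Measure.volume_eq_prod, integral_prod _ j1]
      simp only [integral_const_mul, heatRiesz]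
    have h2 : ∫ x, F x * heatRiesz i j a G x =
        ∫ q : E3 × E3, F q.1 * (hessHeat i j a (q.1 - q.2) * G q.2) := by
      rw [Measure.volume_eq_prod, integral_prod _ j2]
      simp only [integral_const_mul, heatRiesz]
    rw [h1, h2, Measure.volume_eq_prod, ← integral_sub j1 j2]
    refine (enorm_integral_le_lintegral_enorm _).trans_eq (lintegral_congr fun q => ?_)
    congr 1
    have hw := (smoothWeight_pos γ q.1).ne'
    rw [hFf, hψG]
    field_simp
  have hL2 : ‖∫ x, F x * rieszRiesz i j G x‖ₑ ≤ eLpNorm F 2 volume * eLpNorm G 2 volume := by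
    refine (enorm_integral_le_lintegral_enorm _).trans ?_
    rw [← eLpNorm_one_eq_lintegral_enorm]
    refine (eLpNorm_smul_le_mul_eLpNorm (p := 2) (q := 2) (r := 1)
      (continuous_rieszRiesz i j hG).aestronglyMeasurable hF.1).trans ?_
    exact mul_le_mul' le_rfl (eLpNorm_rieszRiesz_le i j hG)
  calc ‖∫ x, f x * rieszRiesz i j ψ x‖ₑ
      = ‖((∫ x, f x * rieszRiesz i j ψ x) - ∫ x, F x * rieszRiesz i j G x) +
          ∫ x, F x * rieszRiesz i j G x‖ₑ := by rw [sub_add_cancel]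
    _ ≤ A * ((eLpNorm F 2 volume + eLpNorm F (6 / 5) volume) * eLpNorm G 2 volume) +
        eLpNorm F 2 volume * eLpNorm G 2 volume := (enorm_add_le _ _).trans (add_le_add hdiff hL2)
    _ ≤ A * ((eLpNorm F 2 volume + eLpNorm F (6 / 5) volume) * eLpNorm G 2 volume) +
        (eLpNorm F 2 volume + eLpNorm F (6 / 5) volume) * eLpNorm G 2 volume := by
        gcongr
        exact le_self_add
    _ = _ := by ring

/-- Weighted estimate for `R_i R_j` in weak form. -/
theorem exists_pairing_rieszRiesz_le : ∃ A : ℝ≥0∞, A ≠ ⊤ ∧ ∀ γ : ℝ, 0 ≤ γ → γ ≤ 2 →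
    ∀ (i j : Fin 3) (f G ψ : E3 → ℝ), AEStronglyMeasurable f → IsTestSpace ψ →
    IsTestSpace G → (∀ x, ψ x = smoothWeight γ x * G x) →
    eLpNorm (fun x => smoothWeight γ x * f x) 2 volume < ⊤ →
    Integrable (fun x => f x * rieszRiesz i j ψ x) →
    ‖∫ x, f x * rieszRiesz i j ψ x‖ₑ ≤
      A * ((eLpNorm (fun x => smoothWeight γ x * f x) 2 volume +
        eLpNorm (fun x => smoothWeight γ x * f x) (6 / 5) volume) * eLpNorm G 2 volume) := by
  obtain ⟨A, hA, h⟩ := exists_pairing_rieszRiesz_le_of_memLp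
  refine ⟨A, hA, fun γ hγ hγ2 i j f G ψ hf hψ hG hψG hfin hint => ?_⟩
  have hWm := (continuous_smoothWeight γ).aestronglyMeasurable (μ := (volume : Measure E3))
  let B : ℕ → Set E3 := fun n => Metric.ball 0 n
  have hB : ∀ n, MeasurableSet (B n) := fun n => measurableSet_ball
  have hlim : Tendsto (fun n => ∫ x in B n, f x * rieszRiesz i j ψ x) atTop
      (𝓝 (∫ x, f x * rieszRiesz i j ψ x)) := by
    have hU : ⋃ n, B n = univ := Metric.iUnion_ball_nat 0
    have := tendsto_setIntegral_of_monotone (μ := volume)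
      (f := fun x => f x * rieszRiesz i j ψ x) hB
      (fun m n hmn => Metric.ball_subset_ball (by exact_mod_cast hmn)) hint.integrableOn
    rwa [hU, setIntegral_univ] at this
  refine le_of_tendsto (hlim.enorm) (Eventually.of_forall fun n => ?_)
  have hWf : MemLp (fun x => smoothWeight γ x * f x) 2 volume := ⟨hWm.mul hf, hfin⟩
  have hFn : IntegrableOn (fun x => smoothWeight γ x * f x) (B n) :=
    (hWf.locallyIntegrable (by norm_num)).integrableOn_isCompact
      (isCompact_closedBall (0 : E3) n) |>.mono_set Metric.ball_subset_closedBall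
  have hfn : IntegrableOn f (B n) := by
    have hc : ContinuousOn (fun x => (smoothWeight γ x)⁻¹) (Metric.closedBall (0 : E3) n) :=
      ((continuous_smoothWeight γ).inv₀ fun x => (smoothWeight_pos γ x).ne').continuousOn
    have := ((hWf.locallyIntegrable (by norm_num)).integrableOn_isCompact
      (isCompact_closedBall (0 : E3) n)).continuousOn_mul hc (isCompact_closedBall (0 : E3) n)
    refine (this.mono_set Metric.ball_subset_closedBall).congr
      (Eventually.of_forall fun x => ?_)
    have := (smoothWeight_pos γ x).ne'
    field_simp
  have key := h γ hγ hγ2 i j ((B n).indicator fun x => smoothWeight γ x * f x) ((B n).indicator f)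
    G ψ (hfn.integrable_indicator (hB n)) (hFn.integrable_indicator (hB n)) hψ hG
    (fun x => by simp only [indicator]; split_ifs <;> simp) hψG
  have e1 : ∫ x in B n, f x * rieszRiesz i j ψ x
      = ∫ x, (B n).indicator f x * rieszRiesz i j ψ x := by
    rw [← integral_indicator (hB n)]
    congr 1
    ext x
    simp only [indicator]
    split_ifs <;> simp
  rw [e1]
  refine key.trans ?_
  gcongr <;> exact eLpNorm_indicator_le _

/-- **Weighted estimate for the pressure.** -/
theorem exists_eLpNorm_rieszSum_le : ∃ A : ℝ≥0∞, A ≠ ⊤ ∧ ∀ γ : ℝ, 0 ≤ γ → γ ≤ 2 →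
    ∀ (f : Fin 3 → Fin 3 → E3 → ℝ) (q : E3 → ℝ), (∀ i j, AEStronglyMeasurable (f i j)) →
    IsRieszSum f q →
    eLpNorm (fun x => smoothWeight γ x * q x) 2 volume ≤
      A * ∑ i, ∑ j, (eLpNorm (fun x => smoothWeight γ x * f i j x) 2 volume +
        eLpNorm (fun x => smoothWeight γ x * f i j x) (6 / 5) volume) := by
  obtain ⟨A, hA, h⟩ := exists_pairing_rieszRiesz_le
  refine ⟨A + 1, by finiteness, fun γ hγ hγ2 f q hf hq => ?_⟩
  set N : Fin 3 → Fin 3 → ℝ≥0∞ := fun i j => eLpNorm (fun x => smoothWeight γ x * f i j x) 2 volume +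
        eLpNorm (fun x => smoothWeight γ x * f i j x) (6 / 5) volume with hN
  by_cases htop : ∑ i, ∑ j, N i j = ⊤
  · change _ ≤ (A + 1) * ∑ i, ∑ j, N i j
    rw [htop, ENNReal.mul_top (by simp)]
    exact le_top
  have hNtop : ∀ i j, N i j ≠ ⊤ := fun i j hij => htop (by
    rw [ENNReal.sum_eq_top]
    exact ⟨i, Finset.mem_univ _, ENNReal.sum_eq_top.2 ⟨j, Finset.mem_univ _, hij⟩⟩)
  have hfin : A * ∑ i, ∑ j, N i j ≠ ⊤ := ENNReal.mul_ne_top hA htop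
  refine le_trans ?_ (mul_le_mul' (le_self_add : A ≤ A + 1) le_rfl)
  rw [← ENNReal.ofReal_toReal hfin]
  refine eLpNorm_two_le_of_forall_integral_mul_le ?_ ENNReal.toReal_nonneg fun φ hφ1 hφ2 => ?_
  · exact LocallyIntegrable.continuous_mul (continuous_smoothWeight γ) hq.1
  have hφ : IsTestSpace φ := ⟨hφ1, hφ2⟩
  have hψ : IsTestSpace (fun x => smoothWeight γ x * φ x) :=
    ⟨(contDiff_smoothWeight γ).mul hφ1, hφ2.mul_left⟩
  obtain ⟨h1, h2⟩ := hq.2 _ hψ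
  have e1 : ∫ x, smoothWeight γ x * q x * φ x =
      ∑ i, ∑ j, ∫ x, f i j x * rieszRiesz i j (fun x => smoothWeight γ x * φ x) x := by
    rw [← h2]
    congr 1
    ext x
    ring
  have e2 : ‖∫ x, smoothWeight γ x * q x * φ x‖ₑ ≤
      (A * ∑ i, ∑ j, N i j) * eLpNorm φ 2 volume := by
    rw [e1, Finset.mul_sum, Finset.sum_mul]
    refine (enorm_sum_le _ _).trans (Finset.sum_le_sum fun i _ => ?_)
    rw [Finset.mul_sum, Finset.sum_mul]
    refine (enorm_sum_le _ _).trans (Finset.sum_le_sum fun j _ => ?_)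
    rw [mul_assoc]
    exact h γ hγ hγ2 i j (f i j) φ _ (hf i j) hψ hφ (fun x => rfl)
      ((le_self_add).trans_lt (hNtop i j).lt_top) (h1 i j)
  rw [← ENNReal.toReal_mul, ← Real.norm_eq_abs, ← toReal_enorm]
  exact ENNReal.toReal_mono (ENNReal.mul_ne_top hfin (hφ.memLp 2).eLpNorm_ne_top) e2

end AdvDiff

/-- Jensen's inequality for the square and a probability density `r`. -/
theorem ENNReal.lintegral_mul_sq_le {α : Type*} [MeasurableSpace α] {μ : Measure α}
    {a r : α → ℝ≥0∞} (ha : AEMeasurable a μ) (hr : AEMeasurable r μ) (h1 : ∫⁻ x, r x ∂μ = 1) :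
    (∫⁻ x, a x * r x ∂μ) ^ (2 : ℝ) ≤ ∫⁻ x, a x ^ (2 : ℝ) * r x ∂μ := by
  have hsq : ∀ c : ℝ≥0∞, c ^ (1 / 2 : ℝ) * c ^ (1 / 2 : ℝ) = c := fun c => by
    rw [← ENNReal.rpow_add_of_nonneg _ _ (by norm_num) (by norm_num)]; norm_num
  have hsq' : ∀ c : ℝ≥0∞, (c ^ (1 / 2 : ℝ)) ^ (2 : ℝ) = c := fun c => by
    rw [← ENNReal.rpow_mul]; norm_num
  have hr' : AEMeasurable (fun x => r x ^ (1 / 2 : ℝ)) μ := hr.pow_const _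
  have h2 := ENNReal.lintegral_mul_le_Lp_mul_Lq μ Real.HolderConjugate.two_two (ha.mul hr') hr'
  have hm : ∀ c d : ℝ≥0∞, (c * d ^ (1 / 2 : ℝ)) ^ (2 : ℝ) = c ^ (2 : ℝ) * d := fun c d => by
    rw [ENNReal.mul_rpow_of_nonneg _ _ (by norm_num), hsq']
  simp only [Pi.mul_apply, hm, hsq', h1, ENNReal.one_rpow, mul_one, mul_assoc, hsq] at h2
  calc _ ≤ ((∫⁻ x, a x ^ (2 : ℝ) * r x ∂μ) ^ (1 / 2 : ℝ)) ^ (2 : ℝ) :=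
        ENNReal.rpow_le_rpow h2 (by norm_num)
    _ = _ := hsq' _

section Mollifier

set_option linter.unusedSectionVars false

variable {V : Type*} [NormedAddCommGroup V] [NormedSpace ℝ V] [FiniteDimensional ℝ V]
  [MeasureSpace V] [BorelSpace V] [(volume : Measure V).IsAddHaarMeasure]

variable (V) in
/-- A smooth bump supported in the closed ball of radius `1 / (k + 1)`. -/
noncomputable def mollBump (k : ℕ) : ContDiffBump (0 : V) where
  rIn := 1 / (2 * (k + 1))
  rOut := 1 / (k + 1)
  rIn_pos := by positivity
  rIn_lt_rOut := by
    have : (0 : ℝ) < k + 1 := by positivity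
    rw [div_lt_div_iff₀ (by positivity) this]
    linarith

/-- An approximate identity. -/
noncomputable def mollifier (k : ℕ) (z : V) : ℝ := (mollBump V k).normed volume z

/-- The convolution of a function with `mollifier k`. -/
noncomputable def moll (k : ℕ) (g : V → ℝ) (z : V) : ℝ := ∫ y, g y * mollifier k (z - y)

theorem mollifier_nonneg (k : ℕ) (z : V) : 0 ≤ mollifier k z := ContDiffBump.nonneg_normed _ _

theorem contDiff_mollifier (k : ℕ) : ContDiff ℝ ∞ (mollifier k : V → ℝ) :=
  ContDiffBump.contDiff_normed _

theorem continuous_mollifier (k : ℕ) : Continuous (mollifier k : V → ℝ) :=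
  (contDiff_mollifier k).continuous

theorem hasCompactSupport_mollifier (k : ℕ) : HasCompactSupport (mollifier k : V → ℝ) :=
  ContDiffBump.hasCompactSupport_normed _

theorem mollifier_neg (k : ℕ) (z : V) : mollifier k (-z) = mollifier k z :=
  ContDiffBump.normed_neg _ _

theorem mollifier_sub_comm (k : ℕ) (z y : V) : mollifier k (z - y) = mollifier k (y - z) := by
  rw [← neg_sub, mollifier_neg]

theorem integrable_mollifier (k : ℕ) : Integrable (mollifier k : V → ℝ) :=
  ContDiffBump.integrable_normed _

theorem integral_mollifier (k : ℕ) : ∫ z : V, mollifier k z = 1 := ContDiffBump.integral_normed _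

theorem lintegral_mollifier (k : ℕ) : ∫⁻ z : V, ENNReal.ofReal (mollifier k z) = 1 := by
  rw [← ofReal_integral_eq_lintegral_ofReal (integrable_mollifier k)
    (Eventually.of_forall (mollifier_nonneg k)), integral_mollifier, ENNReal.ofReal_one]

theorem mollifier_eq_zero (k : ℕ) {z : V} (hz : 1 / ((k : ℝ) + 1) ≤ ‖z‖) : mollifier k z = 0 := by
  by_contra h
  have : z ∈ Function.support ((mollBump V k).normed volume) := h
  rw [ContDiffBump.support_normed_eq, Metric.mem_ball, dist_zero_right] at this
  exact absurd this (not_lt.2 hz)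

theorem moll_eq_convolution (k : ℕ) (g : V → ℝ) :
    moll k g = convolution g (mollifier k) (ContinuousLinearMap.mul ℝ ℝ) volume := rfl

theorem contDiff_moll (k : ℕ) {g : V → ℝ} (hg : LocallyIntegrable g) : ContDiff ℝ ∞ (moll k g) := by
  rw [moll_eq_convolution]
  exact (hasCompactSupport_mollifier k).contDiff_convolution_right _ hg (contDiff_mollifier k)

theorem fderiv_moll (k : ℕ) {g : V → ℝ} (hg : LocallyIntegrable g) (z v : V) :
    fderiv ℝ (moll k g) z v = ∫ y, g y * fderiv ℝ (mollifier k) (z - y) v := by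
  have hc : ContDiff ℝ 1 (mollifier k : V → ℝ) := (contDiff_mollifier k).of_le (by simp)
  rw [moll_eq_convolution, ((hasCompactSupport_mollifier k).hasFDerivAt_convolution_right _ hg hc
    z).fderiv, convolution_precompR_apply _ hg ((hasCompactSupport_mollifier k).fderiv ℝ)
    (hc.continuous_fderiv one_ne_zero)]
  rfl

theorem fderiv_moll_of_contDiff (k : ℕ) {g : V → ℝ} (hg : ContDiff ℝ 1 g)
    (hgc : HasCompactSupport g) (z v : V) :
    fderiv ℝ (moll k g) z v = moll k (fun y => fderiv ℝ g y v) z := by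
  rw [fderiv_moll k hg.continuous.locallyIntegrable]
  have hc : ContDiff ℝ 1 (fun y => mollifier k (z - y) : V → ℝ) :=
    ((contDiff_mollifier k).of_le (by simp)).comp (contDiff_const.sub contDiff_id)
  have h := integral_mul_fderiv_of_hasCompactSupport (μ := (volume : Measure V)) hc hg hgc v
  have hd : ∀ y, fderiv ℝ (fun y => mollifier k (z - y)) y v
      = -fderiv ℝ (mollifier k : V → ℝ) (z - y) v := fun y => by
    have h1 := ((contDiff_mollifier (V := V) k).differentiable (by simp) (z - y)).hasFDerivAt.comp y
      ((hasFDerivAt_id y).const_sub z)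
    change fderiv ℝ (mollifier k ∘ fun y => z - y) y v = _
    rw [HasFDerivAt.fderiv h1]
    simp
  simp only [hd, neg_mul, integral_neg, neg_neg] at h
  simp only [moll]
  rw [← show _ = ∫ y, fderiv ℝ g y v * mollifier k (z - y) from
    (integral_congr_ae (Eventually.of_forall fun y => mul_comm _ _)), h]
  exact integral_congr_ae (Eventually.of_forall fun y => mul_comm _ _)

theorem exists_mollifier_le (k : ℕ) : ∃ C, ∀ z : V, ‖mollifier k z‖ ≤ C :=
  (hasCompactSupport_mollifier k).exists_bound_of_continuous (continuous_mollifier k)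

theorem integral_mul_moll (k : ℕ) {f g : V → ℝ} (hf : Integrable f) (hg : Integrable g) :
    ∫ z, f z * moll k g z = ∫ z, moll k f z * g z := by
  obtain ⟨C, hC⟩ := exists_mollifier_le (V := V) k
  have hi : Integrable (fun q : V × V => f q.1 * (g q.2 * mollifier k (q.1 - q.2)))
      (volume.prod volume) := by
    refine ((hf.mul_prod hg).bdd_mul
      ((continuous_mollifier k).comp (continuous_fst.sub continuous_snd)).aestronglyMeasurable
      (Eventually.of_forall fun q => hC _)).congr (Eventually.of_forall fun q => ?_)
    simp only [Function.comp, Pi.sub_apply]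
    ring
  have h := integral_integral_swap (f := fun x y => f x * (g y * mollifier k (x - y))) hi
  simp only [integral_const_mul] at h
  refine h.trans (integral_congr_ae (Eventually.of_forall fun y => ?_))
  simp only [moll]
  rw [← integral_mul_const]
  refine integral_congr_ae (Eventually.of_forall fun x => ?_)
  simp only
  rw [mollifier_sub_comm k x y]
  ring

theorem moll_eq_zero_of_notMem_cthickening (k : ℕ) {g : V → ℝ} {s : Set V}
    (hg : ∀ y ∉ s, g y = 0) {z : V} (hz : z ∉ Metric.cthickening (1 / ((k : ℝ) + 1)) s) :
    moll k g z = 0 := by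
  refine integral_eq_zero_of_ae (Eventually.of_forall fun y => ?_)
  by_cases hy : y ∈ s
  · simp only [Pi.zero_apply]
    rw [mollifier_eq_zero k, mul_zero]
    by_contra h
    push Not at h
    exact hz (Metric.mem_cthickening_of_dist_le z y _ s hy (by rw [dist_eq_norm]; exact h.le))
  · simp [hg y hy]

theorem tsupport_moll_subset (k : ℕ) {g : V → ℝ} :
    tsupport (moll k g) ⊆ Metric.cthickening (1 / ((k : ℝ) + 1)) (tsupport g) := by
  refine closure_minimal (fun z hz => ?_) Metric.isClosed_cthickening
  by_contra h
  exact hz (moll_eq_zero_of_notMem_cthickening k (fun y hy => image_eq_zero_of_notMem_tsupport hy) h)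

theorem hasCompactSupport_moll (k : ℕ) {g : V → ℝ} (hg : HasCompactSupport g) :
    HasCompactSupport (moll k g) :=
  hg.isCompact.cthickening.of_isClosed_subset (isClosed_tsupport _) (tsupport_moll_subset k)

theorem lintegral_mollifier_sub_left (k : ℕ) (z : V) :
    ∫⁻ y, ENNReal.ofReal (mollifier k (z - y)) = 1 := by
  rw [lintegral_sub_left_eq_self (fun y : V => ENNReal.ofReal (mollifier k y)) z,
    lintegral_mollifier]

theorem lintegral_mollifier_sub_right (k : ℕ) (y : V) :
    ∫⁻ z, ENNReal.ofReal (mollifier k (z - y)) = 1 := by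
  rw [lintegral_sub_right_eq_self (fun y : V => ENNReal.ofReal (mollifier k y)) y,
    lintegral_mollifier]

/-- Jensen's inequality for a mollification. -/
theorem enorm_moll_sq_le (k : ℕ) {g : V → ℝ} (hg : AEStronglyMeasurable g) (z : V) :
    ‖moll k g z‖ₑ ^ (2 : ℝ) ≤ ∫⁻ y, ‖g y‖ₑ ^ (2 : ℝ) * ENNReal.ofReal (mollifier k (z - y)) := by
  have hρ : Measurable fun y => ENNReal.ofReal (mollifier k (z - y)) :=
    ((continuous_mollifier k).comp (continuous_const.sub continuous_id)).measurable.ennreal_ofReal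
  refine le_trans (ENNReal.rpow_le_rpow ?_ (by norm_num))
    (ENNReal.lintegral_mul_sq_le hg.enorm hρ.aemeasurable (lintegral_mollifier_sub_left k z))
  refine (enorm_integral_le_lintegral_enorm _).trans_eq (lintegral_congr fun y => ?_)
  rw [enorm_mul, Real.enorm_of_nonneg (mollifier_nonneg _ _)]

theorem eLpNorm_moll_le (k : ℕ) {g : V → ℝ} (hg : AEStronglyMeasurable g) :
    eLpNorm (moll k g) 2 volume ≤ eLpNorm g 2 volume := by
  rw [AdvDiff.eLpNorm_two_eq, AdvDiff.eLpNorm_two_eq]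
  refine ENNReal.rpow_le_rpow ?_ (by norm_num)
  refine (lintegral_mono fun z => enorm_moll_sq_le k hg z).trans ?_
  have hm : AEMeasurable (fun q : V × V => ‖g q.2‖ₑ ^ (2 : ℝ) *
      ENNReal.ofReal (mollifier k (q.1 - q.2))) (volume.prod volume) := by
    have h1 : AEMeasurable (fun q : V × V => ‖g q.2‖ₑ) (volume.prod volume) := hg.comp_snd.enorm
    have h2 : Measurable (fun q : V × V => ENNReal.ofReal (mollifier k (q.1 - q.2))) :=
      ((continuous_mollifier k).comp (continuous_fst.sub continuous_snd)).measurable.ennreal_ofReal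
    exact (h1.pow_const _).mul h2.aemeasurable
  rw [lintegral_lintegral_swap hm]
  refine lintegral_mono_ae (Eventually.of_forall fun y => ?_)
  have hm' : Measurable fun z => ENNReal.ofReal (mollifier k (z - y)) :=
    ((continuous_mollifier k).comp (continuous_id.sub continuous_const)).measurable.ennreal_ofReal
  rw [lintegral_const_mul _ hm', lintegral_mollifier_sub_right, mul_one]

theorem moll_sub (k : ℕ) {f g : V → ℝ} (hf : LocallyIntegrable f) (hg : LocallyIntegrable g) (z : V) :
    moll k (f - g) z = moll k f z - moll k g z := by
  have h : ∀ {f : V → ℝ}, LocallyIntegrable f → Integrable fun y => f y * mollifier k (z - y) := by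
    intro f hf
    exact (hasCompactSupport_mollifier k).convolutionExists_right (ContinuousLinearMap.mul ℝ ℝ) hf
      (continuous_mollifier k) z
  simp only [moll]
  rw [← integral_sub (h hf) (h hg)]
  simp [sub_mul]

theorem abs_moll_sub_le (k : ℕ) {g : V → ℝ} (hg : Continuous g) {z : V} {ε : ℝ}
    (hε : ∀ y, ‖z - y‖ < 1 / ((k : ℝ) + 1) → |g y - g z| ≤ ε) : |moll k g z - g z| ≤ ε := by
  have hi : Integrable fun y => mollifier k (z - y) := (integrable_mollifier k).comp_sub_left z
  have h1 : ∫ y, mollifier k (z - y) = 1 := by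
    rw [integral_sub_left_eq_self (fun y : V => mollifier k y) volume z, integral_mollifier]
  have hgi : Integrable fun y => g y * mollifier k (z - y) :=
    (hasCompactSupport_mollifier k).convolutionExists_right (ContinuousLinearMap.mul ℝ ℝ)
      hg.locallyIntegrable (continuous_mollifier k) z
  have e : moll k g z - g z = ∫ y, (g y - g z) * mollifier k (z - y) := by
    have : g z = ∫ y, g z * mollifier k (z - y) := by rw [integral_const_mul, h1, mul_one]
    conv_lhs => rw [this]
    rw [moll, ← integral_sub hgi (hi.const_mul _)]
    simp [sub_mul]
  rw [e]
  rw [← Real.norm_eq_abs]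
  refine (norm_integral_le_of_norm_le (hi.const_mul ε) (Eventually.of_forall fun y => ?_)).trans_eq
    (by rw [integral_const_mul, h1, mul_one])
  rw [norm_mul, Real.norm_of_nonneg (mollifier_nonneg _ _), Real.norm_eq_abs]
  by_cases hy : ‖z - y‖ < 1 / ((k : ℝ) + 1)
  · exact mul_le_mul_of_nonneg_right (hε y hy) (mollifier_nonneg _ _)
  · rw [mollifier_eq_zero k (not_lt.1 hy)]
    simp

theorem tendsto_eLpNorm_moll_sub_of_continuous {g : V → ℝ} (hg : Continuous g)
    (hgc : HasCompactSupport g) :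
    Tendsto (fun k => eLpNorm (moll k g - g) 2 volume) atTop (𝓝 0) := by
  rw [ENNReal.tendsto_atTop_zero]
  intro ε hε
  have huc := hgc.uniformContinuous_of_continuous hg
  rw [Metric.uniformContinuous_iff] at huc
  set K : Set V := Metric.cthickening 1 (tsupport g) with hK
  have hKc : IsCompact K := hgc.isCompact.cthickening
  have hμ : volume K ≠ ⊤ := hKc.measure_lt_top.ne
  obtain ⟨η, hη0, hη⟩ : ∃ η : ℝ, 0 < η ∧
      ENNReal.ofReal η * volume K ^ (1 / (2 : ℝ≥0∞).toReal) ≤ ε := by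
    by_cases hεt : ε = ⊤
    · exact ⟨1, one_pos, by simp [hεt]⟩
    have hfin : volume K ^ (1 / (2 : ℝ≥0∞).toReal) ≠ ⊤ :=
      ENNReal.rpow_ne_top_of_nonneg (by norm_num) hμ
    set c := (volume K ^ (1 / (2 : ℝ≥0∞).toReal)).toReal
    have hc : 0 ≤ c := ENNReal.toReal_nonneg
    refine ⟨ε.toReal / (c + 1), div_pos (ENNReal.toReal_pos hε.ne' hεt) (by positivity), ?_⟩
    rw [← ENNReal.ofReal_toReal hfin, ← ENNReal.ofReal_mul (by positivity)]
    refine (ENNReal.ofReal_le_ofReal ?_).trans_eq (ENNReal.ofReal_toReal hεt)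
    rw [div_mul_eq_mul_div]
    refine div_le_of_le_mul₀ (by positivity) ENNReal.toReal_nonneg ?_
    exact mul_le_mul_of_nonneg_left (by linarith) ENNReal.toReal_nonneg
  obtain ⟨δ, hδ, h⟩ := huc η hη0
  obtain ⟨N, hN⟩ := exists_nat_one_div_lt hδ
  refine ⟨N, fun k hk => le_trans ?_ hη⟩
  have hk' : 1 / ((k : ℝ) + 1) < δ := lt_of_le_of_lt (by gcongr) hN
  have hk1 : 1 / ((k : ℝ) + 1) ≤ 1 := by
    rw [div_le_one (by positivity)]
    linarith [(Nat.cast_nonneg k : (0 : ℝ) ≤ k)]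
  have hzero : ∀ z ∉ K, (moll k g - g) z = 0 := by
    intro z hz
    have h1 : moll k g z = 0 := moll_eq_zero_of_notMem_cthickening k
      (fun y hy => image_eq_zero_of_notMem_tsupport hy)
      (fun hz' => hz (Metric.cthickening_mono hk1 _ hz'))
    have h2 : g z = 0 := image_eq_zero_of_notMem_tsupport
      (fun hz' => hz (Metric.self_subset_cthickening _ hz'))
    simp [h1, h2]
  have hind : moll k g - g = K.indicator (moll k g - g) := by
    ext z
    by_cases hz : z ∈ K
    · simp [hz]
    · rw [indicator_of_notMem hz, hzero z hz]
  rw [hind, eLpNorm_indicator_eq_eLpNorm_restrict hKc.measurableSet]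
  refine (eLpNorm_le_of_ae_bound (C := η) (Eventually.of_forall fun z => ?_)).trans_eq ?_
  · exact abs_moll_sub_le k hg fun y hy =>
      (h (by rw [dist_comm, dist_eq_norm]; exact hy.trans hk')).le
  · rw [Measure.restrict_apply_univ, mul_comm]
    simp

/-- Mollifications converge in `L²`. -/
theorem tendsto_eLpNorm_moll_sub {g : V → ℝ} (hg : MemLp g 2 volume) :
    Tendsto (fun k => eLpNorm (moll k g - g) 2 volume) atTop (𝓝 0) := by
  rw [ENNReal.tendsto_atTop_zero]
  intro ε hε
  have hε3 : ε / 3 ≠ 0 := (ENNReal.div_pos hε.ne' (by norm_num)).ne'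
  obtain ⟨f, hf1, hf2, hf3, hf4⟩ := hg.exists_hasCompactSupport_eLpNorm_sub_le (by norm_num) hε3
  obtain ⟨N, hN⟩ := (ENNReal.tendsto_atTop_zero.1
    (tendsto_eLpNorm_moll_sub_of_continuous hf3 hf1)) (ε / 3) (pos_iff_ne_zero.2 hε3)
  refine ⟨N, fun k hk => ?_⟩
  have hgl : LocallyIntegrable g := hg.locallyIntegrable (by norm_num)
  have e : moll k g - g = moll k (g - f) + (moll k f - f) - (g - f) := by
    ext z
    simp only [Pi.sub_apply, Pi.add_apply, moll_sub k hgl hf3.locallyIntegrable]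
    ring
  have hsub := hg.sub hf4
  have hm : ∀ {h : V → ℝ}, LocallyIntegrable h → AEStronglyMeasurable (moll k h) volume :=
    fun hh => (contDiff_moll k hh).continuous.aestronglyMeasurable
  have hm1 := hm (hsub.locallyIntegrable (by norm_num))
  have hm2 := (hm hf3.locallyIntegrable).sub hf4.1
  rw [e]
  calc _ ≤ eLpNorm (moll k (g - f)) 2 volume + eLpNorm (moll k f - f) 2 volume +
        eLpNorm (g - f) 2 volume :=
        (eLpNorm_sub_le (hm1.add hm2) hsub.1 (by norm_num)).trans
          (add_le_add_left (eLpNorm_add_le hm1 hm2 (by norm_num)) _)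
    _ ≤ ε / 3 + ε / 3 + ε / 3 := by
        gcongr
        · exact (eLpNorm_moll_le k hsub.1).trans hf2
        · exact hN k hk
    _ = ε := ENNReal.add_thirds ε

end Mollifier

/-- If `A` is integrable, `e k` is bounded and tends to `0` in `L²`, then `∫ A e k → 0`. -/
theorem tendsto_lintegral_mul_zero_of_bounded_of_measurable {α : Type*} [MeasurableSpace α] {μ : Measure α}
    {A : α → ℝ≥0∞} (hA : Measurable A) (hAi : ∫⁻ x, A x ∂μ ≠ ⊤) {e : ℕ → α → ℝ≥0∞}
    (he : ∀ k, AEMeasurable (e k) μ) {M : ℝ≥0∞} (hM : M ≠ ⊤) (heM : ∀ k, ∀ᵐ x ∂μ, e k x ≤ M)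
    (h : Tendsto (fun k => ∫⁻ x, e k x ^ (2 : ℝ) ∂μ) atTop (𝓝 0)) :
    Tendsto (fun k => ∫⁻ x, A x * e k x ∂μ) atTop (𝓝 0) := by
  set S : ℕ → Set α := fun n => {x | (n : ℝ≥0∞) ≤ A x} with hS
  have hSm : ∀ n, MeasurableSet (S n) := fun n => measurableSet_le measurable_const hA
  have hμS : Tendsto (fun n => μ (S n)) atTop (𝓝 0) := by
    have hlim : Tendsto (fun n : ℕ => (∫⁻ x, A x ∂μ) / n) atTop (𝓝 0) := by
      simpa using ENNReal.Tendsto.div (tendsto_const_nhds (x := ∫⁻ x, A x ∂μ))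
        (Or.inr ENNReal.top_ne_zero) ENNReal.tendsto_nat_nhds_top (Or.inr hAi)
    refine tendsto_of_tendsto_of_tendsto_of_le_of_le' tendsto_const_nhds hlim
      (Eventually.of_forall fun _ => zero_le) ?_
    filter_upwards [eventually_gt_atTop 0] with n hn
    exact meas_ge_le_lintegral_div hA.aemeasurable (by exact_mod_cast hn.ne') (ENNReal.natCast_ne_top n)
  have hAS : Tendsto (fun n => ∫⁻ x in S n, A x ∂μ) atTop (𝓝 0) := tendsto_setLIntegral_zero hAi hμS
  have hASM : Tendsto (fun n => (∫⁻ x in S n, A x ∂μ) * M) atTop (𝓝 0) := by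
    simpa using ENNReal.Tendsto.mul_const hAS (Or.inr hM)
  rw [ENNReal.tendsto_atTop_zero]
  intro ε hε
  have hε2 : 0 < ε / 2 := ENNReal.div_pos hε.ne' (by norm_num)
  obtain ⟨n, hn⟩ := (ENNReal.tendsto_atTop_zero.1 hASM) (ε / 2) hε2
  have hn := hn n le_rfl
  have hfin : ∫⁻ x in (S n)ᶜ, A x ^ (2 : ℝ) ∂μ ≠ ⊤ := by
    refine ((setLIntegral_mono_ae' (g := fun x => (n : ℝ≥0∞) * A x) (hSm n).compl
      (Eventually.of_forall fun x hx => ?_)).trans_lt ?_).ne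
    · have hx' : A x ≤ n := (lt_of_not_ge (show ¬ (n : ℝ≥0∞) ≤ A x from hx)).le
      rw [ENNReal.rpow_two, sq]
      gcongr
    · rw [lintegral_const_mul'' _ hA.aemeasurable]
      exact ENNReal.mul_lt_top (ENNReal.natCast_lt_top n)
        ((setLIntegral_le_lintegral _ _).trans_lt hAi.lt_top)
  have h2 : Tendsto (fun k => (∫⁻ x in (S n)ᶜ, A x ^ (2 : ℝ) ∂μ) ^ (1 / 2 : ℝ) *
      (∫⁻ x, e k x ^ (2 : ℝ) ∂μ) ^ (1 / 2 : ℝ)) atTop (𝓝 0) := by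
    have := (ENNReal.continuous_rpow_const (y := 1 / 2)).tendsto 0 |>.comp h
    rw [ENNReal.zero_rpow_of_pos (by norm_num)] at this
    simpa using ENNReal.Tendsto.const_mul this
      (Or.inr (ENNReal.rpow_ne_top_of_nonneg (by norm_num : (0 : ℝ) ≤ 1 / 2) hfin))
  obtain ⟨N, hN⟩ := (ENNReal.tendsto_atTop_zero.1 h2) (ε / 2) hε2
  refine ⟨N, fun k hk => ?_⟩
  rw [← lintegral_add_compl _ (hSm n)]
  calc _ ≤ ε / 2 + ε / 2 := by
        refine add_le_add (le_trans ?_ hn) (le_trans ?_ (hN k hk))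
        · rw [← lintegral_mul_const' _ _ hM]
          refine lintegral_mono_ae ?_
          filter_upwards [ae_restrict_of_ae (heM k)] with x hx
          gcongr
        · refine (ENNReal.lintegral_mul_le_Lp_mul_Lq _ Real.HolderConjugate.two_two
            hA.aemeasurable (he k).restrict).trans ?_
          gcongr
          exact Measure.restrict_le_self
    _ = ε := ENNReal.add_halves ε

/-- If `A` is integrable, `e k` is bounded and tends to `0` in `L²`, then `∫ A e k → 0`. -/
theorem tendsto_lintegral_mul_zero_of_bounded {α : Type*} [MeasurableSpace α] {μ : Measure α}
    {A : α → ℝ≥0∞} (hA : AEMeasurable A μ) (hAi : ∫⁻ x, A x ∂μ ≠ ⊤) {e : ℕ → α → ℝ≥0∞}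
    (he : ∀ k, AEMeasurable (e k) μ) {M : ℝ≥0∞} (hM : M ≠ ⊤) (heM : ∀ k, ∀ᵐ x ∂μ, e k x ≤ M)
    (h : Tendsto (fun k => ∫⁻ x, e k x ^ (2 : ℝ) ∂μ) atTop (𝓝 0)) :
    Tendsto (fun k => ∫⁻ x, A x * e k x ∂μ) atTop (𝓝 0) := by
  rw [lintegral_congr_ae hA.ae_eq_mk] at hAi
  refine (tendsto_lintegral_mul_zero_of_bounded_of_measurable hA.measurable_mk hAi he hM heM
    h).congr fun k => lintegral_congr_ae ?_
  filter_upwards [hA.ae_eq_mk] with x hx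
  rw [hx]

/-- `∫ f_k g_k → ∫ f g` when `f_k → f` and `g_k → g` in `L²`. -/
theorem tendsto_integral_mul_of_tendsto_eLpNorm {α : Type*} [MeasurableSpace α] {μ : Measure α}
    {f g : ℕ → α → ℝ} {f' g' : α → ℝ} (hf : ∀ k, MemLp (f k) 2 μ) (hg : ∀ k, MemLp (g k) 2 μ)
    (hf' : MemLp f' 2 μ) (hg' : MemLp g' 2 μ)
    (h1 : Tendsto (fun k => eLpNorm (f k - f') 2 μ) atTop (𝓝 0))
    (h2 : Tendsto (fun k => eLpNorm (g k - g') 2 μ) atTop (𝓝 0)) :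
    Tendsto (fun k => ∫ x, f k x * g k x ∂μ) atTop (𝓝 (∫ x, f' x * g' x ∂μ)) := by
  have key : ∀ {a b : α → ℝ} (ha : MemLp a 2 μ) (hb : MemLp b 2 μ),
      ∫ x, a x * b x ∂μ = inner ℝ (ha.toLp a) (hb.toLp b) := by
    intro a b ha hb
    rw [L2.inner_def]
    refine integral_congr_ae ?_
    filter_upwards [ha.coeFn_toLp, hb.coeFn_toLp] with x hx hy
    rw [hx, hy]
    simp [mul_comm]
  rw [key hf' hg']
  simp only [fun k => key (hf k) (hg k)]
  exact ((Lp.tendsto_Lp_iff_tendsto_eLpNorm'' f hf f' hf').2 h1).inner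
    ((Lp.tendsto_Lp_iff_tendsto_eLpNorm'' g hg g' hg').2 h2)

namespace AdvDiff

instance : (volume : Measure (ℝ × E3)).IsAddHaarMeasure := by
  rw [Measure.volume_eq_prod]; infer_instance

theorem lintegral_slab {f : ℝ × E3 → ℝ≥0∞} (hf : AEMeasurable f) :
    ∫⁻ z, f z = ∫⁻ t, ∫⁻ x, f (t, x) := by
  rw [Measure.volume_eq_prod] at hf ⊢
  exact lintegral_prod _ hf

/-- Mollification does not increase `L^∞_t L²_x` norms. -/
theorem lintegral_moll_sq_le (k : ℕ) {g : ℝ × E3 → ℝ} (hg : AEStronglyMeasurable g) {M : ℝ≥0∞}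
    (hM : ∀ᵐ t, ∫⁻ x, ‖g (t, x)‖ₑ ^ (2 : ℝ) ≤ M) (t : ℝ) :
    ∫⁻ x, ‖moll k g (t, x)‖ₑ ^ (2 : ℝ) ≤ M := by
  have hgm : AEMeasurable (fun q => ‖g q‖ₑ ^ (2 : ℝ)) := hg.enorm.pow_const _
  set r : ℝ → ℝ≥0∞ := fun s => ∫⁻ x : E3, ENNReal.ofReal (mollifier k (s, x)) with hr
  have hρ : Measurable fun q : ℝ × E3 => ENNReal.ofReal (mollifier k q) :=
    (continuous_mollifier k).measurable.ennreal_ofReal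
  have hrm : Measurable r := hρ.lintegral_prod_right'
  have hr1 : ∫⁻ s, r (t - s) = 1 := by
    rw [lintegral_sub_left_eq_self r t, hr, ← lintegral_slab hρ.aemeasurable, lintegral_mollifier]
  have hm : AEMeasurable (Function.uncurry fun (x : E3) (q : ℝ × E3) => ‖g q‖ₑ ^ (2 : ℝ) *
      ENNReal.ofReal (mollifier k ((t, x) - q))) (volume.prod volume) := by
    have h1 : AEMeasurable (fun q : E3 × (ℝ × E3) => ‖g q.2‖ₑ ^ (2 : ℝ)) (volume.prod volume) :=
      hgm.comp_snd
    have h2 : Measurable fun q : E3 × (ℝ × E3) => ENNReal.ofReal (mollifier k ((t, q.1) - q.2)) :=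
      hρ.comp (by fun_prop)
    exact h1.mul h2.aemeasurable
  calc _ ≤ ∫⁻ x, ∫⁻ q, ‖g q‖ₑ ^ (2 : ℝ) * ENNReal.ofReal (mollifier k ((t, x) - q)) :=
        lintegral_mono fun x => enorm_moll_sq_le k hg (t, x)
    _ = ∫⁻ q : ℝ × E3, ‖g q‖ₑ ^ (2 : ℝ) * r (t - q.1) := by
        rw [lintegral_lintegral_swap hm]
        refine lintegral_congr fun q => ?_
        have h2 : Measurable fun x : E3 => ENNReal.ofReal (mollifier k ((t, x) - q)) :=
          hρ.comp (by fun_prop)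
        rw [lintegral_const_mul _ h2]
        congr 1
        exact lintegral_sub_right_eq_self
          (fun x : E3 => ENNReal.ofReal (mollifier k (t - q.1, x))) q.2
    _ = ∫⁻ s, (∫⁻ y, ‖g (s, y)‖ₑ ^ (2 : ℝ)) * r (t - s) := by
        have hm' : AEMeasurable fun q : ℝ × E3 => ‖g q‖ₑ ^ (2 : ℝ) * r (t - q.1) :=
          hgm.mul (hrm.comp (by fun_prop)).aemeasurable
        rw [lintegral_slab hm']
        have hg' := hg
        rw [Measure.volume_eq_prod] at hg'
        refine lintegral_congr_ae ?_
        filter_upwards [hg'.prodMk_left] with s hs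
        exact lintegral_mul_const'' _ (hs.enorm.pow_const _)
    _ ≤ ∫⁻ s, M * r (t - s) := by
        refine lintegral_mono_ae ?_
        filter_upwards [hM] with s hs
        gcongr
    _ = M := by
        have hrs : Measurable fun s => r (t - s) := hrm.comp (by fun_prop)
        rw [lintegral_const_mul _ hrs, hr1, mul_one]

theorem aemeasurable_lintegral_slice_sq {h : ℝ × E3 → ℝ} (hh : AEStronglyMeasurable h) :
    AEMeasurable fun t => ∫⁻ x, ‖h (t, x)‖ₑ ^ (2 : ℝ) := by
  have : AEMeasurable (fun q => ‖h q‖ₑ ^ (2 : ℝ)) := hh.enorm.pow_const _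
  rw [Measure.volume_eq_prod] at this
  exact this.lintegral_prod_right'

theorem eLpNorm_two_sq_eq_slab {h : ℝ × E3 → ℝ} (hh : AEStronglyMeasurable h) :
    eLpNorm h 2 volume ^ (2 : ℝ) = ∫⁻ t, ∫⁻ x, ‖h (t, x)‖ₑ ^ (2 : ℝ) := by
  rw [eLpNorm_two_eq, ← ENNReal.rpow_mul, ← lintegral_slab (hh.enorm.pow_const _)]
  norm_num

theorem lintegral_slab_mul_le {h D : ℝ × E3 → ℝ} (hh : AEStronglyMeasurable h)
    (hD : AEStronglyMeasurable D) :
    ∫⁻ z, ‖h z * D z‖ₑ ≤ ∫⁻ t, (∫⁻ x, ‖h (t, x)‖ₑ ^ (2 : ℝ)) ^ (1 / 2 : ℝ) *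
      (∫⁻ x, ‖D (t, x)‖ₑ ^ (2 : ℝ)) ^ (1 / 2 : ℝ) := by
  have hm : AEMeasurable fun z => ‖h z * D z‖ₑ := (hh.mul hD).enorm
  rw [lintegral_slab hm]
  rw [Measure.volume_eq_prod] at hh hD
  refine lintegral_mono_ae ?_
  filter_upwards [hh.prodMk_left, hD.prodMk_left] with t h1 h2
  simp only [enorm_mul]
  exact ENNReal.lintegral_mul_le_Lp_mul_Lq _ Real.HolderConjugate.two_two h1.enorm h2.enorm

/-- Hölder's inequality `L¹_t L²_x × L^∞_t L²_x → L¹`. -/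
theorem integrable_mul_of_mixed {h D : ℝ × E3 → ℝ} (hh : AEStronglyMeasurable h)
    (hD : AEStronglyMeasurable D) (hi : ∫⁻ t, (∫⁻ x, ‖h (t, x)‖ₑ ^ (2 : ℝ)) ^ (1 / 2 : ℝ) ≠ ⊤)
    {M : ℝ≥0∞} (hM : M ≠ ⊤) (hDM : ∀ᵐ t, ∫⁻ x, ‖D (t, x)‖ₑ ^ (2 : ℝ) ≤ M) :
    Integrable fun z => h z * D z := by
  refine ⟨hh.mul hD, ?_⟩
  have hM' : M ^ (1 / 2 : ℝ) ≠ ⊤ := ENNReal.rpow_ne_top_of_nonneg (by norm_num) hM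
  refine (lintegral_slab_mul_le hh hD).trans_lt ?_
  calc _ ≤ ∫⁻ t, (∫⁻ x, ‖h (t, x)‖ₑ ^ (2 : ℝ)) ^ (1 / 2 : ℝ) * M ^ (1 / 2 : ℝ) := by
        refine lintegral_mono_ae ?_
        filter_upwards [hDM] with t ht
        gcongr
    _ < ⊤ := by
        rw [lintegral_mul_const' _ _ hM']
        exact ENNReal.mul_lt_top hi.lt_top hM'.lt_top

/-- `∫ h V_k → ∫ h V` for `h ∈ L¹_t L²_x` when `V_k` is bounded in `L^∞_t L²_x` and converges to `V`
in `L²`. -/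
theorem tendsto_integral_mul_of_mixed {h : ℝ × E3 → ℝ} {W : ℕ → ℝ × E3 → ℝ} {W' : ℝ × E3 → ℝ}
    (hh : AEStronglyMeasurable h) (hi : ∫⁻ t, (∫⁻ x, ‖h (t, x)‖ₑ ^ (2 : ℝ)) ^ (1 / 2 : ℝ) ≠ ⊤)
    (hW : ∀ k, AEStronglyMeasurable (W k)) (hW' : AEStronglyMeasurable W') {M : ℝ≥0∞} (hM : M ≠ ⊤)
    (hWM : ∀ k, ∀ᵐ t, ∫⁻ x, ‖W k (t, x)‖ₑ ^ (2 : ℝ) ≤ M)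
    (hWM' : ∀ k, ∀ᵐ t, ∫⁻ x, ‖(W k - W') (t, x)‖ₑ ^ (2 : ℝ) ≤ M)
    (hlim : Tendsto (fun k => eLpNorm (W k - W') 2 volume) atTop (𝓝 0)) :
    Tendsto (fun k => ∫ z, h z * W k z) atTop (𝓝 (∫ z, h z * W' z)) := by
  refine tendsto_integral_of_L1 _ (hh.mul hW') (Eventually.of_forall fun k =>
    integrable_mul_of_mixed hh (hW k) hi hM (hWM k)) ?_
  have hsq : ∀ c : ℝ≥0∞, (c ^ (1 / 2 : ℝ)) ^ (2 : ℝ) = c := fun c => by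
    rw [← ENNReal.rpow_mul]; norm_num
  have key := tendsto_lintegral_mul_zero_of_bounded
    (A := fun t => (∫⁻ x, ‖h (t, x)‖ₑ ^ (2 : ℝ)) ^ (1 / 2 : ℝ))
    (e := fun k t => (∫⁻ x, ‖(W k - W') (t, x)‖ₑ ^ (2 : ℝ)) ^ (1 / 2 : ℝ))
    ((aemeasurable_lintegral_slice_sq hh).pow_const _) hi
    (fun k => (aemeasurable_lintegral_slice_sq ((hW k).sub hW')).pow_const _)
    (ENNReal.rpow_ne_top_of_nonneg (by norm_num : (0 : ℝ) ≤ 1 / 2) hM)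
    (fun k => by
      filter_upwards [hWM' k] with t ht
      gcongr) ?_
  · refine tendsto_of_tendsto_of_tendsto_of_le_of_le tendsto_const_nhds key (fun _ => zero_le)
      fun k => ?_
    refine le_trans (lintegral_mono fun z => ?_) (lintegral_slab_mul_le hh ((hW k).sub hW'))
    simp [mul_sub]
  · simp only [hsq, ← fun k => eLpNorm_two_sq_eq_slab ((hW k).sub hW')]
    have := (ENNReal.continuous_rpow_const (y := 2)).tendsto 0 |>.comp hlim
    rwa [ENNReal.zero_rpow_of_pos (by norm_num)] at this

/-- `b D_k → 0` in `L²` for `b ∈ L²_t L^∞_x` when `D_k` is bounded in `L^∞_t L²_x` and tends to `0`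
in `L²`. -/
theorem tendsto_eLpNorm_mul_of_mixed {b : ℝ × E3 → ℝ} {D : ℕ → ℝ × E3 → ℝ} {β : ℝ → ℝ≥0∞}
    (hb : AEStronglyMeasurable b) (hβ : AEMeasurable β) (hbβ : ∀ᵐ z : ℝ × E3, ‖b z‖ₑ ≤ β z.1)
    (hi : ∫⁻ t, β t ^ (2 : ℝ) ≠ ⊤)
    (hD : ∀ k, AEStronglyMeasurable (D k)) {M : ℝ≥0∞} (hM : M ≠ ⊤)
    (hDM : ∀ k, ∀ᵐ t, ∫⁻ x, ‖D k (t, x)‖ₑ ^ (2 : ℝ) ≤ M)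
    (hlim : Tendsto (fun k => eLpNorm (D k) 2 volume) atTop (𝓝 0)) :
    Tendsto (fun k => eLpNorm (fun z => b z * D k z) 2 volume) atTop (𝓝 0) := by
  have h1 : Tendsto (fun k => eLpNorm (D k) 2 volume ^ (2 : ℝ)) atTop (𝓝 0) := by
    have := (ENNReal.continuous_rpow_const (y := 2)).tendsto 0 |>.comp hlim
    rwa [ENNReal.zero_rpow_of_pos (by norm_num)] at this
  have hm := fun k => aemeasurable_lintegral_slice_sq (hD k)
  have key := tendsto_lintegral_mul_zero_of_bounded (A := fun t => β t ^ (2 : ℝ))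
    (e := fun k t => ∫⁻ x, ‖D k (t, x)‖ₑ ^ (2 : ℝ)) (hβ.pow_const _) hi hm hM hDM ?_
  · have h2 : Tendsto (fun k => eLpNorm (fun z => b z * D k z) 2 volume ^ (2 : ℝ)) atTop (𝓝 0) := by
      refine tendsto_of_tendsto_of_tendsto_of_le_of_le tendsto_const_nhds key (fun _ => zero_le)
        fun k => ?_
      simp only
      have hbD : AEStronglyMeasurable fun z => b z * D k z := hb.mul (hD k)
      rw [eLpNorm_two_sq_eq_slab hbD]
      rw [Measure.volume_eq_prod] at hbβ
      have hDk := hD k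
      rw [Measure.volume_eq_prod] at hDk
      refine lintegral_mono_ae ?_
      filter_upwards [Measure.ae_ae_of_ae_prod hbβ, hDk.prodMk_left] with t ht hDt
      rw [← lintegral_const_mul'' _ (hDt.enorm.pow_const _)]
      refine lintegral_mono_ae ?_
      filter_upwards [ht] with x hx
      rw [enorm_mul, ENNReal.mul_rpow_of_nonneg _ _ (by norm_num)]
      gcongr
    have := (ENNReal.continuous_rpow_const (y := 1 / 2)).tendsto 0 |>.comp h2
    rw [ENNReal.zero_rpow_of_pos (by norm_num)] at this
    refine this.congr fun k => ?_
    simp only [Function.comp]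
    rw [← ENNReal.rpow_mul]
    norm_num
  · have h3 : Tendsto (fun k => M * eLpNorm (D k) 2 volume ^ (2 : ℝ)) atTop (𝓝 0) := by
      simpa using ENNReal.Tendsto.const_mul h1 (Or.inr hM)
    refine tendsto_of_tendsto_of_tendsto_of_le_of_le tendsto_const_nhds h3 (fun _ => zero_le)
      fun k => ?_
    simp only
    rw [eLpNorm_two_sq_eq_slab (hD k), ← lintegral_const_mul'' _ (hm k)]
    refine lintegral_mono_ae ?_
    filter_upwards [hDM k] with t ht
    rw [ENNReal.rpow_two, sq]
    gcongr

end AdvDiff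

section Mollifier

set_option linter.unusedSectionVars false

variable {V : Type*} [NormedAddCommGroup V] [NormedSpace ℝ V] [FiniteDimensional ℝ V]
  [MeasureSpace V] [BorelSpace V] [(volume : Measure V).IsAddHaarMeasure]

theorem contDiff_mollifier_sub (k : ℕ) (z : V) : ContDiff ℝ ∞ fun y => mollifier k (z - y) :=
  (contDiff_mollifier k).comp (contDiff_const.sub contDiff_id)

theorem fderiv_mollifier_sub (k : ℕ) (z y v : V) :
    fderiv ℝ (fun y => mollifier k (z - y)) y v = -fderiv ℝ (mollifier k : V → ℝ) (z - y) v := by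
  have h1 := ((contDiff_mollifier (V := V) k).differentiable (by simp) (z - y)).hasFDerivAt.comp y
    ((hasFDerivAt_id y).const_sub z)
  change fderiv ℝ (mollifier k ∘ fun y => z - y) y v = _
  rw [HasFDerivAt.fderiv h1]
  simp

theorem tsupport_mollifier_sub_subset (k : ℕ) (z : V) :
    tsupport (fun y => mollifier k (z - y)) ⊆ Metric.closedBall z (1 / ((k : ℝ) + 1)) := by
  refine closure_minimal (fun y hy => ?_) Metric.isClosed_closedBall
  rw [Metric.mem_closedBall, dist_comm, dist_eq_norm]
  by_contra h
  exact hy (mollifier_eq_zero k (not_le.1 h).le)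

/-- A directional derivative of a mollification is the mollification of the weak derivative. -/
theorem fderiv_moll_of_weak (k : ℕ) {f g : V → ℝ} (hf : LocallyIntegrable f) {z v : V}
    (h : ∫ y, f y * fderiv ℝ (fun y => mollifier k (z - y)) y v =
      -∫ y, g y * mollifier k (z - y)) :
    fderiv ℝ (moll k f) z v = moll k g z := by
  simp only [fderiv_mollifier_sub, mul_neg, integral_neg, neg_inj] at h
  rw [fderiv_moll k hf, h, moll]

theorem memLp_moll (k : ℕ) {g : V → ℝ} (hg : MemLp g 2 volume) : MemLp (moll k g) 2 volume :=
  ⟨(contDiff_moll k (hg.locallyIntegrable (by norm_num))).continuous.aestronglyMeasurable,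
    (eLpNorm_moll_le k hg.1).trans_lt hg.2⟩

theorem memLp_two_bdd_mul {a f : V → ℝ} (ha : AEStronglyMeasurable a) {A : ℝ}
    (hA : ∀ z, ‖a z‖ ≤ A) (hf : MemLp f 2 volume) : MemLp (fun z => a z * f z) 2 volume :=
  hf.of_le_mul (c := A) (ha.mul hf.1) (Eventually.of_forall fun z => by
    rw [norm_mul]; exact mul_le_mul_of_nonneg_right (hA z) (norm_nonneg _))

theorem tendsto_eLpNorm_bdd_mul {a : V → ℝ} {A : ℝ}
    (hA : ∀ z, ‖a z‖ ≤ A) {f : ℕ → V → ℝ} {f' : V → ℝ}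
    (h : Tendsto (fun k => eLpNorm (f k - f') 2 volume) atTop (𝓝 0)) :
    Tendsto (fun k => eLpNorm ((fun z => a z * f k z) - fun z => a z * f' z) 2 volume) atTop
      (𝓝 0) := by
  have h0 : Tendsto (fun k => ENNReal.ofReal A * eLpNorm (f k - f') 2 volume) atTop (𝓝 0) := by
    simpa using ENNReal.Tendsto.const_mul h (Or.inr ENNReal.ofReal_ne_top)
  refine tendsto_of_tendsto_of_tendsto_of_le_of_le tendsto_const_nhds h0 (fun _ => zero_le)
    fun k => ?_
  refine eLpNorm_le_mul_eLpNorm_of_ae_le_mul (Eventually.of_forall fun z => ?_) 2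
  simp only [Pi.sub_apply, ← mul_sub, norm_mul]
  exact mul_le_mul_of_nonneg_right (hA z) (norm_nonneg _)

/-- `ρ_k * (a (ρ_k * g)) → a g` in `L²`. -/
theorem tendsto_eLpNorm_moll_mul_moll {a : V → ℝ} (ha : AEStronglyMeasurable a) {A : ℝ}
    (hA : ∀ z, ‖a z‖ ≤ A) {g : V → ℝ} (hg : MemLp g 2 volume) :
    Tendsto (fun k => eLpNorm (moll k (fun z => a z * moll k g z) - fun z => a z * g z) 2 volume)
      atTop (𝓝 0) := by
  have hag := memLp_two_bdd_mul ha hA hg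
  have h1 := tendsto_eLpNorm_bdd_mul hA (tendsto_eLpNorm_moll_sub hg)
  have h2 := tendsto_eLpNorm_moll_sub hag
  have h3 := h1.add h2
  rw [add_zero] at h3
  refine tendsto_of_tendsto_of_tendsto_of_le_of_le tendsto_const_nhds h3 (fun _ => zero_le)
    fun k => ?_
  have hagk := memLp_two_bdd_mul ha hA (memLp_moll k hg)
  have e : moll k (fun z => a z * moll k g z) - (fun z => a z * g z) =
      moll k ((fun z => a z * moll k g z) - fun z => a z * g z) +
      (moll k (fun z => a z * g z) - fun z => a z * g z) := by
    ext z
    simp only [Pi.sub_apply, Pi.add_apply, moll_sub k (hagk.locallyIntegrable (by norm_num))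
      (hag.locallyIntegrable (by norm_num))]
    ring
  rw [e]
  refine (eLpNorm_add_le (memLp_moll k (hagk.sub hag)).1 ((memLp_moll k hag).sub hag).1
    (by norm_num)).trans (add_le_add_left (eLpNorm_moll_le k (hagk.sub hag).1) _)

end Mollifier

namespace AdvDiff

theorem lintegral_slice_mul_sq_le {a : ℝ × E3 → ℝ} {A : ℝ} (hA : ∀ z, ‖a z‖ ≤ A)
    {f : ℝ × E3 → ℝ} {t : ℝ} {M : ℝ≥0∞} (hM : ∫⁻ x, ‖f (t, x)‖ₑ ^ (2 : ℝ) ≤ M) :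
    ∫⁻ x, ‖a (t, x) * f (t, x)‖ₑ ^ (2 : ℝ) ≤ ENNReal.ofReal A ^ (2 : ℝ) * M := by
  refine le_trans ?_ (mul_le_mul_right hM _)
  rw [← lintegral_const_mul' _ _ (ENNReal.rpow_ne_top_of_nonneg (by norm_num) ENNReal.ofReal_ne_top)]
  refine lintegral_mono fun x => ?_
  rw [enorm_mul, ENNReal.mul_rpow_of_nonneg _ _ (by norm_num)]
  gcongr
  rw [← ofReal_norm]
  exact ENNReal.ofReal_le_ofReal (hA _)

theorem lintegral_slice_sub_sq_le {f g : ℝ × E3 → ℝ} {t : ℝ} {M N : ℝ≥0∞}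
    (hfm : AEStronglyMeasurable fun x => f (t, x))
    (hf : ∫⁻ x, ‖f (t, x)‖ₑ ^ (2 : ℝ) ≤ M) (hg : ∫⁻ x, ‖g (t, x)‖ₑ ^ (2 : ℝ) ≤ N) :
    ∫⁻ x, ‖(f - g) (t, x)‖ₑ ^ (2 : ℝ) ≤ 2 * (M + N) := by
  have h := mul_le_mul_right (add_le_add hf hg) 2
  refine le_trans ?_ h
  rw [← lintegral_add_left' (hfm.enorm.pow_const _), ← lintegral_const_mul' _ _ (by norm_num)]
  refine lintegral_mono fun x => ?_
  have h1 : ‖(f - g) (t, x)‖ₑ ≤ ‖f (t, x)‖ₑ + ‖g (t, x)‖ₑ := enorm_sub_le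
  refine (ENNReal.rpow_le_rpow h1 (by norm_num)).trans ?_
  refine (ENNReal.rpow_add_le_mul_rpow_add_rpow _ _ (by norm_num)).trans_eq ?_
  norm_num

/-- `∫ h (ρ_k * (a (ρ_k * g))) → ∫ h a g` for `h ∈ L¹_t L²_x` and `g ∈ L^∞_t L²_x`. -/
theorem tendsto_integral_mul_moll_mul_moll {h : ℝ × E3 → ℝ} (hh : AEStronglyMeasurable h)
    (hi : ∫⁻ t, (∫⁻ x, ‖h (t, x)‖ₑ ^ (2 : ℝ)) ^ (1 / 2 : ℝ) ≠ ⊤)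
    {a : ℝ × E3 → ℝ} (ha : AEStronglyMeasurable a) {A : ℝ} (hA : ∀ z, ‖a z‖ ≤ A)
    {g : ℝ × E3 → ℝ} (hg : MemLp g 2 volume) {M : ℝ≥0∞} (hM : M ≠ ⊤)
    (hgM : ∀ᵐ t, ∫⁻ x, ‖g (t, x)‖ₑ ^ (2 : ℝ) ≤ M) :
    Tendsto (fun k => ∫ z, h z * moll k (fun z => a z * moll k g z) z) atTop
      (𝓝 (∫ z, h z * (a z * g z))) := by
  set N : ℝ≥0∞ := ENNReal.ofReal A ^ (2 : ℝ) * M with hN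
  have hNt : N ≠ ⊤ := ENNReal.mul_ne_top
    (ENNReal.rpow_ne_top_of_nonneg (by norm_num) ENNReal.ofReal_ne_top) hM
  have hak := fun k => memLp_two_bdd_mul ha hA (memLp_moll k hg)
  have hb : ∀ k t, ∫⁻ x, ‖moll k (fun z => a z * moll k g z) (t, x)‖ₑ ^ (2 : ℝ) ≤ N := fun k t =>
    lintegral_moll_sq_le k (hak k).1 (Eventually.of_forall fun s => lintegral_slice_mul_sq_le hA
      (lintegral_moll_sq_le k hg.1 hgM s)) t
  refine tendsto_integral_mul_of_mixed (M := 2 * (N + N)) hh hi (fun k => (memLp_moll k (hak k)).1)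
    (ha.mul hg.1) (ENNReal.mul_ne_top (by norm_num) (ENNReal.add_ne_top.2 ⟨hNt, hNt⟩))
    (fun k => Eventually.of_forall fun t => (hb k t).trans ?_) (fun k => ?_)
    (tendsto_eLpNorm_moll_mul_moll ha hA hg)
  · rw [two_mul]
    exact le_add_right le_self_add
  · filter_upwards [hgM] with t ht
    refine lintegral_slice_sub_sq_le ?_ (hb k t) (lintegral_slice_mul_sq_le hA ht)
    exact ((contDiff_moll k ((hak k).locallyIntegrable (by norm_num))).continuous.comp
      (by fun_prop)).aestronglyMeasurable

/-- The localized difference of two solutions of the advection-diffusion problem: the functions are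
global, and the equations hold in the interior of a compact set `K`. -/
structure IsLocalSolution (K : Set (ℝ × E3)) (u : Fin 3 → ℝ × E3 → ℝ)
    (G : Fin 3 → Fin 3 → ℝ × E3 → ℝ) (b : Fin 3 → ℝ × E3 → ℝ) (p : ℝ × E3 → ℝ) : Prop where
  memLp_u : ∀ j, MemLp (u j) 2 volume
  integrable_u : ∀ j, Integrable (u j)
  bounded_u : ∃ M : ℝ≥0∞, M ≠ ⊤ ∧ ∀ j, ∀ᵐ t, ∫⁻ x, ‖u j (t, x)‖ₑ ^ (2 : ℝ) ≤ M
  memLp_G : ∀ i j, MemLp (G i j) 2 volume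
  integrable_G : ∀ i j, Integrable (G i j)
  measurable_b : ∀ i, AEStronglyMeasurable (b i)
  bounded_b : ∃ β : ℝ → ℝ≥0∞, AEMeasurable β ∧ ∫⁻ t, β t ^ (2 : ℝ) ≠ ⊤ ∧
    ∀ i, ∀ᵐ z : ℝ × E3, ‖b i z‖ₑ ≤ β z.1
  integrable_p : Integrable p
  mixed_p : ∫⁻ t, (∫⁻ x, ‖p (t, x)‖ₑ ^ (2 : ℝ)) ^ (1 / 2 : ℝ) ≠ ⊤
  gradient : ∀ i j, ∀ ψ : ℝ × E3 → ℝ, ContDiff ℝ ∞ ψ → HasCompactSupport ψ → tsupport ψ ⊆ K →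
    ∫ z, u j z * spaceDeriv i ψ z = -∫ z, G i j z * ψ z
  momentum : ∀ j, ∀ ψ : ℝ × E3 → ℝ, ContDiff ℝ ∞ ψ → HasCompactSupport ψ → tsupport ψ ⊆ K →
    -∫ z, u j z * timeDeriv ψ z = -(∑ i, ∫ z, G i j z * spaceDeriv i ψ z)
      - (∫ z, (∑ i, b i z * G i j z) * ψ z) + ∫ z, p z * spaceDeriv j ψ z
  divFree_b : ∀ ψ : ℝ × E3 → ℝ, ContDiff ℝ ∞ ψ → HasCompactSupport ψ → tsupport ψ ⊆ K →
    ∑ i, ∫ z, b i z * spaceDeriv i ψ z = 0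
  divFree_u : ∀ ψ : ℝ × E3 → ℝ, ContDiff ℝ ∞ ψ → HasCompactSupport ψ → tsupport ψ ⊆ K →
    ∑ j, ∫ z, u j z * spaceDeriv j ψ z = 0

namespace IsLocalSolution

variable {K : Set (ℝ × E3)} {u : Fin 3 → ℝ × E3 → ℝ} {G : Fin 3 → Fin 3 → ℝ × E3 → ℝ}
  {b : Fin 3 → ℝ × E3 → ℝ} {p : ℝ × E3 → ℝ}

theorem fderiv_moll_eq (h : IsLocalSolution K u G b p) (k : ℕ) {z : ℝ × E3}
    (hz : Metric.closedBall z (1 / ((k : ℝ) + 1)) ⊆ K) (i j : Fin 3) :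
    spaceDeriv i (moll k (u j)) z = moll k (G i j) z := by
  have hs := (tsupport_mollifier_sub_subset k z)
  exact fderiv_moll_of_weak k (h.integrable_u j).locallyIntegrable
    (h.gradient i j _ (contDiff_mollifier_sub k z)
      ((isCompact_closedBall z _).of_isClosed_subset (isClosed_tsupport _) hs) (hs.trans hz))

theorem sum_fderiv_moll_eq_zero (h : IsLocalSolution K u G b p) (k : ℕ) {z : ℝ × E3}
    (hz : Metric.closedBall z (1 / ((k : ℝ) + 1)) ⊆ K) :
    ∑ j, spaceDeriv j (moll k (u j)) z = 0 := by
  have hs := (tsupport_mollifier_sub_subset k z)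
  have h1 := h.divFree_u _ (contDiff_mollifier_sub k z)
      ((isCompact_closedBall z _).of_isClosed_subset (isClosed_tsupport _) hs) (hs.trans hz)
  simp only [spaceDeriv, fderiv_mollifier_sub, mul_neg, integral_neg, Finset.sum_neg_distrib,
    neg_eq_zero] at h1
  rw [← h1]
  exact Finset.sum_congr rfl fun j _ => fderiv_moll k (h.integrable_u j).locallyIntegrable z _

theorem fderiv_mul_moll {φ g : ℝ × E3 → ℝ} (hφ : ContDiff ℝ ∞ φ) (k : ℕ)
    (hg : LocallyIntegrable g) (z v : ℝ × E3) :
    fderiv ℝ (fun z => φ z * moll k g z) z v =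
      fderiv ℝ φ z v * moll k g z + φ z * fderiv ℝ (moll k g) z v := by
  rw [fderiv_fun_mul (hφ.differentiable (by simp) z)
    ((contDiff_moll k hg).differentiable (by simp) z)]
  simp only [_root_.add_apply, _root_.smul_apply, smul_eq_mul]
  ring

theorem integral_mul_fderiv_moll {φ g f : ℝ × E3 → ℝ} (hφ : ContDiff ℝ ∞ φ)
    (hφc : HasCompactSupport φ) (k : ℕ) (hg : LocallyIntegrable g) (hf : Integrable f)
    (v : ℝ × E3) :
    ∫ z, f z * fderiv ℝ (moll k fun z => φ z * moll k g z) z v =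
      ∫ z, moll k f z * (fderiv ℝ φ z v * moll k g z + φ z * fderiv ℝ (moll k g) z v) := by
  have hφg : ContDiff ℝ ∞ fun z => φ z * moll k g z := hφ.mul (contDiff_moll k hg)
  have hφgc : HasCompactSupport fun z => φ z * moll k g z := hφc.mul_right
  have h1 : ContDiff ℝ 1 fun z => φ z * moll k g z := hφg.of_le (by simp)
  have hi : Integrable fun z => fderiv ℝ (fun z => φ z * moll k g z) z v := by
    refine Continuous.integrable_of_hasCompactSupport ?_ (hφgc.fderiv_apply ℝ v)
    exact (h1.continuous_fderiv one_ne_zero).clm_apply continuous_const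
  simp only [fderiv_moll_of_contDiff k h1 hφgc]
  rw [integral_mul_moll k hf hi]
  simp only [fderiv_mul_moll hφ k hg]

end IsLocalSolution

end AdvDiff

namespace AdvDiff

namespace IsLocalSolution

variable {K : Set (ℝ × E3)} {u : Fin 3 → ℝ × E3 → ℝ} {G : Fin 3 → Fin 3 → ℝ × E3 → ℝ}
  {b : Fin 3 → ℝ × E3 → ℝ} {p : ℝ × E3 → ℝ}

theorem integral_moll_mul_timeDeriv {φ g : ℝ × E3 → ℝ} (hφ : ContDiff ℝ ∞ φ)
    (hφc : HasCompactSupport φ) (k : ℕ) (hg : Integrable g) :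
    ∫ z, g z * timeDeriv (moll k fun z => φ z * moll k g z) z =
      1 / 2 * ∫ z, moll k g z * (timeDeriv φ z * moll k g z) := by
  have hgl := hg.locallyIntegrable
  have hU := contDiff_moll k hgl
  have hU1 : ContDiff ℝ 1 (moll k g) := hU.of_le (by simp)
  have hφ1 : ContDiff ℝ 1 φ := hφ.of_le (by simp)
  set v : ℝ × E3 := (1, 0)
  have hcφ : Continuous fun z => fderiv ℝ φ z v :=
    (hφ1.continuous_fderiv one_ne_zero).clm_apply continuous_const
  have hcU : Continuous fun z => fderiv ℝ (moll k g) z v :=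
    (hU1.continuous_fderiv one_ne_zero).clm_apply continuous_const
  have h1 := integral_mul_fderiv_moll hφ hφc k hgl hg v
  have h2 := integral_mul_fderiv_of_hasCompactSupport (μ := (volume : Measure (ℝ × E3)))
    (hU1.pow 2) hφ1 hφc v
  have hd : ∀ z, fderiv ℝ (fun z => moll k g z ^ 2) z v =
      2 * (moll k g z * fderiv ℝ (moll k g) z v) := fun z => by
    rw [fderiv_fun_pow 2 (hU1.differentiable one_ne_zero z)]
    simp [mul_assoc]
  simp only [hd] at h2
  have i1 : Integrable fun z => moll k g z * (fderiv ℝ φ z v * moll k g z) :=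
    (hU.continuous.mul (hcφ.mul hU.continuous)).integrable_of_hasCompactSupport
      ((hφc.fderiv_apply ℝ v).mul_right.mul_left)
  have i2 : Integrable fun z => moll k g z * fderiv ℝ (moll k g) z v * φ z :=
    ((hU.continuous.mul hcU).mul hφ.continuous).integrable_of_hasCompactSupport hφc.mul_left
  have h3 : ∫ z, moll k g z * (fderiv ℝ φ z v * moll k g z) =
      -(2 * ∫ z, moll k g z * fderiv ℝ (moll k g) z v * φ z) := by
    rw [← integral_const_mul]
    refine Eq.trans ?_ (h2.trans ?_)
    · exact integral_congr_ae (Eventually.of_forall fun z => by simp only; ring)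
    · congr 1
      exact integral_congr_ae (Eventually.of_forall fun z => by simp only; ring)
  refine h1.trans ?_
  change _ = 1 / 2 * ∫ z, moll k g z * (fderiv ℝ φ z v * moll k g z)
  have h4 : ∫ z, moll k g z * (fderiv ℝ φ z v * moll k g z + φ z * fderiv ℝ (moll k g) z v) =
      (∫ z, moll k g z * (fderiv ℝ φ z v * moll k g z)) +
      ∫ z, moll k g z * fderiv ℝ (moll k g) z v * φ z := by
    rw [← integral_add i1 i2]
    exact integral_congr_ae (Eventually.of_forall fun z => by simp only; ring)
  rw [h4]
  linarith

section

variable (h : IsLocalSolution K u G b p) {φ : ℝ × E3 → ℝ} (hφ : ContDiff ℝ ∞ φ)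
  (hφc : HasCompactSupport φ) (k : ℕ)
  (hφK : Metric.cthickening (1 / ((k : ℝ) + 1)) (tsupport φ) ⊆ K)

include h hφK in
theorem mul_spaceDeriv_moll_eq (i j : Fin 3) (z : ℝ × E3) :
    φ z * spaceDeriv i (moll k (u j)) z = φ z * moll k (G i j) z := by
  by_cases hz : z ∈ tsupport φ
  · rw [h.fderiv_moll_eq k ((Metric.closedBall_subset_cthickening hz _).trans hφK)]
  · simp [image_eq_zero_of_notMem_tsupport hz]

include hφK in
theorem tsupport_moll_mul_subset (g : ℝ × E3 → ℝ) :
    tsupport (moll k fun z => φ z * g z) ⊆ K :=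
  (tsupport_moll_subset k).trans ((Metric.cthickening_subset_of_subset _
    (tsupport_mul_subset_left (f := φ) (g := g))).trans hφK)

theorem memLp_spaceDeriv_test (hφ : ContDiff ℝ ∞ φ) (hφc : HasCompactSupport φ) (v : ℝ × E3) :
    Continuous (fun z => fderiv ℝ φ z v) ∧ ∃ C, ∀ z, ‖fderiv ℝ φ z v‖ ≤ C := by
  have hc : Continuous fun z => fderiv ℝ φ z v :=
    ((hφ.of_le (by simp) : ContDiff ℝ 1 φ).continuous_fderiv one_ne_zero).clm_apply
      continuous_const
  exact ⟨hc, (hφc.fderiv_apply ℝ v).exists_bound_of_continuous hc⟩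

include h hφ hφc hφK in
theorem momentum_moll (j : Fin 3) :
    -(1 / 2 * ∫ z, moll k (u j) z * (timeDeriv φ z * moll k (u j) z)) =
      -(∑ i, ∫ z, moll k (G i j) z *
        (spaceDeriv i φ z * moll k (u j) z + φ z * moll k (G i j) z))
      - (∫ z, (∑ i, b i z * G i j z) * moll k (fun z => φ z * moll k (u j) z) z)
      + ∫ z, moll k p z * (spaceDeriv j φ z * moll k (u j) z + φ z * spaceDeriv j (moll k (u j)) z)
      := by
  have hul := (h.integrable_u j).locallyIntegrable
  have hU := contDiff_moll k hul
  have h1 := h.momentum j (moll k fun z => φ z * moll k (u j) z)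
    (contDiff_moll k (hφ.continuous.mul hU.continuous).locallyIntegrable)
    (hasCompactSupport_moll k hφc.mul_right) (tsupport_moll_mul_subset k hφK _)
  rw [integral_moll_mul_timeDeriv hφ hφc k (h.integrable_u j)] at h1
  rw [h1]
  congr 1
  · congr 2
    refine Finset.sum_congr rfl fun i _ => ?_
    refine (integral_mul_fderiv_moll hφ hφc k hul (h.integrable_G i j) _).trans ?_
    refine integral_congr_ae (Eventually.of_forall fun z => ?_)
    simp only
    rw [← mul_spaceDeriv_moll_eq h k hφK]
    rfl
  · exact integral_mul_fderiv_moll hφ hφc k hul h.integrable_p _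

include h hφ hφc hφK in
theorem sum_integral_pressure_moll :
    ∑ j, ∫ z, moll k p z *
        (spaceDeriv j φ z * moll k (u j) z + φ z * spaceDeriv j (moll k (u j)) z) =
      ∑ j, ∫ z, p z * moll k (fun z => spaceDeriv j φ z * moll k (u j) z) z := by
  have hU := fun j => contDiff_moll k (h.integrable_u j).locallyIntegrable
  have hP := contDiff_moll k h.integrable_p.locallyIntegrable
  have hcφ := fun j : Fin 3 => (memLp_spaceDeriv_test hφ hφc (0, basisVec j)).1
  have hcU : ∀ j, Continuous fun z => spaceDeriv j (moll k (u j)) z := fun j =>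
    (((hU j).of_le (by simp) : ContDiff ℝ 1 (moll k (u j))).continuous_fderiv
      one_ne_zero).clm_apply continuous_const
  have hsφ : ∀ j : Fin 3, HasCompactSupport (spaceDeriv j φ) := fun j => hφc.fderiv_apply ℝ _
  have i0 : ∀ j, Integrable fun z => spaceDeriv j φ z * moll k (u j) z := fun j =>
    ((hcφ j).mul (hU j).continuous).integrable_of_hasCompactSupport (hsφ j).mul_right
  have i1 : ∀ j, Integrable fun z => moll k p z * (spaceDeriv j φ z * moll k (u j) z) := fun j =>
    (hP.continuous.mul ((hcφ j).mul (hU j).continuous)).integrable_of_hasCompactSupport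
      ((hsφ j).mul_right.mul_left)
  have i2 : ∀ j, Integrable fun z => moll k p z * (φ z * spaceDeriv j (moll k (u j)) z) := fun j =>
    (hP.continuous.mul (hφ.continuous.mul (hcU j))).integrable_of_hasCompactSupport
      (hφc.mul_right.mul_left)
  have e : ∑ j, ∫ z, moll k p z * (φ z * spaceDeriv j (moll k (u j)) z) = 0 := by
    rw [← integral_finsetSum _ fun j _ => i2 j]
    refine integral_eq_zero_of_ae (Eventually.of_forall fun z => ?_)
    simp only [← Finset.mul_sum]
    by_cases hz : z ∈ tsupport φ
    · rw [h.sum_fderiv_moll_eq_zero k ((Metric.closedBall_subset_cthickening hz _).trans hφK)]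
      simp
    · simp [image_eq_zero_of_notMem_tsupport hz]
  simp only [mul_add]
  rw [Finset.sum_congr rfl fun j _ => integral_add (i1 j) (i2 j), Finset.sum_add_distrib, e,
    add_zero]
  exact Finset.sum_congr rfl fun j _ => (integral_mul_moll k h.integrable_p (i0 j)).symm

include h hφ hφc hφK in
theorem divFree_moll (j : Fin 3) :
    ∑ i, ∫ z, (b i z * moll k (u j) z) *
      (spaceDeriv i φ z * moll k (u j) z + 2 * (φ z * moll k (G i j) z)) = 0 := by
  have hU := contDiff_moll k (h.integrable_u j).locallyIntegrable
  have hs : tsupport (fun z => φ z * moll k (u j) z ^ 2) ⊆ K :=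
    tsupport_mul_subset_left.trans ((Metric.self_subset_cthickening _).trans hφK)
  have h1 := h.divFree_b (fun z => φ z * moll k (u j) z ^ 2) (hφ.mul (hU.pow 2)) hφc.mul_right hs
  rw [← h1]
  refine Finset.sum_congr rfl fun i _ => integral_congr_ae (Eventually.of_forall fun z => ?_)
  have hd : spaceDeriv i (fun z => φ z * moll k (u j) z ^ 2) z =
      spaceDeriv i φ z * moll k (u j) z ^ 2 +
        2 * (φ z * spaceDeriv i (moll k (u j)) z) * moll k (u j) z := by
    have h2 := hU.differentiable (by simp) z
    simp only [spaceDeriv]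
    rw [fderiv_fun_mul (hφ.differentiable (by simp) z) (h2.fun_pow 2), fderiv_fun_pow 2 h2]
    simp only [_root_.add_apply, _root_.smul_apply, smul_eq_mul, nsmul_eq_mul]
    norm_num
    ring
  simp only [hd]
  rw [mul_spaceDeriv_moll_eq h k hφK]
  ring

end

end IsLocalSolution

end AdvDiff

theorem tendsto_eLpNorm_add_sub_add {α : Type*} [MeasurableSpace α] {μ : Measure α}
    {f g : ℕ → α → ℝ} {f' g' : α → ℝ} (hf : ∀ k, MemLp (f k) 2 μ) (hg : ∀ k, MemLp (g k) 2 μ)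
    (hf' : MemLp f' 2 μ) (hg' : MemLp g' 2 μ)
    (h1 : Tendsto (fun k => eLpNorm (f k - f') 2 μ) atTop (𝓝 0))
    (h2 : Tendsto (fun k => eLpNorm (g k - g') 2 μ) atTop (𝓝 0)) :
    Tendsto (fun k => eLpNorm ((fun x => f k x + g k x) - fun x => f' x + g' x) 2 μ) atTop
      (𝓝 0) := by
  have h3 := h1.add h2
  rw [add_zero] at h3
  refine tendsto_of_tendsto_of_tendsto_of_le_of_le tendsto_const_nhds h3 (fun _ => zero_le)
    fun k => ?_
  have e : ((fun x => f k x + g k x) - fun x => f' x + g' x) = (f k - f') + (g k - g') := by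
    ext x
    simp only [Pi.sub_apply, Pi.add_apply]
    ring
  rw [e]
  exact eLpNorm_add_le ((hf k).sub hf').1 ((hg k).sub hg').1 (by norm_num)

namespace AdvDiff

theorem memLp_mul_of_mixed {b f : ℝ × E3 → ℝ} {β : ℝ → ℝ≥0∞}
    (hb : AEStronglyMeasurable b) (hbβ : ∀ᵐ z : ℝ × E3, ‖b z‖ₑ ≤ β z.1)
    (hi : ∫⁻ t, β t ^ (2 : ℝ) ≠ ⊤) (hf : AEStronglyMeasurable f) {M : ℝ≥0∞} (hM : M ≠ ⊤)
    (hfM : ∀ᵐ t, ∫⁻ x, ‖f (t, x)‖ₑ ^ (2 : ℝ) ≤ M) : MemLp (fun z => b z * f z) 2 volume := by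
  have hbf : AEStronglyMeasurable fun z => b z * f z := hb.mul hf
  refine ⟨hbf, ?_⟩
  have h1 : eLpNorm (fun z => b z * f z) 2 volume ^ (2 : ℝ) < ⊤ := by
    rw [eLpNorm_two_sq_eq_slab hbf]
    rw [Measure.volume_eq_prod] at hbβ hf
    refine lt_of_le_of_lt (lintegral_mono_ae (g := fun t => β t ^ (2 : ℝ) * M) ?_) ?_
    · filter_upwards [Measure.ae_ae_of_ae_prod hbβ, hf.prodMk_left, hfM] with t ht hft h2
      refine le_trans ?_ (mul_le_mul_right h2 _)
      rw [← lintegral_const_mul'' _ (hft.enorm.pow_const _)]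
      refine lintegral_mono_ae ?_
      filter_upwards [ht] with x hx
      rw [enorm_mul, ENNReal.mul_rpow_of_nonneg _ _ (by norm_num)]
      gcongr
    · rw [lintegral_mul_const' _ _ hM]
      exact ENNReal.mul_lt_top hi.lt_top hM.lt_top
  exact (ENNReal.rpow_lt_top_iff_of_pos (by norm_num)).1 h1

theorem mixed_mul_lt_top {b f : ℝ × E3 → ℝ} {β : ℝ → ℝ≥0∞}
    (hβ : AEMeasurable β) (hbβ : ∀ᵐ z : ℝ × E3, ‖b z‖ₑ ≤ β z.1)
    (hi : ∫⁻ t, β t ^ (2 : ℝ) ≠ ⊤) (hf : MemLp f 2 volume) :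
    ∫⁻ t, (∫⁻ x, ‖b (t, x) * f (t, x)‖ₑ ^ (2 : ℝ)) ^ (1 / 2 : ℝ) ≠ ⊤ := by
  have hsq : ∀ c : ℝ≥0∞, (c ^ (1 / 2 : ℝ)) ^ (2 : ℝ) = c := fun c => by
    rw [← ENNReal.rpow_mul]; norm_num
  have hsq' : ∀ c : ℝ≥0∞, (c ^ (2 : ℝ)) ^ (1 / 2 : ℝ) = c := fun c => by
    rw [← ENNReal.rpow_mul]; norm_num
  have hm := (aemeasurable_lintegral_slice_sq hf.1).pow_const (1 / 2 : ℝ)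
  have h1 : ∫⁻ t, (∫⁻ x, ‖b (t, x) * f (t, x)‖ₑ ^ (2 : ℝ)) ^ (1 / 2 : ℝ) ≤
      ∫⁻ t, β t * (∫⁻ x, ‖f (t, x)‖ₑ ^ (2 : ℝ)) ^ (1 / 2 : ℝ) := by
    have hf1 := hf.1
    rw [Measure.volume_eq_prod] at hbβ hf1
    refine lintegral_mono_ae ?_
    filter_upwards [Measure.ae_ae_of_ae_prod hbβ, hf1.prodMk_left] with t ht hft
    rw [← hsq' (β t), ← ENNReal.mul_rpow_of_nonneg _ _ (by norm_num)]
    refine ENNReal.rpow_le_rpow ?_ (by norm_num)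
    rw [← lintegral_const_mul'' _ (hft.enorm.pow_const _)]
    refine lintegral_mono_ae ?_
    filter_upwards [ht] with x hx
    rw [enorm_mul, ENNReal.mul_rpow_of_nonneg _ _ (by norm_num)]
    gcongr
  refine (h1.trans_lt ((ENNReal.lintegral_mul_le_Lp_mul_Lq _ Real.HolderConjugate.two_two hβ
    hm).trans_lt (ENNReal.mul_lt_top ?_ ?_))).ne
  · exact ENNReal.rpow_lt_top_of_nonneg (by norm_num) hi
  · simp only [hsq]
    rw [← eLpNorm_two_sq_eq_slab hf.1]
    exact ENNReal.rpow_lt_top_of_nonneg (by norm_num)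
      (ENNReal.rpow_ne_top_of_nonneg (by norm_num) hf.2.ne)

namespace IsLocalSolution

variable {K : Set (ℝ × E3)} {u : Fin 3 → ℝ × E3 → ℝ} {G : Fin 3 → Fin 3 → ℝ × E3 → ℝ}
  {b : Fin 3 → ℝ × E3 → ℝ} {p : ℝ × E3 → ℝ}

/-- The local energy equality. -/
theorem energy_equality (h : IsLocalSolution K u G b p) {φ : ℝ × E3 → ℝ} (hφ : ContDiff ℝ ∞ φ)
    (hφc : HasCompactSupport φ) {ε : ℝ} (hε : 0 < ε)
    (hφK : Metric.cthickening ε (tsupport φ) ⊆ K) :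
    -(1 / 2 * ∑ j, ∫ z, u j z * (timeDeriv φ z * u j z)) =
      -(∑ j, ∑ i, ∫ z, G i j z * (spaceDeriv i φ z * u j z))
      - (∑ j, ∑ i, ∫ z, G i j z * (φ z * G i j z))
      + 1 / 2 * (∑ j, ∑ i, ∫ z, b i z * u j z * (spaceDeriv i φ z * u j z))
      + ∑ j, ∫ z, p z * (spaceDeriv j φ z * u j z) := by
  obtain ⟨M, hMt, hM⟩ := h.bounded_u
  obtain ⟨β, hβ, hβi, hbβ⟩ := h.bounded_b
  obtain ⟨hct, Ct, hCt⟩ := memLp_spaceDeriv_test hφ hφc (1, 0)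
  have hcs := fun i : Fin 3 => (memLp_spaceDeriv_test hφ hφc (0, basisVec i)).1
  choose Cs hCs using fun i : Fin 3 => (memLp_spaceDeriv_test hφ hφc (0, basisVec i)).2
  obtain ⟨C, hC⟩ := hφc.exists_bound_of_continuous hφ.continuous
  have hφm := hφ.continuous.aestronglyMeasurable (μ := (volume : Measure (ℝ × E3)))
  have hUl := fun k j => memLp_moll k (h.memLp_u j)
  have hUt := fun j => tendsto_eLpNorm_moll_sub (h.memLp_u j)
  have hGl := fun k i j => memLp_moll k (h.memLp_G i j)
  have hGt := fun i j => tendsto_eLpNorm_moll_sub (h.memLp_G i j)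
  have hsU : ∀ k i j, MemLp (fun z => spaceDeriv i φ z * moll k (u j) z) 2 volume := fun k i j =>
    memLp_two_bdd_mul (hcs i).aestronglyMeasurable (hCs i) (hUl k j)
  have hsu : ∀ i j, MemLp (fun z => spaceDeriv i φ z * u j z) 2 volume := fun i j =>
    memLp_two_bdd_mul (hcs i).aestronglyMeasurable (hCs i) (h.memLp_u j)
  have hφG := fun k i j => memLp_two_bdd_mul hφm hC (hGl k i j)
  have hφg := fun i j => memLp_two_bdd_mul hφm hC (h.memLp_G i j)
  have hφu := fun j => memLp_two_bdd_mul hφm hC (h.memLp_u j)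
  have tφG := fun i j => tendsto_eLpNorm_bdd_mul hC (hGt i j)
  have tsU : ∀ i j, Tendsto (fun k => eLpNorm ((fun z => spaceDeriv i φ z * moll k (u j) z) -
      fun z => spaceDeriv i φ z * u j z) 2 volume) atTop (𝓝 0) := fun i j =>
    tendsto_eLpNorm_bdd_mul (hCs i) (hUt j)
  have hbu := fun i j => memLp_mul_of_mixed (h.measurable_b i) (hbβ i) hβi (h.memLp_u j).1 hMt
    (hM j)
  have hbU := fun k i j => memLp_mul_of_mixed (h.measurable_b i) (hbβ i) hβi (hUl k j).1 hMt
    (Eventually.of_forall (lintegral_moll_sq_le k (h.memLp_u j).1 (hM j)))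
  have tbU : ∀ i j, Tendsto (fun k => eLpNorm ((fun z => b i z * moll k (u j) z) -
      fun z => b i z * u j z) 2 volume) atTop (𝓝 0) := fun i j => by
    have := tendsto_eLpNorm_mul_of_mixed (D := fun k => moll k (u j) - u j) (M := 2 * (M + M))
      (h.measurable_b i) hβ (hbβ i) hβi (fun k => ((hUl k j).sub (h.memLp_u j)).1)
      (ENNReal.mul_ne_top (by norm_num) (ENNReal.add_ne_top.2 ⟨hMt, hMt⟩)) (fun k => by
        filter_upwards [hM j] with t ht
        refine lintegral_slice_sub_sq_le ?_ (lintegral_moll_sq_le k (h.memLp_u j).1 (hM j) t) ht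
        exact ((contDiff_moll k ((h.memLp_u j).locallyIntegrable (by norm_num))).continuous.comp
          (by fun_prop)).aestronglyMeasurable) (hUt j)
    refine this.congr fun k => ?_
    congr 1
    ext z
    simp [mul_sub]
  have hbG : ∀ i j, AEStronglyMeasurable fun z => b i z * G i j z := fun i j =>
    (h.measurable_b i).mul (h.memLp_G i j).1
  have hbGi := fun i j => mixed_mul_lt_top hβ (hbβ i) hβi (h.memLp_G i j)
  -- the limits of the terms of the identities for mollified functions
  have T1 := tendsto_finsetSum Finset.univ fun j _ =>
    tendsto_integral_mul_of_tendsto_eLpNorm (fun k => hUl k j)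
      (fun k => memLp_two_bdd_mul hct.aestronglyMeasurable hCt (hUl k j)) (h.memLp_u j)
      (memLp_two_bdd_mul hct.aestronglyMeasurable hCt (h.memLp_u j)) (hUt j)
      (tendsto_eLpNorm_bdd_mul hCt (hUt j))
  have T2 := tendsto_finsetSum Finset.univ fun j _ => tendsto_finsetSum Finset.univ fun i _ =>
    tendsto_integral_mul_of_tendsto_eLpNorm (fun k => hGl k i j)
      (fun k => (hsU k i j).add (hφG k i j)) (h.memLp_G i j) ((hsu i j).add (hφg i j)) (hGt i j)
      (tendsto_eLpNorm_add_sub_add (fun k => hsU k i j) (fun k => hφG k i j) (hsu i j) (hφg i j)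
        (tsU i j) (tφG i j))
  have T3 := tendsto_finsetSum Finset.univ fun j _ => tendsto_finsetSum Finset.univ fun i _ =>
    tendsto_integral_mul_moll_mul_moll (hbG i j) (hbGi i j) hφm hC (h.memLp_u j) hMt (hM j)
  have T4 := tendsto_finsetSum Finset.univ fun j _ =>
    tendsto_integral_mul_moll_mul_moll h.integrable_p.1 h.mixed_p (hcs j).aestronglyMeasurable
      (hCs j) (h.memLp_u j) hMt (hM j)
  have T5 := fun j => tendsto_finsetSum Finset.univ fun i _ =>
    tendsto_integral_mul_of_tendsto_eLpNorm (fun k => hbU k i j)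
      (fun k => (hsU k i j).add ((hφG k i j).const_mul 2)) (hbu i j)
      ((hsu i j).add ((hφg i j).const_mul 2)) (tbU i j)
      (tendsto_eLpNorm_add_sub_add (fun k => hsU k i j) (fun k => (hφG k i j).const_mul 2)
        (hsu i j) ((hφg i j).const_mul 2) (tsU i j)
        (tendsto_eLpNorm_bdd_mul (A := 2) (fun _ => by norm_num) (tφG i j)))
  obtain ⟨N, hN⟩ := exists_nat_one_div_lt hε
  have hK : ∀ k ≥ N, Metric.cthickening (1 / ((k : ℝ) + 1)) (tsupport φ) ⊆ K := fun k hk =>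
    (Metric.cthickening_mono (le_trans (by gcongr) hN.le) _).trans hφK
  have hhs : ∀ k j, ∫ z, (∑ i, b i z * G i j z) * moll k (fun z => φ z * moll k (u j) z) z =
      ∑ i, ∫ z, b i z * G i j z * moll k (fun z => φ z * moll k (u j) z) z := fun k j => by
    simp only [Finset.sum_mul]
    refine integral_finsetSum _ fun i _ => ?_
    have hm := memLp_two_bdd_mul hφm hC (hUl k j)
    refine integrable_mul_of_mixed (hbG i j) (memLp_moll k hm).1 (hbGi i j)
      (M := ENNReal.ofReal C ^ (2 : ℝ) * M) (ENNReal.mul_ne_top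
      (ENNReal.rpow_ne_top_of_nonneg (by norm_num) ENNReal.ofReal_ne_top) hMt)
      (Eventually.of_forall fun t => ?_)
    exact lintegral_moll_sq_le k hm.1 (Eventually.of_forall fun s => lintegral_slice_mul_sq_le hC
      (lintegral_moll_sq_le k (h.memLp_u j).1 (hM j) s)) t
  have key : ∀ k ≥ N, -(1 / 2 * ∑ j, ∫ z, moll k (u j) z * (timeDeriv φ z * moll k (u j) z)) =
      -(∑ j, ∑ i, ∫ z, moll k (G i j) z *
        (spaceDeriv i φ z * moll k (u j) z + φ z * moll k (G i j) z))
      - (∑ j, ∑ i, ∫ z, b i z * G i j z * moll k (fun z => φ z * moll k (u j) z) z)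
      + ∑ j, ∫ z, p z * moll k (fun z => spaceDeriv j φ z * moll k (u j) z) z := fun k hk => by
    have h1 := Finset.sum_congr rfl fun j (_ : j ∈ Finset.univ) =>
      h.momentum_moll hφ hφc k (hK k hk) j
    simp only [Finset.sum_add_distrib, Finset.sum_sub_distrib, Finset.sum_neg_distrib,
      ← Finset.mul_sum, hhs] at h1
    rw [h1, h.sum_integral_pressure_moll hφ hφc k (hK k hk)]
  have L : -(1 / 2 * ∑ j, ∫ z, u j z * (timeDeriv φ z * u j z)) =
      -(∑ j, ∑ i, ∫ z, G i j z * (spaceDeriv i φ z * u j z + φ z * G i j z))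
      - (∑ j, ∑ i, ∫ z, b i z * G i j z * (φ z * u j z))
      + ∑ j, ∫ z, p z * (spaceDeriv j φ z * u j z) := tendsto_nhds_unique_of_eventuallyEq (T1.const_mul (1 / 2)).neg
    ((T2.neg.sub T3).add T4) ((eventually_ge_atTop N).mono key)
  have L5 : ∀ j, ∑ i, ∫ z, b i z * u j z * (spaceDeriv i φ z * u j z + 2 * (φ z * G i j z)) = 0 :=
    fun j => tendsto_nhds_unique_of_eventuallyEq (T5 j) tendsto_const_nhds
      ((eventually_ge_atTop N).mono fun k hk => h.divFree_moll hφ hφc k (hK k hk) j)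
  have e2 : ∀ i j, ∫ z, G i j z * (spaceDeriv i φ z * u j z + φ z * G i j z) =
      (∫ z, G i j z * (spaceDeriv i φ z * u j z)) + ∫ z, G i j z * (φ z * G i j z) := fun i j => by
    simp only [mul_add]
    exact integral_add ((h.memLp_G i j).integrable_mul (hsu i j))
      ((h.memLp_G i j).integrable_mul (hφg i j))
  have e5 : ∀ i j, ∫ z, b i z * u j z * (spaceDeriv i φ z * u j z + 2 * (φ z * G i j z)) =
      (∫ z, b i z * u j z * (spaceDeriv i φ z * u j z)) +
        2 * ∫ z, b i z * G i j z * (φ z * u j z) := fun i j => by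
    simp only [mul_add]
    rw [← integral_const_mul]
    refine (integral_add ((hbu i j).integrable_mul (hsu i j))
      ((hbu i j).integrable_mul ((hφg i j).const_mul 2))).trans ?_
    congr 1
    exact integral_congr_ae (Eventually.of_forall fun z => by simp only [Pi.mul_apply]; ring)
  simp only [e5, Finset.sum_add_distrib, ← Finset.mul_sum] at L5
  have L6 := Finset.sum_congr rfl fun j (_ : j ∈ Finset.univ) => L5 j
  rw [Finset.sum_add_distrib, ← Finset.mul_sum, Finset.sum_const_zero] at L6
  simp only [e2, Finset.sum_add_distrib] at L
  linarith

end IsLocalSolution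

end AdvDiff

namespace AdvDiff

theorem smoothWeight_add (a b : ℝ) (x : E3) :
    smoothWeight (a + b) x = smoothWeight a x * smoothWeight b x := by
  rw [smoothWeight, smoothWeight, smoothWeight, neg_add, Real.rpow_add (bracket_pos x)]

theorem smoothWeight_rpow (a r : ℝ) (x : E3) : smoothWeight a x ^ r = smoothWeight (a * r) x := by
  rw [smoothWeight, smoothWeight, ← Real.rpow_mul (bracket_pos x).le, neg_mul]

theorem smoothWeight_zero (x : E3) : smoothWeight 0 x = 1 := by simp [smoothWeight]

theorem smoothWeight_neg_mul_self (a : ℝ) (x : E3) : smoothWeight (-a) x * smoothWeight a x = 1 := by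
  rw [← smoothWeight_add, neg_add_cancel, smoothWeight_zero]

theorem smoothWeight_le {δ : ℝ} (hδ : 0 ≤ δ) (x : E3) :
    smoothWeight δ x ≤ 2 ^ δ * weight δ x := by
  have h1 := one_le_bracket x
  have h2 := norm_le_bracket x
  have h3 : 0 < 1 + ‖x‖ := by positivity
  rw [smoothWeight, weight, mul_one_div, ← Real.div_rpow (by norm_num) h3.le,
    Real.rpow_neg (bracket_pos x).le, ← Real.inv_rpow (bracket_pos x).le]
  refine Real.rpow_le_rpow (inv_nonneg.2 (bracket_pos x).le) ?_ hδ
  rw [inv_le_comm₀ (bracket_pos x) (by positivity), inv_div, div_le_iff₀ (by norm_num)]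
  linarith

theorem eLpNorm_weightedVolume {V : Type*} [NormedAddCommGroup V] {r : ℝ≥0∞} (hr : r ≠ 0)
    (hr' : r ≠ ⊤) (δ : ℝ) (g : E3 → V) :
    eLpNorm g r (weightedVolume δ) =
      (∫⁻ x, ENNReal.ofReal (weight δ x) * ‖g x‖ₑ ^ r.toReal) ^ (1 / r.toReal) := by
  have hw : Measurable fun x : E3 => ENNReal.ofReal (weight δ x) := by
    unfold weight
    fun_prop
  rw [eLpNorm_eq_lintegral_rpow_enorm_toReal hr hr', weightedVolume,
    lintegral_withDensity_eq_lintegral_mul_non_measurable _ hw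
      (Eventually.of_forall fun _ => ENNReal.ofReal_lt_top)]
  rfl

theorem eLpNorm_smoothWeight_mul_le {V : Type*} [NormedAddCommGroup V] {r : ℝ≥0∞} (hr : r ≠ 0)
    (hr' : r ≠ ⊤) {δ : ℝ} (hδ : 0 ≤ δ) {g : E3 → V} {f : E3 → ℝ} (h : ∀ x, ‖f x‖ ≤ ‖g x‖) :
    eLpNorm (fun x => smoothWeight (δ / r.toReal) x * f x) r volume ≤
      ENNReal.ofReal (2 ^ δ) ^ (1 / r.toReal) * eLpNorm g r (weightedVolume δ) := by
  have hr0 : 0 < r.toReal := ENNReal.toReal_pos hr hr'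
  rw [eLpNorm_weightedVolume hr hr', eLpNorm_eq_lintegral_rpow_enorm_toReal hr hr',
    ← ENNReal.mul_rpow_of_nonneg _ _ (by positivity),
    ← lintegral_const_mul' _ _ ENNReal.ofReal_ne_top]
  refine ENNReal.rpow_le_rpow (lintegral_mono fun x => ?_) (by positivity)
  have hw := smoothWeight_pos (δ / r.toReal) x
  rw [enorm_mul, ENNReal.mul_rpow_of_nonneg _ _ hr0.le, ← mul_assoc,
    Real.enorm_of_nonneg hw.le, ENNReal.ofReal_rpow_of_nonneg hw.le hr0.le, smoothWeight_rpow,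
    div_mul_cancel₀ _ hr0.ne', ← ENNReal.ofReal_mul (by positivity)]
  gcongr
  · exact smoothWeight_le hδ x
  · rw [← ofReal_norm, ← ofReal_norm]
    exact ENNReal.ofReal_le_ofReal (h x)

theorem measurableSet_slab (T : ℝ) : MeasurableSet (slab T) := measurableSet_Ioo.prod .univ

theorem isOpen_slab (T : ℝ) : IsOpen (slab T) := isOpen_Ioo.prod isOpen_univ

/-- A function on the slab extended by zero. -/
noncomputable def cut (T : ℝ) (f : ℝ × E3 → ℝ) : ℝ × E3 → ℝ := (slab T).indicator f

theorem cut_of_mem {T : ℝ} {f : ℝ × E3 → ℝ} {z : ℝ × E3} (hz : z ∈ slab T) : cut T f z = f z :=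
  indicator_of_mem hz f

theorem cut_of_notMem {T : ℝ} {f : ℝ × E3 → ℝ} {z : ℝ × E3} (hz : z ∉ slab T) : cut T f z = 0 :=
  indicator_of_notMem hz f

theorem cut_slice_of_mem {T t : ℝ} (ht : t ∈ Ioo 0 T) (f : ℝ × E3 → ℝ) (x : E3) :
    cut T f (t, x) = f (t, x) := cut_of_mem ⟨ht, mem_univ _⟩

theorem cut_slice_of_notMem {T t : ℝ} (ht : t ∉ Ioo 0 T) (f : ℝ × E3 → ℝ) (x : E3) :
    cut T f (t, x) = 0 := cut_of_notMem fun h => ht h.1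

theorem aestronglyMeasurable_cut {T : ℝ} {f : ℝ × E3 → ℝ}
    (hf : AEStronglyMeasurable f (volume.restrict (slab T))) : AEStronglyMeasurable (cut T f) :=
  (aestronglyMeasurable_indicator_iff (measurableSet_slab T)).2 hf

theorem memLp_cut_of_memLqLr {V : Type*} [NormedAddCommGroup V] {r : ℝ≥0∞} (hr : r ≠ 0)
    (hr' : r ≠ ⊤) {δ : ℝ} (hδ : 0 ≤ δ) {T : ℝ} {g : ℝ → E3 → V}
    (hg : MemLqLr T r r (weightedVolume δ) g) {f : ℝ × E3 → ℝ}
    (hf : AEStronglyMeasurable f (volume.restrict (slab T))) (h : ∀ z, ‖f z‖ ≤ ‖g z.1 z.2‖) :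
    MemLp (fun z => smoothWeight (δ / r.toReal) z.2 * cut T f z) r volume := by
  have hr0 : 0 < r.toReal := ENNReal.toReal_pos hr hr'
  have hw : AEStronglyMeasurable (fun z : ℝ × E3 => smoothWeight (δ / r.toReal) z.2) :=
    ((continuous_smoothWeight _).comp continuous_snd).aestronglyMeasurable
  have hm : AEStronglyMeasurable fun z => smoothWeight (δ / r.toReal) z.2 * cut T f z :=
    hw.mul (aestronglyMeasurable_cut hf)
  refine ⟨hm, ?_⟩
  rw [eLpNorm_lt_top_iff_lintegral_rpow_enorm_lt_top hr hr']
  rw [lintegral_slab (hm.enorm.pow_const _)]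
  have hC : (ENNReal.ofReal (2 ^ δ) ^ (1 / r.toReal)) ^ r.toReal ≠ ⊤ :=
    ENNReal.rpow_ne_top_of_nonneg hr0.le
      (ENNReal.rpow_ne_top_of_nonneg (by positivity) ENNReal.ofReal_ne_top)
  have hg2 := (eLpNorm_lt_top_iff_lintegral_rpow_enorm_lt_top hr hr').1 hg.2
  simp only [enorm_eq_self] at hg2
  refine lt_of_le_of_lt ?_ (ENNReal.mul_lt_top hC.lt_top hg2)
  rw [← lintegral_const_mul' _ _ hC, ← lintegral_indicator measurableSet_Ioo]
  refine lintegral_mono fun t => ?_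
  by_cases ht : t ∈ Ioo 0 T
  · rw [indicator_of_mem ht]
    have h1 := eLpNorm_smoothWeight_mul_le hr hr' hδ (f := fun x => f (t, x)) (g := g t)
      (fun x => h (t, x))
    rw [← ENNReal.mul_rpow_of_nonneg _ _ hr0.le]
    refine le_trans (le_of_eq ?_) (ENNReal.rpow_le_rpow h1 hr0.le)
    rw [eLpNorm_eq_lintegral_rpow_enorm_toReal hr hr', ← ENNReal.rpow_mul,
      one_div_mul_cancel hr0.ne', ENNReal.rpow_one]
    simp only [cut_slice_of_mem ht]
  · simp [cut_slice_of_notMem ht, hr0]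

theorem MemLqLr.of_top {V : Type*} [NormedAddCommGroup V] {T : ℝ} {q r : ℝ≥0∞} {m : Measure E3}
    {f : ℝ → E3 → V} (h : MemLqLr T ⊤ r m f) : MemLqLr T q r m f := by
  refine ⟨h.1, ?_⟩
  have h2 := h.2
  rw [eLpNorm_exponent_top] at h2
  refine (eLpNorm_le_of_ae_enorm_bound ae_le_eLpNormEssSup).trans_lt ?_
  rw [smul_eq_mul]
  refine ENNReal.mul_lt_top h2 (ENNReal.rpow_lt_top_of_nonneg (by positivity) ?_)
  simp

theorem exists_bound_of_memLqLr_top {V : Type*} [NormedAddCommGroup V] {δ : ℝ} (hδ : 0 ≤ δ)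
    {T : ℝ} {g : ℝ → E3 → V} (hg : MemLqLr T ⊤ 2 (weightedVolume δ) g) :
    ∃ M : ℝ≥0∞, M ≠ ⊤ ∧ ∀ f : ℝ × E3 → ℝ, (∀ z, ‖f z‖ ≤ ‖g z.1 z.2‖) →
      ∀ᵐ t, ∫⁻ x, ‖smoothWeight (δ / 2) x * cut T f (t, x)‖ₑ ^ (2 : ℝ) ≤ M := by
  have h2 := hg.2
  rw [eLpNorm_exponent_top] at h2
  refine ⟨(ENNReal.ofReal (2 ^ δ) ^ (1 / 2 : ℝ) * _) ^ (2 : ℝ), ENNReal.rpow_ne_top_of_nonneg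
    (by norm_num) (ENNReal.mul_ne_top (ENNReal.rpow_ne_top_of_nonneg (by norm_num)
    ENNReal.ofReal_ne_top) h2.ne), fun f hf => ?_⟩
  have h3 := (ae_restrict_iff' measurableSet_Ioo).1 (ae_le_eLpNormEssSup
    (f := fun t => eLpNorm (g t) 2 (weightedVolume δ)) (μ := volume.restrict (Ioo 0 T)))
  filter_upwards [h3] with t ht
  by_cases htT : t ∈ Ioo 0 T
  · have h1 := eLpNorm_smoothWeight_mul_le (r := 2) (by norm_num) (by norm_num) hδ
      (f := fun x => f (t, x)) (g := g t) (fun x => hf (t, x))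
    rw [ENNReal.toReal_ofNat] at h1
    have h4 := ENNReal.rpow_le_rpow (h1.trans (mul_le_mul_right (ht htT) _))
      (by norm_num : (0 : ℝ) ≤ 2)
    refine le_trans (le_of_eq ?_) h4
    rw [eLpNorm_two_eq, ← ENNReal.rpow_mul]
    simp only [cut_slice_of_mem htT]
    norm_num
  · simp [cut_slice_of_notMem htT]

/-- The essential supremum of the slices of a function is measurable. -/
theorem exists_slice_essSup {f : ℝ × E3 → ℝ≥0∞} (hf : AEMeasurable f) :
    ∃ β : ℝ → ℝ≥0∞, Measurable β ∧ (∀ᵐ t, β t = essSup (fun x => f (t, x)) volume) ∧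
      ∀ᵐ z : ℝ × E3, f z ≤ β z.1 := by
  set f' := hf.mk f with hf'
  have hfm : Measurable f' := hf.measurable_mk
  have hfae : ∀ᵐ z, f z = f' z := hf.ae_eq_mk
  have hβ : Measurable fun t => essSup (fun x => f' (t, x)) volume := by
    refine measurable_of_Iic fun c => ?_
    have : (fun t => essSup (fun x => f' (t, x)) volume) ⁻¹' Iic c =
        (fun t => volume (Prod.mk t ⁻¹' {z : ℝ × E3 | c < f' z})) ⁻¹' {0} := by
      ext t
      simp only [mem_preimage, mem_Iic, mem_singleton_iff]
      constructor
      · intro h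
        have h1 := ae_le_essSup (f := fun x => f' (t, x)) (μ := volume)
        refine measure_mono_null (fun x hx => ?_) (ae_iff.1 h1)
        exact not_le.2 (lt_of_le_of_lt h hx)
      · intro h
        refine essSup_le_of_ae_le c (ae_iff.2 ?_)
        simpa using h
    rw [this]
    exact measurable_measure_prodMk_left (measurableSet_lt measurable_const hfm)
      (measurableSet_singleton 0)
  refine ⟨_, hβ, ?_, ?_⟩
  · rw [Measure.volume_eq_prod] at hfae
    filter_upwards [Measure.ae_ae_of_ae_prod hfae] with t ht
    exact (essSup_congr_ae ht).symm
  · have h1 : ∀ᵐ z : ℝ × E3, f' z ≤ essSup (fun x => f' (z.1, x)) volume := by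
      rw [Measure.volume_eq_prod]
      exact (Measure.ae_prod_iff_ae_ae (measurableSet_le hfm (hβ.comp measurable_fst))).2
        (Eventually.of_forall fun t => ae_le_essSup)
    filter_upwards [h1, hfae] with z hz hz'
    rw [hz']
    exact hz

theorem exists_bound_of_memLocL2LInfty {V : Type*} [NormedAddCommGroup V] {T : ℝ}
    {b : ℝ → E3 → V} (hb : MemLocL2LInfty T b) {K : Set (ℝ × E3)} (hK : IsCompact K)
    (hKT : K ⊆ slab T) :
    ∃ β : ℝ → ℝ≥0∞, AEMeasurable β ∧ ∫⁻ t, β t ^ (2 : ℝ) ≠ ⊤ ∧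
      ∀ᵐ z : ℝ × E3, ‖K.indicator (Function.uncurry b) z‖ₑ ≤ β z.1 := by
  obtain ⟨h1, h2⟩ := hb K hK hKT
  have hm : AEStronglyMeasurable (K.indicator (Function.uncurry b)) := by
    have h3 : AEStronglyMeasurable ((slab T).indicator (K.indicator (Function.uncurry b))) :=
      (aestronglyMeasurable_indicator_iff (measurableSet_slab T)).2 h1
    rwa [indicator_indicator, inter_eq_self_of_subset_right hKT] at h3
  obtain ⟨β, hβ, hβe, hβb⟩ := exists_slice_essSup hm.enorm
  refine ⟨β, hβ.aemeasurable, ?_, hβb⟩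
  have h3 := (eLpNorm_lt_top_iff_lintegral_rpow_enorm_lt_top (by norm_num) (by norm_num)).1 h2
  simp only [enorm_eq_self, eLpNorm_exponent_top, ENNReal.toReal_ofNat] at h3
  refine (lt_of_eq_of_lt ?_ h3).ne
  rw [← lintegral_indicator measurableSet_Ioo]
  refine lintegral_congr_ae ?_
  filter_upwards [hβe] with t ht
  by_cases htT : t ∈ Ioo 0 T
  · rw [indicator_of_mem htT, ht]
    rfl
  · rw [indicator_of_notMem htT, ht]
    have : (fun x => ‖K.indicator (Function.uncurry b) (t, x)‖ₑ) = fun _ => 0 := by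
      ext x
      rw [indicator_of_notMem fun h => htT (hKT h).1, enorm_zero]
    rw [this]
    have h0 : essSup (fun _ : E3 => (0 : ℝ≥0∞)) volume = 0 :=
      le_antisymm (essSup_le_of_ae_le 0 (Eventually.of_forall fun _ => le_rfl)) zero_le
    simp [h0]

end AdvDiff

namespace ENNReal

instance : HolderTriple 3 6 2 where
  inv_add_inv_eq_inv := by
    rw [← ENNReal.toReal_eq_toReal_iff' (by simp) (by simp), ENNReal.toReal_add (by simp) (by simp)]
    norm_num

instance : HolderTriple 3 2 (6 / 5) where
  inv_add_inv_eq_inv := by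
    rw [← ENNReal.toReal_eq_toReal_iff' (by simp) (by simp),
      ENNReal.toReal_add (by simp) (by simp)]
    simp [ENNReal.toReal_div]
    norm_num

end ENNReal

theorem integral_sub_add_sub {α : Type*} [MeasurableSpace α] {μ : Measure α} {f g h k : α → ℝ}
    (hf : Integrable f μ) (hg : Integrable g μ) (hh : Integrable h μ) (hk : Integrable k μ) :
    ∫ x, (f x - g x + h x - k x) ∂μ =
      (∫ x, f x ∂μ) - (∫ x, g x ∂μ) + (∫ x, h x ∂μ) - ∫ x, k x ∂μ := by
  have h1 : Integrable (fun x => f x - g x) μ := hf.sub hg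
  have h2 : Integrable (fun x => f x - g x + h x) μ := h1.add hh
  rw [integral_sub h2 hk, integral_add h1 hh, integral_sub hf hg]

namespace AdvDiff

/-- Solutions of the advection-diffusion problem on the slab, extended by zero, in weighted spaces;
the equations are tested on functions supported in the slab. -/
structure IsWeightedSolution (γ T : ℝ) (b : Fin 3 → ℝ × E3 → ℝ) (F : Fin 3 → Fin 3 → ℝ × E3 → ℝ)
    (u : Fin 3 → ℝ × E3 → ℝ) (G : Fin 3 → Fin 3 → ℝ × E3 → ℝ) (p : ℝ × E3 → ℝ) : Prop where
  memLp_u : ∀ j, MemLp (fun z => smoothWeight (γ / 2) z.2 * u j z) 2 volume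
  bounded_u : ∃ M : ℝ≥0∞, M ≠ ⊤ ∧
    ∀ j, ∀ᵐ t, ∫⁻ x, ‖smoothWeight (γ / 2) x * u j (t, x)‖ₑ ^ (2 : ℝ) ≤ M
  memLp_G : ∀ i j, MemLp (fun z => smoothWeight (γ / 2) z.2 * G i j z) 2 volume
  memLp_b : ∀ i, MemLp (fun z => smoothWeight (γ / 2) z.2 * b i z) 3 volume
  bounded_b : ∀ K, IsCompact K → K ⊆ slab T → ∃ β : ℝ → ℝ≥0∞, AEMeasurable β ∧
    ∫⁻ t, β t ^ (2 : ℝ) ≠ ⊤ ∧ ∀ i, ∀ᵐ z : ℝ × E3, ‖K.indicator (b i) z‖ₑ ≤ β z.1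
  measurable_p : AEStronglyMeasurable p
  integrable_p : ∀ K, IsCompact K → K ⊆ slab T → IntegrableOn p K
  riesz : ∀ᵐ t, IsRieszSum (fun i j x => b i (t, x) * u j (t, x) - F i j (t, x))
    fun x => p (t, x)
  gradient : ∀ i j φ, IsTestSlab T φ → ∫ z, u j z * spaceDeriv i φ z = -∫ z, G i j z * φ z
  momentum : ∀ j φ, IsTestSlab T φ →
    -∫ z, u j z * timeDeriv φ z = -(∑ i, ∫ z, G i j z * spaceDeriv i φ z)
      - (∫ z, (∑ i, b i z * G i j z) * φ z) + (∫ z, p z * spaceDeriv j φ z)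
      - ∑ i, ∫ z, F i j z * spaceDeriv i φ z
  divFree_b : ∀ φ, IsTestSlab T φ → ∑ i, ∫ z, b i z * spaceDeriv i φ z = 0
  divFree_u : ∀ φ, IsTestSlab T φ → ∑ j, ∫ z, u j z * spaceDeriv j φ z = 0

theorem IsTestSlab.fderiv_apply {T : ℝ} {φ : ℝ × E3 → ℝ} (hφ : IsTestSlab T φ) (v : ℝ × E3) :
    IsTestSlab T fun z => fderiv ℝ φ z v :=
  ⟨(hφ.1.fderiv_right (by simp)).clm_apply contDiff_const, hφ.2.1.fderiv_apply ℝ v,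
    (tsupport_fderiv_apply_subset ℝ v).trans hφ.2.2⟩

theorem IsTestSlab.spaceDeriv {T : ℝ} {φ : ℝ × E3 → ℝ} (hφ : IsTestSlab T φ) (i : Fin 3) :
    IsTestSlab T (spaceDeriv i φ) := hφ.fderiv_apply _

theorem IsTestSlab.timeDeriv {T : ℝ} {φ : ℝ × E3 → ℝ} (hφ : IsTestSlab T φ) :
    IsTestSlab T (timeDeriv φ) := hφ.fderiv_apply _

theorem locallyIntegrable_of_memLp_weight {a : ℝ} {r : ℝ≥0∞} (hr : 1 ≤ r) {f : ℝ × E3 → ℝ}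
    (hf : MemLp (fun z => smoothWeight a z.2 * f z) r volume) : LocallyIntegrable f := by
  have h := (hf.locallyIntegrable hr).continuous_mul (g := fun z : ℝ × E3 => smoothWeight (-a) z.2)
    ((continuous_smoothWeight _).comp continuous_snd)
  refine h.congr (Eventually.of_forall fun z => ?_)
  simp only [← mul_assoc, smoothWeight_neg_mul_self, one_mul]

theorem integrable_mul_test {f : ℝ × E3 → ℝ} (hf : LocallyIntegrable f) {T : ℝ}
    {φ : ℝ × E3 → ℝ} (hφ : IsTestSlab T φ) : Integrable fun z => f z * φ z :=
  (hf.integrable_smul_right_of_hasCompactSupport hφ.1.continuous hφ.2.1)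

theorem integrable_mul_test_of_integrableOn {T : ℝ} {p φ : ℝ × E3 → ℝ}
    (hp : ∀ K, IsCompact K → K ⊆ slab T → IntegrableOn p K) (hφ : IsTestSlab T φ) :
    Integrable fun z => p z * φ z := by
  have h := (hp _ hφ.2.1 hφ.2.2).mul_continuousOn hφ.1.continuous.continuousOn hφ.2.1
  refine (integrableOn_iff_integrable_of_support_subset fun z hz => ?_).1 h
  exact subset_tsupport _ (right_ne_zero_of_mul hz)

theorem locallyIntegrable_mul_of_memLp_weight {a : ℝ} {f g : ℝ × E3 → ℝ}
    (hf : MemLp (fun z => smoothWeight a z.2 * f z) 3 volume)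
    (hg : MemLp (fun z => smoothWeight a z.2 * g z) 2 volume) :
    LocallyIntegrable fun z => f z * g z := by
  have h : MemLp (fun z => smoothWeight (a + a) z.2 * (f z * g z)) (6 / 5) volume := by
    have h1 : MemLp (fun z => (smoothWeight a z.2 * f z) * (smoothWeight a z.2 * g z)) (6 / 5)
        volume := hg.mul' hf
    convert h1 using 2 with z
    rw [smoothWeight_add]
    ring
  exact locallyIntegrable_of_memLp_weight (by rw [ENNReal.le_div_iff_mul_le] <;> norm_num) h

theorem setIntegral_slab_eq {T : ℝ} {f g : ℝ × E3 → ℝ} (h1 : ∀ z ∈ slab T, f z = g z)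
    (h2 : ∀ z ∉ slab T, g z = 0) : ∫ z in slab T, f z = ∫ z, g z :=
  (setIntegral_congr_fun (measurableSet_slab T) h1).trans
    (setIntegral_eq_integral_of_forall_compl_eq_zero h2)

theorem isRieszSum_zero : IsRieszSum (fun _ _ _ => 0) fun _ => 0 :=
  ⟨locallyIntegrable_zero, fun ψ _ => ⟨fun _ _ => by simp, by simp⟩⟩

theorem IsSolution.exists_isWeightedSolution {γ T : ℝ} (hγ : 0 < γ) {u₀ : E3 → E3}
    {F : ℝ → E3 → Fin 3 → Fin 3 → ℝ} {b u : ℝ → E3 → E3} {p : ℝ → E3 → ℝ}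
    (hF : ∀ i j, MemLqLr T 2 2 (weightedVolume γ) (fun t x => F t x i j))
    (hb : MemLqLr T 3 3 (weightedVolume (3 * γ / 2)) b) (hbdiv : DivFreeSlab T b)
    (hbloc : MemLocL2LInfty T b) (h : IsSolution γ T u₀ F b u p) :
    ∃ G, IsWeightedSolution γ T (fun i => cut T fun z => b z.1 z.2 i)
      (fun i j => cut T fun z => F z.1 z.2 i j) (fun j => cut T fun z => u z.1 z.2 j) G
      (cut T fun z => p z.1 z.2) := by
  obtain ⟨G, hG, hGw, hm⟩ := h.equation
  have hcoord : ∀ {v : ℝ → E3 → E3}, AEStronglyMeasurable (Function.uncurry v)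
      (volume.restrict (slab T)) → ∀ j, AEStronglyMeasurable (fun z : ℝ × E3 => v z.1 z.2 j)
      (volume.restrict (slab T)) := fun hv j =>
    (show Continuous fun x : E3 => x j by fun_prop).comp_aestronglyMeasurable hv
  have hle : ∀ (v : ℝ → E3 → E3) (j : Fin 3) (z : ℝ × E3), ‖v z.1 z.2 j‖ ≤ ‖v z.1 z.2‖ :=
    fun v j z => PiLp.norm_apply_le (v z.1 z.2) j
  have hu2 : ∀ j, MemLp (fun z => smoothWeight (γ / 2) z.2 * cut T (fun z => u z.1 z.2 j) z) 2
      volume := fun j => by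
    simpa using memLp_cut_of_memLqLr (r := 2) (by norm_num) (by norm_num) hγ.le h.memLInftyL2.of_top
      (hcoord h.memLInftyL2.1 j) (hle u j)
  have hG2 : ∀ i j, MemLp (fun z => smoothWeight (γ / 2) z.2 * cut T (fun z => G z.1 z.2 i j) z) 2
      volume := fun i j => by
    simpa using memLp_cut_of_memLqLr (r := 2) (by norm_num) (by norm_num) hγ.le (hG i j)
      (f := fun z => G z.1 z.2 i j) (hG i j).1 fun _ => le_rfl
  have hF2 : ∀ i j, MemLp (fun z => smoothWeight (γ / 2) z.2 * cut T (fun z => F z.1 z.2 i j) z) 2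
      volume := fun i j => by
    simpa using memLp_cut_of_memLqLr (r := 2) (by norm_num) (by norm_num) hγ.le (hF i j)
      (f := fun z => F z.1 z.2 i j) (hF i j).1 fun _ => le_rfl
  have hb3 : ∀ i, MemLp (fun z => smoothWeight (γ / 2) z.2 * cut T (fun z => b z.1 z.2 i) z) 3
      volume := fun i => by
    have := memLp_cut_of_memLqLr (r := 3) (by norm_num) (by norm_num) (by positivity) hb
      (hcoord hb.1 i) (hle b i)
    rw [ENNReal.toReal_ofNat, show 3 * γ / 2 / 3 = γ / 2 by ring] at this
    exact this
  obtain ⟨M, hMt, hM⟩ := exists_bound_of_memLqLr_top hγ.le h.memLInftyL2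
  have hpK : ∀ K, IsCompact K → K ⊆ slab T → IntegrableOn (cut T fun z => p z.1 z.2) K :=
    fun K hK hKT => (h.pressure_locallyIntegrable.integrableOn_compact_subset hKT hK).congr_fun
      (fun z hz => (cut_of_mem (hKT hz)).symm) hK.measurableSet
  have hgrad : ∀ i j φ, IsTestSlab T φ → ∫ z, cut T (fun z => u z.1 z.2 j) z * spaceDeriv i φ z =
      -∫ z, cut T (fun z => G z.1 z.2 i j) z * φ z := fun i j φ hφ => by
    have := hGw i j φ hφ
    rwa [setIntegral_slab_eq (g := fun z => cut T (fun z => u z.1 z.2 j) z * spaceDeriv i φ z)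
      (fun z hz => by rw [cut_of_mem hz]) (fun z hz => by rw [cut_of_notMem hz, zero_mul]),
      setIntegral_slab_eq (g := fun z => cut T (fun z => G z.1 z.2 i j) z * φ z)
      (fun z hz => by rw [cut_of_mem hz]) (fun z hz => by rw [cut_of_notMem hz, zero_mul])] at this
  have hdiv : ∀ {v : ℝ → E3 → E3}, DivFreeSlab T v →
      (∀ i, LocallyIntegrable (cut T fun z => v z.1 z.2 i)) → ∀ φ, IsTestSlab T φ →
      ∑ i, ∫ z, cut T (fun z => v z.1 z.2 i) z * spaceDeriv i φ z = 0 := fun hv hvi φ hφ => by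
    rw [← hv φ hφ]
    refine (integral_finsetSum _ fun i _ =>
      integrable_mul_test (hvi i) (hφ.spaceDeriv i)).symm.trans ?_
    exact (setIntegral_slab_eq (fun z hz => by simp only [cut_of_mem hz])
      (fun z hz => by simp only [cut_of_notMem hz, zero_mul, Finset.sum_const_zero])).symm
  have hul := fun j => locallyIntegrable_of_memLp_weight (by norm_num) (hu2 j)
  have hFl := fun i j => locallyIntegrable_of_memLp_weight (by norm_num) (hF2 i j)
  refine ⟨fun i j => cut T fun z => G z.1 z.2 i j, hu2, ⟨M, hMt, fun j => hM _ (hle u j)⟩, hG2, hb3,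
    fun K hK hKT => ?_, ?_, hpK, ?_, hgrad, fun j φ hφ => ?_, ?_, ?_⟩
  · obtain ⟨β, h1, h2, h3⟩ := exists_bound_of_memLocL2LInfty hbloc hK hKT
    refine ⟨β, h1, h2, fun i => h3.mono fun z hz => le_trans ?_ hz⟩
    by_cases hzK : z ∈ K
    · rw [indicator_of_mem hzK, indicator_of_mem hzK, cut_of_mem (hKT hzK), ← ofReal_norm,
        ← ofReal_norm]
      exact ENNReal.ofReal_le_ofReal (hle b i z)
    · simp [hzK]
  · exact aestronglyMeasurable_cut h.pressure_locallyIntegrable.aestronglyMeasurable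
  · have h1 := (ae_restrict_iff' measurableSet_Ioo).1 h.pressure_formula
    filter_upwards [h1] with t ht
    by_cases htT : t ∈ Ioo 0 T
    · simp only [cut_slice_of_mem htT]
      exact ht htT
    · simp only [cut_slice_of_notMem htT, mul_zero, sub_zero]
      exact isRieszSum_zero
  · have h1 := hm j φ hφ
    have i1 : ∀ i, Integrable fun z => cut T (fun z => u z.1 z.2 j) z *
        spaceDeriv i (spaceDeriv i φ) z := fun i =>
      integrable_mul_test (hul j) ((hφ.spaceDeriv i).spaceDeriv i)
    have i2 : ∀ i, Integrable fun z => cut T (fun z => b z.1 z.2 i) z *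
        cut T (fun z => G z.1 z.2 i j) z * φ z := fun i =>
      integrable_mul_test (locallyIntegrable_mul_of_memLp_weight (hb3 i) (hG2 i j)) hφ
    have i3 : Integrable fun z => cut T (fun z => p z.1 z.2) z * spaceDeriv j φ z :=
      integrable_mul_test_of_integrableOn hpK (hφ.spaceDeriv j)
    have i4 : ∀ i, Integrable fun z => cut T (fun z => F z.1 z.2 i j) z * spaceDeriv i φ z :=
      fun i => integrable_mul_test (hFl i j) (hφ.spaceDeriv i)
    have i1' := integrable_finsetSum Finset.univ fun i _ => i1 i
    have i2' := integrable_finsetSum Finset.univ fun i _ => i2 i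
    have i4' := integrable_finsetSum Finset.univ fun i _ => i4 i
    rw [setIntegral_slab_eq (g := fun z => cut T (fun z => u z.1 z.2 j) z * timeDeriv φ z)
      (fun z hz => by rw [cut_of_mem hz]) (fun z hz => by rw [cut_of_notMem hz, zero_mul]),
      setIntegral_slab_eq (g := fun z =>
        ∑ i, cut T (fun z => u z.1 z.2 j) z * spaceDeriv i (spaceDeriv i φ) z
          - ∑ i, cut T (fun z => b z.1 z.2 i) z * cut T (fun z => G z.1 z.2 i j) z * φ z
          + cut T (fun z => p z.1 z.2) z * spaceDeriv j φ z
          - ∑ i, cut T (fun z => F z.1 z.2 i j) z * spaceDeriv i φ z)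
      (fun z hz => by simp only [cut_of_mem hz, spaceLaplacian, Finset.mul_sum, Finset.sum_mul])
      (fun z hz => by simp [cut_of_notMem hz]),
      integral_sub_add_sub i1' i2' i3 i4', integral_finsetSum _ fun i _ => i1 i,
      integral_finsetSum _ fun i _ => i4 i] at h1
    rw [h1]
    simp only [Finset.sum_mul]
    have hlap : ∀ i, ∫ z, cut T (fun z => u z.1 z.2 j) z * spaceDeriv i (spaceDeriv i φ) z =
        -∫ z, cut T (fun z => G z.1 z.2 i j) z * spaceDeriv i φ z := fun i =>
      hgrad i j _ (hφ.spaceDeriv i)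
    rw [Finset.sum_congr rfl fun i _ => hlap i, Finset.sum_neg_distrib]
  · exact hdiv hbdiv fun i => locallyIntegrable_of_memLp_weight (by norm_num) (hb3 i)
  · exact hdiv h.divFree hul

end AdvDiff

namespace AdvDiff

theorem IsRieszSum.sub {f g : Fin 3 → Fin 3 → E3 → ℝ} {p q : E3 → ℝ} (hf : IsRieszSum f p)
    (hg : IsRieszSum g q) :
    IsRieszSum (fun i j x => f i j x - g i j x) fun x => p x - q x := by
  refine ⟨hf.1.sub hg.1, fun ψ hψ => ⟨fun i j => ?_, ?_⟩⟩
  · simp only [sub_mul]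
    exact ((hf.2 ψ hψ).1 i j).sub ((hg.2 ψ hψ).1 i j)
  · have h1 : Integrable fun x => p x * ψ x :=
      hf.1.integrable_smul_right_of_hasCompactSupport hψ.1.continuous hψ.2
    have h2 : Integrable fun x => q x * ψ x :=
      hg.1.integrable_smul_right_of_hasCompactSupport hψ.1.continuous hψ.2
    simp only [sub_mul]
    rw [integral_sub h1 h2, (hf.2 ψ hψ).2, (hg.2 ψ hψ).2, ← Finset.sum_sub_distrib]
    refine Finset.sum_congr rfl fun i _ => ?_
    rw [← Finset.sum_sub_distrib]
    exact Finset.sum_congr rfl fun j _ => (integral_sub ((hf.2 ψ hψ).1 i j) ((hg.2 ψ hψ).1 i j)).symm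

namespace IsWeightedSolution

variable {γ T : ℝ} {b : Fin 3 → ℝ × E3 → ℝ} {F : Fin 3 → Fin 3 → ℝ × E3 → ℝ}
  {u u' : Fin 3 → ℝ × E3 → ℝ} {G G' : Fin 3 → Fin 3 → ℝ × E3 → ℝ} {p p' : ℝ × E3 → ℝ}

section

variable (h : IsWeightedSolution γ T b F u G p)

include h

theorem locallyIntegrable_u (j : Fin 3) : LocallyIntegrable (u j) :=
  locallyIntegrable_of_memLp_weight (by norm_num) (h.memLp_u j)

theorem locallyIntegrable_G (i j : Fin 3) : LocallyIntegrable (G i j) :=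
  locallyIntegrable_of_memLp_weight (by norm_num) (h.memLp_G i j)

theorem locallyIntegrable_b (i : Fin 3) : LocallyIntegrable (b i) :=
  locallyIntegrable_of_memLp_weight (by norm_num) (h.memLp_b i)

theorem integral_drift {φ : ℝ × E3 → ℝ} (hφ : IsTestSlab T φ) (j : Fin 3) :
    Integrable fun z => (∑ i, b i z * G i j z) * φ z := by
  simp only [Finset.sum_mul]
  exact integrable_finsetSum _ fun i _ => integrable_mul_test
    (locallyIntegrable_mul_of_memLp_weight (h.memLp_b i) (h.memLp_G i j)) hφ

end

/-- The difference of two solutions solves the problem without forcing. -/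
theorem sub (h : IsWeightedSolution γ T b F u G p) (h' : IsWeightedSolution γ T b F u' G' p') :
    IsWeightedSolution γ T b (fun _ _ _ => 0) (fun j z => u j z - u' j z)
      (fun i j z => G i j z - G' i j z) fun z => p z - p' z := by
  obtain ⟨M, hMt, hM⟩ := h.bounded_u
  obtain ⟨M', hMt', hM'⟩ := h'.bounded_u
  have hs : ∀ {f g φ : ℝ × E3 → ℝ}, LocallyIntegrable f → LocallyIntegrable g → IsTestSlab T φ →
      ∫ z, (f z - g z) * φ z = (∫ z, f z * φ z) - ∫ z, g z * φ z := fun hf hg hφ => by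
    simp only [sub_mul]
    exact integral_sub (integrable_mul_test hf hφ) (integrable_mul_test hg hφ)
  have hu := h.locallyIntegrable_u
  have hu' := h'.locallyIntegrable_u
  have hG := h.locallyIntegrable_G
  have hG' := h'.locallyIntegrable_G
  refine ⟨fun j => ?_, ⟨2 * (M + M'), ENNReal.mul_ne_top (by norm_num)
    (ENNReal.add_ne_top.2 ⟨hMt, hMt'⟩), fun j => ?_⟩, fun i j => ?_, h.memLp_b,
    h.bounded_b, h.measurable_p.sub h'.measurable_p, fun K hK hKT =>
    (h.integrable_p K hK hKT).sub (h'.integrable_p K hK hKT), ?_, fun i j φ hφ => ?_,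
    fun j φ hφ => ?_, h.divFree_b, fun φ hφ => ?_⟩
  · simp only [mul_sub]
    exact (h.memLp_u j).sub (h'.memLp_u j)
  · have hm := (h.memLp_u j).1
    rw [Measure.volume_eq_prod] at hm
    filter_upwards [hM j, hM' j, hm.prodMk_left] with t h1 h2 h3
    simp only [mul_sub]
    exact lintegral_slice_sub_sq_le (f := fun z => smoothWeight (γ / 2) z.2 * u j z)
      (g := fun z => smoothWeight (γ / 2) z.2 * u' j z) h3 h1 h2
  · simp only [mul_sub]
    exact (h.memLp_G i j).sub (h'.memLp_G i j)
  · filter_upwards [h.riesz, h'.riesz] with t h1 h2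
    convert h1.sub h2 using 4
    ring
  · rw [hs (hu j) (hu' j) (hφ.spaceDeriv i), hs (hG i j) (hG' i j) hφ]
    rw [h.gradient i j φ hφ, h'.gradient i j φ hφ]
    ring
  · have h1 := h.momentum j φ hφ
    have h2 := h'.momentum j φ hφ
    have e1 := hs (hu j) (hu' j) (hφ.timeDeriv)
    have e2 := fun i => hs (hG i j) (hG' i j) (hφ.spaceDeriv i)
    have e3 : ∫ z, (p z - p' z) * spaceDeriv j φ z =
        (∫ z, p z * spaceDeriv j φ z) - ∫ z, p' z * spaceDeriv j φ z := by
      simp only [sub_mul]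
      exact integral_sub
        (integrable_mul_test_of_integrableOn h.integrable_p (hφ.spaceDeriv j))
        (integrable_mul_test_of_integrableOn h'.integrable_p (hφ.spaceDeriv j))
    have e4 : ∫ z, (∑ i, b i z * (G i j z - G' i j z)) * φ z =
        (∫ z, (∑ i, b i z * G i j z) * φ z) - ∫ z, (∑ i, b i z * G' i j z) * φ z := by
      simp only [mul_sub, Finset.sum_sub_distrib, sub_mul]
      exact integral_sub (h.integral_drift hφ j) (h'.integral_drift hφ j)
    rw [e1, e3, e4]
    simp only [e2, Finset.sum_sub_distrib, zero_mul, integral_zero, Finset.sum_const_zero]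
    linarith
  · have h1 := h.divFree_u φ hφ
    have h2 := h'.divFree_u φ hφ
    have e : ∀ j, ∫ z, (u j z - u' j z) * spaceDeriv j φ z =
        (∫ z, u j z * spaceDeriv j φ z) - ∫ z, u' j z * spaceDeriv j φ z := fun j =>
      hs (hu j) (hu' j) (hφ.spaceDeriv j)
    simp only [e, Finset.sum_sub_distrib, h1, h2, sub_zero]

end IsWeightedSolution

end AdvDiff

namespace AdvDiff

theorem lipschitzWith_bracket : LipschitzWith 1 bracket := by
  refine LipschitzWith.of_le_add fun x y => ?_
  rw [dist_eq_norm]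
  exact bracket_le_add x y

theorem smoothWeight_anti {a c : ℝ} (h : a ≤ c) (x : E3) : smoothWeight c x ≤ smoothWeight a x :=
  Real.rpow_le_rpow_of_exponent_le (one_le_bracket x) (neg_le_neg h)

theorem norm_fderiv_smoothWeight_le (a : ℝ) (x v : E3) :
    ‖fderiv ℝ (smoothWeight a) x v‖ ≤ |a| * smoothWeight (a + 1) x * ‖v‖ := by
  have hd : HasFDerivAt bracket (fderiv ℝ bracket x) x :=
    (contDiff_bracket.differentiable (by simp) x).hasFDerivAt
  have h1 := hd.rpow_const (p := -a) (Or.inl (bracket_pos x).ne')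
  have h2 : ‖fderiv ℝ bracket x‖ ≤ 1 := by
    simpa using norm_fderiv_le_of_lipschitz ℝ lipschitzWith_bracket (x₀ := x)
  have h3 : ‖fderiv ℝ bracket x v‖ ≤ ‖v‖ := by
    simpa using (fderiv ℝ bracket x).le_of_opNorm_le h2 v
  change ‖fderiv ℝ (fun x => bracket x ^ (-a)) x v‖ ≤ _
  rw [h1.fderiv, _root_.smul_apply, smul_eq_mul, norm_mul, norm_mul, norm_neg, Real.norm_eq_abs,
    Real.norm_of_nonneg (Real.rpow_nonneg (bracket_pos x).le _), smoothWeight, neg_add']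
  exact mul_le_mul_of_nonneg_left h3
    (mul_nonneg (abs_nonneg _) (Real.rpow_nonneg (bracket_pos x).le _))

/-- The fixed bump from which the cutoffs are obtained by scaling. -/
noncomputable def baseBump : ContDiffBump (0 : E3) := ⟨1, 2, one_pos, one_lt_two⟩

/-- A cutoff equal to `1` on the ball of radius `n + 1` and to `0` off the ball of radius
`2 (n + 1)`. -/
noncomputable def spaceCutoff (n : ℕ) (x : E3) : ℝ := baseBump (((n : ℝ) + 1)⁻¹ • x)

theorem contDiff_spaceCutoff (n : ℕ) : ContDiff ℝ ∞ (spaceCutoff n) :=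
  baseBump.contDiff.comp (contDiff_const_smul _)

theorem spaceCutoff_nonneg (n : ℕ) (x : E3) : 0 ≤ spaceCutoff n x := baseBump.nonneg

theorem spaceCutoff_le_one (n : ℕ) (x : E3) : spaceCutoff n x ≤ 1 := baseBump.le_one

theorem norm_smul_inv_succ (n : ℕ) (x : E3) : ‖((n : ℝ) + 1)⁻¹ • x‖ = ‖x‖ / (n + 1) := by
  rw [norm_smul, norm_inv, Real.norm_of_nonneg (by positivity), div_eq_inv_mul]

theorem spaceCutoff_eq_one {n : ℕ} {x : E3} (hx : ‖x‖ ≤ n + 1) : spaceCutoff n x = 1 := by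
  refine baseBump.one_of_mem_closedBall ?_
  rw [mem_closedBall_zero_iff, norm_smul_inv_succ]
  exact (div_le_one (by positivity)).2 hx

theorem tendsto_spaceCutoff (x : E3) : Tendsto (fun n => spaceCutoff n x) atTop (𝓝 1) := by
  obtain ⟨N, hN⟩ := exists_nat_ge ‖x‖
  refine tendsto_const_nhds.congr' ?_
  filter_upwards [eventually_ge_atTop N] with n hn
  have : (N : ℝ) ≤ n := by exact_mod_cast hn
  exact (spaceCutoff_eq_one (by linarith)).symm

theorem tsupport_spaceCutoff_subset (n : ℕ) :
    tsupport (spaceCutoff n) ⊆ Metric.closedBall 0 (2 * (n + 1)) := by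
  refine closure_minimal (fun x hx => ?_) Metric.isClosed_closedBall
  by_contra h
  rw [mem_closedBall_zero_iff, not_le] at h
  refine hx (baseBump.zero_of_le_dist ?_)
  rw [dist_zero_right, norm_smul_inv_succ]
  exact (le_div_iff₀ (by positivity)).2 h.le

theorem hasCompactSupport_spaceCutoff (n : ℕ) : HasCompactSupport (spaceCutoff n) :=
  (isCompact_closedBall 0 _).of_isClosed_subset (isClosed_tsupport _) (tsupport_spaceCutoff_subset n)

theorem exists_norm_fderiv_spaceCutoff_le :
    ∃ C : ℝ, 0 ≤ C ∧ ∀ n x v, ‖fderiv ℝ (spaceCutoff n) x v‖ ≤ C * smoothWeight 1 x * ‖v‖ := by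
  have hB : ContDiff ℝ ∞ (baseBump : E3 → ℝ) := baseBump.contDiff
  obtain ⟨C, hC⟩ := (baseBump.hasCompactSupport.fderiv ℝ).exists_bound_of_continuous
    (hB.continuous_fderiv (by simp))
  have hC0 : 0 ≤ C := (norm_nonneg _).trans (hC 0)
  refine ⟨3 * C, by positivity, fun n x v => ?_⟩
  have hw := smoothWeight_pos 1 x
  by_cases hx : x ∈ tsupport (spaceCutoff n)
  · have h1 := mem_closedBall_zero_iff.1 (tsupport_spaceCutoff_subset n hx)
    have hn : (0 : ℝ) < n + 1 := by positivity
    have hn1 : (1 : ℝ) ≤ n + 1 := by linarith [(Nat.cast_nonneg n : (0 : ℝ) ≤ n)]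
    have h2 : ((n : ℝ) + 1)⁻¹ ≤ 3 * smoothWeight 1 x := by
      rw [smoothWeight, Real.rpow_neg_one, ← div_eq_mul_inv, inv_le_comm₀ hn
        (div_pos three_pos (bracket_pos x)), inv_div, div_le_iff₀ (by norm_num)]
      refine Real.sqrt_le_iff.2 ⟨by positivity, ?_⟩
      have : ‖x‖ ^ 2 ≤ (2 * ((n : ℝ) + 1)) ^ 2 := by gcongr
      nlinarith
    have h3 : fderiv ℝ (spaceCutoff n) x v =
        fderiv ℝ (baseBump : E3 → ℝ) (((n : ℝ) + 1)⁻¹ • x) (((n : ℝ) + 1)⁻¹ • v) := by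
      have := (hB.differentiable (by simp) (((n : ℝ) + 1)⁻¹ • x)).hasFDerivAt.comp x
        ((hasFDerivAt_id (𝕜 := ℝ) x).const_smul ((n : ℝ) + 1)⁻¹)
      change fderiv ℝ ((baseBump : E3 → ℝ) ∘ fun x => ((n : ℝ) + 1)⁻¹ • x) x v = _
      exact congrArg (· v) this.fderiv
    rw [h3, map_smul, norm_smul, norm_inv, Real.norm_of_nonneg hn.le]
    calc _ ≤ 3 * smoothWeight 1 x * (C * ‖v‖) :=
          mul_le_mul h2 ((fderiv ℝ (baseBump : E3 → ℝ) _).le_of_opNorm_le (hC _) v)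
            (norm_nonneg _) (by positivity)
      _ = _ := by ring
  · have : fderiv ℝ (spaceCutoff n) x = 0 := image_eq_zero_of_notMem_tsupport fun h =>
      hx (tsupport_fderiv_subset ℝ h)
    rw [this]
    simp only [_root_.zero_apply, norm_zero]
    positivity

/-- The weight multiplied by a cutoff. -/
noncomputable def cutWeight (a : ℝ) (n : ℕ) (x : E3) : ℝ := smoothWeight a x * spaceCutoff n x

theorem contDiff_cutWeight (a : ℝ) (n : ℕ) : ContDiff ℝ ∞ (cutWeight a n) :=
  (contDiff_smoothWeight a).mul (contDiff_spaceCutoff n)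

theorem hasCompactSupport_cutWeight (a : ℝ) (n : ℕ) : HasCompactSupport (cutWeight a n) :=
  (hasCompactSupport_spaceCutoff n).mul_left

theorem cutWeight_nonneg (a : ℝ) (n : ℕ) (x : E3) : 0 ≤ cutWeight a n x :=
  mul_nonneg (smoothWeight_pos a x).le (spaceCutoff_nonneg n x)

theorem cutWeight_le (a : ℝ) (n : ℕ) (x : E3) : cutWeight a n x ≤ smoothWeight a x :=
  mul_le_of_le_one_right (smoothWeight_pos a x).le (spaceCutoff_le_one n x)

theorem tendsto_cutWeight (a : ℝ) (x : E3) :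
    Tendsto (fun n => cutWeight a n x) atTop (𝓝 (smoothWeight a x)) := by
  simpa [cutWeight] using (tendsto_spaceCutoff x).const_mul (smoothWeight a x)

theorem norm_basisVec (i : Fin 3) : ‖basisVec i‖ = 1 := by simp [basisVec]

theorem exists_norm_fderiv_cutWeight_le (a : ℝ) : ∃ C : ℝ, 0 ≤ C ∧ ∀ n x i,
    ‖fderiv ℝ (cutWeight a n) x (basisVec i)‖ ≤ C * smoothWeight (a + 1) x := by
  obtain ⟨C, hC0, hC⟩ := exists_norm_fderiv_spaceCutoff_le
  refine ⟨C + |a|, by positivity, fun n x i => ?_⟩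
  have h1 : fderiv ℝ (cutWeight a n) x (basisVec i) =
      smoothWeight a x * fderiv ℝ (spaceCutoff n) x (basisVec i) +
        spaceCutoff n x * fderiv ℝ (smoothWeight a) x (basisVec i) := by
    change fderiv ℝ (fun x => smoothWeight a x * spaceCutoff n x) x _ = _
    rw [fderiv_fun_mul ((contDiff_smoothWeight a).differentiable (by simp) x)
      ((contDiff_spaceCutoff n).differentiable (by simp) x)]
    rfl
  have h2 := hC n x (basisVec i)
  have h3 := norm_fderiv_smoothWeight_le a x (basisVec i)
  rw [norm_basisVec, mul_one] at h2 h3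
  rw [h1]
  refine (norm_add_le _ _).trans ?_
  rw [norm_mul, norm_mul, Real.norm_of_nonneg (smoothWeight_pos a x).le,
    Real.norm_of_nonneg (spaceCutoff_nonneg n x), add_mul]
  refine add_le_add ?_ ?_
  · rw [smoothWeight_add]
    calc _ ≤ smoothWeight a x * (C * smoothWeight 1 x) :=
          mul_le_mul_of_nonneg_left h2 (smoothWeight_pos a x).le
      _ = _ := by ring
  · exact (mul_le_of_le_one_left (norm_nonneg _) (spaceCutoff_le_one n x)).trans h3

theorem fderiv_time_mul_space {θ : ℝ → ℝ} {a : E3 → ℝ} (hθ : ContDiff ℝ ∞ θ) (ha : ContDiff ℝ ∞ a)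
    (z v : ℝ × E3) :
    fderiv ℝ (fun z : ℝ × E3 => θ z.1 * a z.2) z v =
      θ z.1 * fderiv ℝ a z.2 v.2 + deriv θ z.1 * v.1 * a z.2 := by
  have h1 := ((hθ.differentiable (by simp) z.1).hasDerivAt.hasFDerivAt).comp z
    (hasFDerivAt_fst (𝕜 := ℝ) (p := z))
  have h2 := ((ha.differentiable (by simp) z.2).hasFDerivAt).comp z
    (hasFDerivAt_snd (𝕜 := ℝ) (p := z))
  have h3 := h1.fun_mul h2
  simp only [Function.comp] at h3
  rw [h3.fderiv]
  simp
  ring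

theorem spaceDeriv_time_mul_space {θ : ℝ → ℝ} {a : E3 → ℝ} (hθ : ContDiff ℝ ∞ θ)
    (ha : ContDiff ℝ ∞ a) (i : Fin 3) (z : ℝ × E3) :
    spaceDeriv i (fun z : ℝ × E3 => θ z.1 * a z.2) z = θ z.1 * fderiv ℝ a z.2 (basisVec i) := by
  rw [spaceDeriv, fderiv_time_mul_space hθ ha]
  simp

theorem timeDeriv_time_mul_space {θ : ℝ → ℝ} {a : E3 → ℝ} (hθ : ContDiff ℝ ∞ θ)
    (ha : ContDiff ℝ ∞ a) (z : ℝ × E3) :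
    timeDeriv (fun z : ℝ × E3 => θ z.1 * a z.2) z = deriv θ z.1 * a z.2 := by
  rw [timeDeriv, fderiv_time_mul_space hθ ha]
  simp

theorem isTestSlab_time_mul_space {T : ℝ} {θ : ℝ → ℝ} {a : E3 → ℝ} (hθ : ContDiff ℝ ∞ θ)
    (hθc : HasCompactSupport θ) (hθT : tsupport θ ⊆ Ioo 0 T) (ha : ContDiff ℝ ∞ a)
    (hac : HasCompactSupport a) : IsTestSlab T fun z : ℝ × E3 => θ z.1 * a z.2 := by
  have hs : tsupport (fun z : ℝ × E3 => θ z.1 * a z.2) ⊆ tsupport θ ×ˢ tsupport a := by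
    refine closure_minimal (fun z hz => ⟨subset_tsupport _ (left_ne_zero_of_mul hz),
      subset_tsupport _ (right_ne_zero_of_mul hz)⟩) ((isClosed_tsupport _).prod (isClosed_tsupport _))
  refine ⟨(hθ.comp contDiff_fst).mul (ha.comp contDiff_snd), ?_, fun z hz => ⟨hθT (hs hz).1, trivial⟩⟩
  exact (hθc.isCompact.prod hac.isCompact).of_isClosed_subset (isClosed_tsupport _) hs

theorem exists_timeCutoff {T : ℝ} (hT : 0 < T) : ∃ θ : ℕ → ℝ → ℝ, (∀ n, ContDiff ℝ ∞ (θ n)) ∧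
    (∀ n, HasCompactSupport (θ n)) ∧ (∀ n, tsupport (θ n) ⊆ Ioo 0 T) ∧
    ∀ t ∈ Ioo 0 T, ∀ᶠ n in atTop, θ n t = 1 := by
  have hlt : ∀ n : ℕ, T / 2 * (1 - 1 / ((n : ℝ) + 2)) < T / 2 * (1 - 1 / ((n : ℝ) + 3)) := fun n => by
    gcongr
    linarith
  have hpos : ∀ n : ℕ, 0 < T / 2 * (1 - 1 / ((n : ℝ) + 2)) := fun n => by
    have : 1 / ((n : ℝ) + 2) < 1 := by
      rw [div_lt_one (by positivity)]
      linarith [(Nat.cast_nonneg n : (0 : ℝ) ≤ n)]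
    have : 0 < 1 - 1 / ((n : ℝ) + 2) := by linarith
    positivity
  let B : ∀ n : ℕ, ContDiffBump (T / 2) := fun n => ⟨_, _, hpos n, hlt n⟩
  refine ⟨fun n => B n, fun n => (B n).contDiff, fun n => (B n).hasCompactSupport, fun n => ?_,
    fun t ht => ?_⟩
  · rw [(B n).tsupport_eq, Real.closedBall_eq_Icc]
    have h1 : (B n).rOut < T / 2 := by
      have : (0 : ℝ) < 1 / ((n : ℝ) + 3) := by positivity
      change T / 2 * (1 - 1 / ((n : ℝ) + 3)) < T / 2
      nlinarith
    exact fun t ht => ⟨by linarith [ht.1], by linarith [ht.2]⟩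
  · have h1 : Tendsto (fun n : ℕ => T / 2 * (1 - 1 / ((n : ℝ) + 2))) atTop (𝓝 (T / 2 * (1 - 0))) := by
      refine (tendsto_const_nhds.sub ?_).const_mul _
      have := tendsto_one_div_add_atTop_nhds_zero_nat (𝕜 := ℝ)
      refine ((tendsto_add_atTop_iff_nat 1).2 this).congr fun n => ?_
      push_cast
      ring_nf
    have h2 : |t - T / 2| < T / 2 * (1 - 0) := by
      rw [abs_lt]
      constructor <;> linarith [ht.1, ht.2]
    filter_upwards [h1.eventually (lt_mem_nhds h2)] with n hn
    exact (B n).one_of_mem_closedBall (by rw [Metric.mem_closedBall, Real.dist_eq]; exact hn.le)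

end AdvDiff

namespace AdvDiff

theorem norm_clm_le_sum (L : E3 →L[ℝ] ℝ) : ‖L‖ ≤ ∑ i, ‖L (basisVec i)‖ := by
  refine L.opNorm_le_bound (Finset.sum_nonneg fun _ _ => norm_nonneg _) fun x => ?_
  have hx : x = ∑ i, x i • basisVec i := by
    ext j
    fin_cases j <;> simp [basisVec, Fin.sum_univ_three]
  conv_lhs => rw [hx]
  rw [map_sum, Finset.sum_mul]
  refine (norm_sum_le _ _).trans (Finset.sum_le_sum fun i _ => ?_)
  rw [map_smul, norm_smul, mul_comm]
  exact mul_le_mul_of_nonneg_left (PiLp.norm_apply_le x i) (norm_nonneg _)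

/-- The Sobolev inequality in `ℝ³`. -/
theorem exists_eLpNorm_six_le : ∃ C : ℝ≥0∞, C ≠ ⊤ ∧ ∀ v : E3 → ℝ, ContDiff ℝ 1 v →
    HasCompactSupport v →
    eLpNorm v 6 volume ≤ C * ∑ i, eLpNorm (fun x => fderiv ℝ v x (basisVec i)) 2 volume := by
  refine ⟨eLpNormLESNormFDerivOfEqInnerConst (volume : Measure E3) (2 : NNReal),
    ENNReal.coe_ne_top, fun v hv hvc => ?_⟩
  have h := eLpNorm_le_eLpNorm_fderiv_of_eq_inner (volume : Measure E3) hv hvc (p := 2) (p' := 6)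
    (by norm_num) (by simp) (by simp; norm_num)
  simp only [ENNReal.coe_ofNat, NNReal.coe_ofNat] at h
  refine h.trans (mul_le_mul_right ?_ _)
  have hm : ∀ i, AEStronglyMeasurable (fun x => fderiv ℝ v x (basisVec i)) volume := fun i =>
    ((hv.continuous_fderiv one_ne_zero).clm_apply continuous_const).aestronglyMeasurable
  calc eLpNorm (fderiv ℝ v) 2 volume
      ≤ eLpNorm (∑ i, fun x => ‖fderiv ℝ v x (basisVec i)‖) 2 volume := by
        refine eLpNorm_mono fun x => ?_
        rw [Finset.sum_apply, Real.norm_of_nonneg (Finset.sum_nonneg fun _ _ => norm_nonneg _)]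
        exact norm_clm_le_sum _
    _ ≤ ∑ i, eLpNorm (fun x => ‖fderiv ℝ v x (basisVec i)‖) 2 volume :=
        eLpNorm_sum_le (fun i _ => (hm i).norm) (by norm_num)
    _ = _ := by simp only [eLpNorm_norm]

/-- An estimate of an `L⁶` norm by `L²` norms is stable under `L²` convergence. -/
theorem eLpNorm_six_le_of_tendsto {α : Type*} [MeasurableSpace α] {μ : Measure α} {C : ℝ≥0∞}
    (hC : C ≠ ⊤) {f : ℕ → α → ℝ} {f' : α → ℝ} {g : Fin 3 → ℕ → α → ℝ} {g' : Fin 3 → α → ℝ}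
    (hf : ∀ k, AEStronglyMeasurable (f k) μ) (hf' : AEStronglyMeasurable f' μ)
    (hg : ∀ i k, AEStronglyMeasurable (g i k) μ) (hg' : ∀ i, AEStronglyMeasurable (g' i) μ)
    (h : ∀ᶠ k in atTop, eLpNorm (f k) 6 μ ≤ C * ∑ i, eLpNorm (g i k) 2 μ)
    (hfl : Tendsto (fun k => eLpNorm (f k - f') 2 μ) atTop (𝓝 0))
    (hgl : ∀ i, Tendsto (fun k => eLpNorm (g i k - g' i) 2 μ) atTop (𝓝 0)) :
    eLpNorm f' 6 μ ≤ C * ∑ i, eLpNorm (g' i) 2 μ := by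
  obtain ⟨ns, hns, hae⟩ := (tendstoInMeasure_of_tendsto_eLpNorm (by norm_num) hf hf'
    hfl).exists_seq_tendsto_ae
  have hlim : Tendsto (fun k => C * ∑ i, (eLpNorm (g i (ns k) - g' i) 2 μ + eLpNorm (g' i) 2 μ)) atTop
      (𝓝 (C * ∑ i, (0 + eLpNorm (g' i) 2 μ))) :=
    ENNReal.Tendsto.const_mul (tendsto_finsetSum _ fun i _ =>
      ((hgl i).comp hns.tendsto_atTop).add tendsto_const_nhds) (Or.inr hC)
  simp only [zero_add] at hlim
  rw [← hlim.liminf_eq]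
  refine (Lp.eLpNorm_lim_le_liminf_eLpNorm (fun k => hf (ns k)) f' hae).trans ?_
  refine liminf_le_liminf ?_
  filter_upwards [hns.tendsto_atTop.eventually h] with k hk
  refine hk.trans ?_
  gcongr with i _
  calc eLpNorm (g i (ns k)) 2 μ = eLpNorm ((g i (ns k) - g' i) + g' i) 2 μ := by simp
    _ ≤ _ := eLpNorm_add_le ((hg _ _).sub (hg' _)) (hg' _) (by norm_num)

/-- Functions converging in `L²` of space-time have slices converging in `L²`, up to a
subsequence. -/
theorem exists_seq_slice_tendsto {ι : Type*} [Fintype ι] {f : ι → ℕ → ℝ × E3 → ℝ}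
    {f' : ι → ℝ × E3 → ℝ} (hf : ∀ i k, AEStronglyMeasurable (f i k))
    (hf' : ∀ i, AEStronglyMeasurable (f' i))
    (h : ∀ i, Tendsto (fun k => eLpNorm (f i k - f' i) 2 volume) atTop (𝓝 0)) :
    ∃ ns : ℕ → ℕ, StrictMono ns ∧ ∀ᵐ t, ∀ i, Tendsto (fun k =>
      eLpNorm ((fun x => f i (ns k) (t, x)) - fun x => f' i (t, x)) 2 volume) atTop (𝓝 0) := by
  set H : ℕ → ℝ → ℝ≥0∞ := fun k t => ∑ i, ∫⁻ x, ‖(f i k - f' i) (t, x)‖ₑ ^ (2 : ℝ) with hH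
  have hHi : ∀ i k, AEMeasurable fun t => ∫⁻ x, ‖(f i k - f' i) (t, x)‖ₑ ^ (2 : ℝ) := fun i k =>
    aemeasurable_lintegral_slice_sq ((hf i k).sub (hf' i))
  have hHm : ∀ k, AEMeasurable (H k) := fun k => Finset.aemeasurable_fun_sum _ fun i _ => hHi i k
  have hHl : Tendsto (fun k => ∫⁻ t, H k t) atTop (𝓝 0) := by
    have h1 : ∀ k, ∫⁻ t, H k t = ∑ i, eLpNorm (f i k - f' i) 2 volume ^ (2 : ℝ) := fun k => by
      rw [lintegral_finsetSum' _ fun i _ => hHi i k]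
      exact Finset.sum_congr rfl fun i _ => (eLpNorm_two_sq_eq_slab ((hf i k).sub (hf' i))).symm
    simp only [h1]
    have h2 := tendsto_finsetSum Finset.univ fun i _ =>
      ((ENNReal.continuous_rpow_const (y := 2)).tendsto 0).comp (h i)
    simpa [ENNReal.zero_rpow_of_pos] using h2
  obtain ⟨ns, hns, hb⟩ := extraction_forall_of_eventually' (P := fun n k =>
    ∫⁻ t, H k t ≤ (2⁻¹ : ℝ≥0∞) ^ n) fun n => by
      obtain ⟨N, hN⟩ := (ENNReal.tendsto_atTop_zero.1 hHl) ((2⁻¹ : ℝ≥0∞) ^ n)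
        (ENNReal.pow_pos (by simp) n)
      exact ⟨N, hN⟩
  refine ⟨ns, hns, ?_⟩
  have hsum : ∫⁻ t, ∑' k, H (ns k) t ≠ ⊤ := by
    rw [lintegral_tsum fun k => hHm (ns k)]
    refine (lt_of_le_of_lt (ENNReal.tsum_le_tsum hb) ?_).ne
    rw [ENNReal.tsum_geometric]
    simp
  filter_upwards [ae_lt_top' (AEMeasurable.tsum fun k => hHm (ns k)) hsum] with t ht i
  have h0 := ENNReal.tendsto_atTop_zero_of_tsum_ne_top ht.ne
  have h1 : Tendsto (fun k => ∫⁻ x, ‖(f i (ns k) - f' i) (t, x)‖ₑ ^ (2 : ℝ)) atTop (𝓝 0) :=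
    tendsto_of_tendsto_of_tendsto_of_le_of_le tendsto_const_nhds h0 (fun _ => zero_le) fun k =>
      Finset.single_le_sum (f := fun i => ∫⁻ x, ‖(f i (ns k) - f' i) (t, x)‖ₑ ^ (2 : ℝ))
        (fun _ _ => zero_le) (Finset.mem_univ i)
  have h2 := ((ENNReal.continuous_rpow_const (y := 1 / 2)).tendsto 0).comp h1
  rw [ENNReal.zero_rpow_of_pos (by norm_num)] at h2
  refine h2.congr fun k => ?_
  rw [eLpNorm_two_eq]
  rfl

end AdvDiff

namespace AdvDiff

theorem exists_norm_indicator_le (a : ℝ) {K : Set (ℝ × E3)} (hK : IsCompact K) :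
    ∃ C : ℝ, 0 ≤ C ∧ ∀ (f : ℝ × E3 → ℝ) z,
      ‖K.indicator f z‖ ≤ C * ‖smoothWeight a z.2 * f z‖ := by
  obtain ⟨C, hC⟩ := hK.exists_bound_of_continuousOn
    ((continuous_smoothWeight (-a)).comp continuous_snd).continuousOn
  refine ⟨|C|, abs_nonneg C, fun f z => ?_⟩
  by_cases hz : z ∈ K
  · rw [indicator_of_mem hz]
    calc ‖f z‖ = ‖smoothWeight (-a) z.2‖ * ‖smoothWeight a z.2 * f z‖ := by
          rw [← norm_mul, ← mul_assoc, smoothWeight_neg_mul_self, one_mul]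
      _ ≤ _ := mul_le_mul_of_nonneg_right ((hC z hz).trans (le_abs_self C)) (norm_nonneg _)
  · rw [indicator_of_notMem hz, norm_zero]
    positivity

theorem memLp_indicator_of_weight {a : ℝ} {r : ℝ≥0∞} (hr : 1 ≤ r) {f : ℝ × E3 → ℝ}
    (hf : MemLp (fun z => smoothWeight a z.2 * f z) r volume) {K : Set (ℝ × E3)}
    (hK : IsCompact K) : MemLp (K.indicator f) r volume := by
  obtain ⟨C, -, hC⟩ := exists_norm_indicator_le a hK
  exact hf.of_le_mul ((locallyIntegrable_of_memLp_weight hr hf).aestronglyMeasurable.indicator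
    hK.measurableSet) (Eventually.of_forall (hC f))

theorem indicator_mul_of_tsupport_subset {K : Set (ℝ × E3)} {ψ : ℝ × E3 → ℝ}
    (h : tsupport ψ ⊆ K) (f : ℝ × E3 → ℝ) (z : ℝ × E3) : K.indicator f z * ψ z = f z * ψ z := by
  by_cases hz : z ∈ K
  · rw [indicator_of_mem hz]
  · rw [image_eq_zero_of_notMem_tsupport fun h' => hz (h h'), mul_zero, mul_zero]

theorem tsupport_spaceDeriv_subset (i : Fin 3) (ψ : ℝ × E3 → ℝ) :
    tsupport (spaceDeriv i ψ) ⊆ tsupport ψ := tsupport_fderiv_apply_subset ℝ _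

theorem tsupport_timeDeriv_subset (ψ : ℝ × E3 → ℝ) :
    tsupport (timeDeriv ψ) ⊆ tsupport ψ := tsupport_fderiv_apply_subset ℝ _

theorem hasCompactSupport_slice {f : ℝ × E3 → ℝ} (hf : HasCompactSupport f) (t : ℝ) :
    HasCompactSupport fun x => f (t, x) :=
  HasCompactSupport.of_support_subset_isCompact (hf.isCompact.image continuous_snd) fun x hx =>
    ⟨(t, x), subset_tsupport _ hx, rfl⟩

theorem fderiv_slice {f : ℝ × E3 → ℝ} (hf : ContDiff ℝ ∞ f) (t : ℝ) (x v : E3) :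
    fderiv ℝ (fun x => f (t, x)) x v = fderiv ℝ f (t, x) (0, v) := by
  have h := ((hf.differentiable (by simp) (t, x)).hasFDerivAt).comp x (hasFDerivAt_prodMk_right t x)
  have h' := congrArg (· v) h.fderiv
  change fderiv ℝ (f ∘ Prod.mk t) x v = _
  simpa using h'

/-- The Sobolev inequality on time slices, for a localized solution. -/
theorem exists_eLpNorm_six_mul_le : ∃ C : ℝ≥0∞, C ≠ ⊤ ∧ ∀ {γ T : ℝ} {b : Fin 3 → ℝ × E3 → ℝ}
    {F : Fin 3 → Fin 3 → ℝ × E3 → ℝ} {u : Fin 3 → ℝ × E3 → ℝ} {G : Fin 3 → Fin 3 → ℝ × E3 → ℝ}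
    {p : ℝ × E3 → ℝ}, IsWeightedSolution γ T b F u G p → ∀ φ, IsTestSlab T φ → ∀ j, ∀ᵐ t,
      eLpNorm (fun x => φ (t, x) * u j (t, x)) 6 volume ≤
        C * ∑ i, eLpNorm (fun x => spaceDeriv i φ (t, x) * u j (t, x) + φ (t, x) * G i j (t, x)) 2
          volume := by
  obtain ⟨C, hCt, hS⟩ := exists_eLpNorm_six_le
  refine ⟨C, hCt, fun {γ T b F u G p} h φ hφ j => ?_⟩
  obtain ⟨ε, hε, hεT⟩ := hφ.2.1.isCompact.exists_cthickening_subset_open (isOpen_slab T) hφ.2.2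
  set K := Metric.cthickening ε (tsupport φ) with hKdef
  have hK : IsCompact K := hφ.2.1.isCompact.cthickening
  have hφK : tsupport φ ⊆ K := Metric.self_subset_cthickening _
  have hU := memLp_indicator_of_weight (by norm_num) (h.memLp_u j) hK
  have hG := fun i => memLp_indicator_of_weight (by norm_num) (h.memLp_G i j) hK
  have hUl : LocallyIntegrable (K.indicator (u j)) := hU.locallyIntegrable (by norm_num)
  obtain ⟨A, hA⟩ := hφ.2.1.exists_bound_of_continuous hφ.1.continuous
  have hφm := hφ.1.continuous.aestronglyMeasurable (μ := (volume : Measure (ℝ × E3)))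
  have hsm := fun i => (hφ.spaceDeriv i).1.continuous.aestronglyMeasurable
    (μ := (volume : Measure (ℝ × E3)))
  choose B hB using fun i => (hφ.spaceDeriv i).2.1.exists_bound_of_continuous
    (hφ.spaceDeriv i).1.continuous
  let f : Option (Fin 3) → ℕ → ℝ × E3 → ℝ := fun o k => o.elim
    (fun z => φ z * moll k (K.indicator (u j)) z) fun i z =>
      spaceDeriv i φ z * moll k (K.indicator (u j)) z + φ z * moll k (K.indicator (G i j)) z
  let f' : Option (Fin 3) → ℝ × E3 → ℝ := fun o => o.elim (fun z => φ z * K.indicator (u j) z)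
    fun i z => spaceDeriv i φ z * K.indicator (u j) z + φ z * K.indicator (G i j) z
  have hf : ∀ o k, AEStronglyMeasurable (f o k) := by
    rintro (_ | i) k
    · exact (memLp_two_bdd_mul hφm hA (memLp_moll k hU)).1
    · exact ((memLp_two_bdd_mul (hsm i) (hB i) (memLp_moll k hU)).add
        (memLp_two_bdd_mul hφm hA (memLp_moll k (hG i)))).1
  have hf' : ∀ o, AEStronglyMeasurable (f' o) := by
    rintro (_ | i)
    · exact (memLp_two_bdd_mul hφm hA hU).1
    · exact ((memLp_two_bdd_mul (hsm i) (hB i) hU).add (memLp_two_bdd_mul hφm hA (hG i))).1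
  have hlim : ∀ o, Tendsto (fun k => eLpNorm (f o k - f' o) 2 volume) atTop (𝓝 0) := by
    rintro (_ | i)
    · exact tendsto_eLpNorm_bdd_mul hA (tendsto_eLpNorm_moll_sub hU)
    · exact tendsto_eLpNorm_add_sub_add
        (fun k => memLp_two_bdd_mul (hsm i) (hB i) (memLp_moll k hU))
        (fun k => memLp_two_bdd_mul hφm hA (memLp_moll k (hG i)))
        (memLp_two_bdd_mul (hsm i) (hB i) hU) (memLp_two_bdd_mul hφm hA (hG i))
        (tendsto_eLpNorm_bdd_mul (hB i) (tendsto_eLpNorm_moll_sub hU))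
        (tendsto_eLpNorm_bdd_mul hA (tendsto_eLpNorm_moll_sub (hG i)))
  obtain ⟨ns, hns, hae⟩ := exists_seq_slice_tendsto hf hf' hlim
  have hfa : ∀ o, ∀ᵐ t, AEStronglyMeasurable fun x => f' o (t, x) := fun o => by
    have := hf' o
    rw [Measure.volume_eq_prod] at this
    exact this.prodMk_left
  obtain ⟨N, hN⟩ := exists_nat_one_div_lt hε
  have key : ∀ k ≥ N, ∀ t, eLpNorm (fun x => f none k (t, x)) 6 volume ≤
      C * ∑ i, eLpNorm (fun x => f (some i) k (t, x)) 2 volume := by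
    intro k hk t
    have hF : ContDiff ℝ ∞ (f none k) := hφ.1.mul (contDiff_moll k hUl)
    have hs : ContDiff ℝ 1 fun x => f none k (t, x) :=
      (hF.of_le (by simp)).comp (contDiff_const.prodMk contDiff_id)
    have hsc : HasCompactSupport fun x => f none k (t, x) :=
      hasCompactSupport_slice hφ.2.1.mul_right t
    refine (hS _ hs hsc).trans_eq ?_
    refine congrArg (C * ·) (Finset.sum_congr rfl fun i _ => congrArg (eLpNorm · 2 volume) ?_)
    ext x
    rw [fderiv_slice hF]
    have e := IsLocalSolution.fderiv_mul_moll hφ.1 k hUl (t, x) (0, basisVec i)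
    refine e.trans ?_
    change _ = spaceDeriv i φ (t, x) * moll k (K.indicator (u j)) (t, x) +
      φ (t, x) * moll k (K.indicator (G i j)) (t, x)
    refine congrArg₂ (· + ·) rfl ?_
    by_cases hx : (t, x) ∈ tsupport φ
    · congr 1
      have hb : Metric.closedBall (t, x) (1 / ((k : ℝ) + 1)) ⊆ K :=
        (Metric.closedBall_subset_cthickening hx _).trans
          (Metric.cthickening_mono (le_trans (by gcongr) hN.le) _)
      have hψ := (tsupport_mollifier_sub_subset k (t, x)).trans hb
      refine fderiv_moll_of_weak k hUl ?_
      have hg := h.gradient i j _ ⟨contDiff_mollifier_sub k (t, x),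
        hK.of_isClosed_subset (isClosed_tsupport _) hψ, hψ.trans hεT⟩
      simp only [indicator_mul_of_tsupport_subset hψ]
      rw [← hg]
      refine integral_congr_ae (Eventually.of_forall fun z => ?_)
      exact indicator_mul_of_tsupport_subset ((tsupport_spaceDeriv_subset i _).trans hψ) _ z
    · simp [image_eq_zero_of_notMem_tsupport hx]
  filter_upwards [hae, ae_all_iff.2 hfa] with t ht hm
  have hck : ∀ o k, AEStronglyMeasurable fun x => f o k (t, x) := by
    have hc : Continuous fun x : E3 => (t, x) := by fun_prop
    rintro (_ | i) k
    · exact ((hφ.1.continuous.mul (contDiff_moll k hUl).continuous).comp hc).aestronglyMeasurable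
    · exact ((((hφ.spaceDeriv i).1.continuous.mul (contDiff_moll k hUl).continuous).add
        (hφ.1.continuous.mul (contDiff_moll k ((hG i).locallyIntegrable
          (by norm_num))).continuous)).comp hc).aestronglyMeasurable
  have h6 := eLpNorm_six_le_of_tendsto hCt (fun k => hck none (ns k)) (hm none)
    (fun i k => hck (some i) (ns k)) (fun i => hm (some i))
    ((hns.tendsto_atTop.eventually_ge_atTop N).mono fun k hk => key _ hk t) (ht none)
    (fun i => ht (some i))
  have e1 : ∀ x, f' none (t, x) = φ (t, x) * u j (t, x) := fun x => by
    change φ (t, x) * K.indicator (u j) (t, x) = _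
    rw [mul_comm, indicator_mul_of_tsupport_subset hφK, mul_comm]
  have e2 : ∀ i x, f' (some i) (t, x) =
      spaceDeriv i φ (t, x) * u j (t, x) + φ (t, x) * G i j (t, x) := fun i x => by
    change spaceDeriv i φ (t, x) * K.indicator (u j) (t, x) + φ (t, x) * K.indicator (G i j) (t, x) = _
    rw [mul_comm, indicator_mul_of_tsupport_subset ((tsupport_spaceDeriv_subset i _).trans hφK),
      mul_comm (φ (t, x)), indicator_mul_of_tsupport_subset hφK, mul_comm, mul_comm (G i j (t, x))]
  simpa only [e1, e2] using h6

/-- The Sobolev inequality for the weighted solution on time slices. -/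
theorem exists_eLpNorm_six_weight_le (γ : ℝ) : ∃ C : ℝ≥0∞, C ≠ ⊤ ∧ ∀ {T : ℝ}
    {b : Fin 3 → ℝ × E3 → ℝ} {F : Fin 3 → Fin 3 → ℝ × E3 → ℝ} {u : Fin 3 → ℝ × E3 → ℝ}
    {G : Fin 3 → Fin 3 → ℝ × E3 → ℝ} {p : ℝ × E3 → ℝ}, IsWeightedSolution γ T b F u G p → 0 < T →
    ∀ j, ∀ᵐ t, t ∈ Ioo 0 T → eLpNorm (fun x => smoothWeight (γ / 2) x * u j (t, x)) 6 volume ≤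
      C * ∑ i, (eLpNorm (fun x => smoothWeight (γ / 2) x * u j (t, x)) 2 volume +
        eLpNorm (fun x => smoothWeight (γ / 2) x * G i j (t, x)) 2 volume) := by
  obtain ⟨C, hCt, hC⟩ := exists_eLpNorm_six_mul_le
  obtain ⟨D, hD0, hD⟩ := exists_norm_fderiv_cutWeight_le (γ / 2)
  refine ⟨C * ENNReal.ofReal (D + 1), ENNReal.mul_ne_top hCt ENNReal.ofReal_ne_top,
    fun {T b F u G p} h hT j => ?_⟩
  obtain ⟨θ, hθ, hθc, hθT, hθ1⟩ := exists_timeCutoff hT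
  have h1 := fun n => hC h _ (isTestSlab_time_mul_space (hθ n) (hθc n) (hθT n)
    (contDiff_cutWeight (γ / 2) n) (hasCompactSupport_cutWeight (γ / 2) n)) j
  have hum : ∀ᵐ t, AEStronglyMeasurable fun x => u j (t, x) := by
    have := (h.locallyIntegrable_u j).aestronglyMeasurable
    rw [Measure.volume_eq_prod] at this
    exact this.prodMk_left
  have hGm : ∀ᵐ t, ∀ i, AEStronglyMeasurable fun x => G i j (t, x) := by
    refine ae_all_iff.2 fun i => ?_
    have := (h.locallyIntegrable_G i j).aestronglyMeasurable
    rw [Measure.volume_eq_prod] at this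
    exact this.prodMk_left
  filter_upwards [ae_all_iff.2 h1, hum, hGm] with t ht hu hG htT
  have hwm : ∀ a n, AEStronglyMeasurable (cutWeight a n) volume := fun a n =>
    (contDiff_cutWeight a n).continuous.aestronglyMeasurable
  have hlim : ∀ᵐ x, Tendsto (fun n => cutWeight (γ / 2) n x * u j (t, x)) atTop
      (𝓝 (smoothWeight (γ / 2) x * u j (t, x))) :=
    Eventually.of_forall fun x => (tendsto_cutWeight (γ / 2) x).mul_const _
  refine (Lp.eLpNorm_lim_le_liminf_eLpNorm (fun n => (hwm _ n).mul hu) _ hlim).trans ?_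
  refine liminf_le_of_frequently_le' ((hθ1 t htT).frequently.mono fun n hn => ?_)
  have h2 := ht n
  simp only [spaceDeriv_time_mul_space (hθ n) (contDiff_cutWeight (γ / 2) n), hn, one_mul] at h2
  refine h2.trans ?_
  rw [mul_assoc]
  refine mul_le_mul_right ?_ _
  rw [Finset.mul_sum]
  refine Finset.sum_le_sum fun i _ => ?_
  have hdm : AEStronglyMeasurable fun x => fderiv ℝ (cutWeight (γ / 2) n) x (basisVec i) :=
    (((contDiff_cutWeight (γ / 2) n).continuous_fderiv (by simp)).clm_apply
      continuous_const).aestronglyMeasurable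
  refine (eLpNorm_add_le (hdm.mul hu) ((hwm _ n).mul (hG i)) (by norm_num)).trans ?_
  rw [mul_add]
  refine add_le_add (eLpNorm_le_mul_eLpNorm_of_ae_le_mul (Eventually.of_forall fun x => ?_) 2)
    (eLpNorm_le_mul_eLpNorm_of_ae_le_mul (Eventually.of_forall fun x => ?_) 2)
  · have hw := smoothWeight_pos (γ / 2) x
    simp only [Pi.mul_apply, norm_mul, ← mul_assoc]
    refine mul_le_mul_of_nonneg_right ((hD n x i).trans ?_) (norm_nonneg _)
    rw [Real.norm_of_nonneg hw.le]
    exact mul_le_mul (by linarith) (smoothWeight_anti (by linarith) x) (smoothWeight_pos _ _).le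
      (by linarith)
  · have hw := smoothWeight_pos (γ / 2) x
    simp only [Pi.mul_apply, norm_mul, ← mul_assoc]
    refine mul_le_mul_of_nonneg_right ?_ (norm_nonneg _)
    rw [Real.norm_of_nonneg hw.le, Real.norm_of_nonneg (cutWeight_nonneg _ _ _)]
    exact (cutWeight_le _ n x).trans (le_mul_of_one_le_left hw.le (by linarith))

end AdvDiff

namespace AdvDiff

/-- The weighted norm of a time slice. -/
noncomputable def wnorm (γ : ℝ) (r : ℝ≥0∞) (f : ℝ × E3 → ℝ) (t : ℝ) : ℝ≥0∞ :=
  eLpNorm (fun x => smoothWeight (γ / 2) x * f (t, x)) r volume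

theorem eLpNorm_mul_le_of_holder {α : Type*} [MeasurableSpace α] {μ : Measure α} {f g h : α → ℝ}
    {p q r : ℝ≥0∞} [ENNReal.HolderTriple p q r] {C : ℝ} (hf : AEStronglyMeasurable f μ)
    (hg : AEStronglyMeasurable g μ) (h1 : ∀ x, ‖h x‖ ≤ C * (‖f x‖ * ‖g x‖)) :
    eLpNorm h r μ ≤ ENNReal.ofReal C * (eLpNorm f p μ * eLpNorm g q μ) := by
  refine (eLpNorm_le_mul_eLpNorm_of_ae_le_mul (g := f • g) (c := C)
    (Eventually.of_forall fun x => ?_) r).trans (mul_le_mul_right (eLpNorm_smul_le_mul_eLpNorm hg hf) _)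
  rw [Pi.smul_apply', smul_eq_mul, norm_mul]
  exact h1 x

theorem lintegral_enorm_le_of_holder {α : Type*} [MeasurableSpace α] {μ : Measure α} {f g h : α → ℝ}
    {C : ℝ} (hf : AEStronglyMeasurable f μ) (hg : AEStronglyMeasurable g μ)
    (h1 : ∀ x, ‖h x‖ ≤ C * (‖f x‖ * ‖g x‖)) :
    ∫⁻ x, ‖h x‖ₑ ∂μ ≤ ENNReal.ofReal C * (eLpNorm f 2 μ * eLpNorm g 2 μ) := by
  rw [← eLpNorm_one_eq_lintegral_enorm]
  exact eLpNorm_mul_le_of_holder hf hg h1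

theorem smoothWeight_eq_sq (γ : ℝ) (x : E3) :
    smoothWeight γ x = smoothWeight (γ / 2) x * smoothWeight (γ / 2) x := by
  rw [← smoothWeight_add, add_halves]

theorem eLpNorm_weight_mul_le {γ : ℝ} {p q r : ℝ≥0∞} [ENNReal.HolderTriple p q r]
    {f g : ℝ × E3 → ℝ} {t : ℝ} (hf : AEStronglyMeasurable fun x => f (t, x))
    (hg : AEStronglyMeasurable fun x => g (t, x)) :
    eLpNorm (fun x => smoothWeight γ x * (f (t, x) * g (t, x))) r volume ≤
      wnorm γ p f t * wnorm γ q g t := by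
  have hw := (continuous_smoothWeight (γ / 2)).aestronglyMeasurable (μ := (volume : Measure E3))
  refine (eLpNorm_mul_le_of_holder (p := p) (q := q) (C := 1) (hw.mul hf) (hw.mul hg) fun x => ?_).trans_eq ?_
  · simp only [Pi.mul_apply]
    rw [smoothWeight_eq_sq, one_mul, ← norm_mul]
    exact le_of_eq (congrArg norm (by ring))
  · rw [ENNReal.ofReal_one, one_mul]
    rfl

section Slices

variable {γ T : ℝ} {b : Fin 3 → ℝ × E3 → ℝ} {u : Fin 3 → ℝ × E3 → ℝ}
  {G : Fin 3 → Fin 3 → ℝ × E3 → ℝ} {p : ℝ × E3 → ℝ}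

/-- The energy norm of a slice of the solution. -/
noncomputable def sliceU (γ : ℝ) (u : Fin 3 → ℝ × E3 → ℝ) (t : ℝ) : ℝ≥0∞ := ∑ j, wnorm γ 2 (u j) t

/-- The energy norm of a slice of the gradient. -/
noncomputable def sliceG (γ : ℝ) (G : Fin 3 → Fin 3 → ℝ × E3 → ℝ) (t : ℝ) : ℝ≥0∞ :=
  ∑ j, ∑ i, wnorm γ 2 (G i j) t

/-- The weighted `L³` norm of a slice of the drift. -/
noncomputable def sliceB (γ : ℝ) (b : Fin 3 → ℝ × E3 → ℝ) (t : ℝ) : ℝ≥0∞ := ∑ i, wnorm γ 3 (b i) t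

theorem wnorm_le_sliceU (j : Fin 3) (t : ℝ) : wnorm γ 2 (u j) t ≤ sliceU γ u t :=
  Finset.single_le_sum (f := fun j => wnorm γ 2 (u j) t) (fun _ _ => zero_le) (Finset.mem_univ j)

theorem wnorm_le_sliceB (i : Fin 3) (t : ℝ) : wnorm γ 3 (b i) t ≤ sliceB γ b t :=
  Finset.single_le_sum (f := fun i => wnorm γ 3 (b i) t) (fun _ _ => zero_le) (Finset.mem_univ i)

theorem sum_wnorm_le_sliceG (j : Fin 3) (t : ℝ) : ∑ i, wnorm γ 2 (G i j) t ≤ sliceG γ G t :=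
  Finset.single_le_sum (f := fun j => ∑ i, wnorm γ 2 (G i j) t) (fun _ _ => zero_le)
    (Finset.mem_univ j)

theorem wnorm_le_sliceG (i j : Fin 3) (t : ℝ) : wnorm γ 2 (G i j) t ≤ sliceG γ G t :=
  (Finset.single_le_sum (f := fun i => wnorm γ 2 (G i j) t) (fun _ _ => zero_le)
    (Finset.mem_univ i)).trans (sum_wnorm_le_sliceG j t)

theorem sum_fin_three_le {f : Fin 3 → ℝ≥0∞} {c : ℝ≥0∞} (h : ∀ i, f i ≤ c) : ∑ i, f i ≤ 3 * c := by
  refine (Finset.sum_le_card_nsmul _ _ c fun i _ => h i).trans_eq ?_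
  simp

/-- On almost every slice, the weighted `L⁶` norm of the solution and the weighted `L²` norm of the
pressure are controlled by the energy norms. -/
theorem exists_slice_six_pressure_le (γ : ℝ) (hγ : 0 < γ) (hγ2 : γ ≤ 2) :
    ∃ C : ℝ≥0∞, C ≠ ⊤ ∧ ∀ {T : ℝ} {b : Fin 3 → ℝ × E3 → ℝ} {u : Fin 3 → ℝ × E3 → ℝ}
      {G : Fin 3 → Fin 3 → ℝ × E3 → ℝ} {p : ℝ × E3 → ℝ},
      IsWeightedSolution γ T b (fun _ _ _ => 0) u G p → 0 < T → ∀ᵐ t, t ∈ Ioo 0 T →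
      (∀ j, wnorm γ 6 (u j) t ≤ C * (sliceU γ u t + sliceG γ G t)) ∧
      eLpNorm (fun x => smoothWeight γ x * p (t, x)) 2 volume ≤
        C * (sliceB γ b t * (sliceU γ u t + sliceG γ G t)) := by
  obtain ⟨C, hCt, hC⟩ := exists_eLpNorm_six_weight_le γ
  obtain ⟨A, hAt, hA⟩ := exists_eLpNorm_rieszSum_le
  refine ⟨3 * C + A * (9 * (3 * C + 1)), by finiteness, fun {T b u G p} h hT => ?_⟩
  have hm : ∀ {f : ℝ × E3 → ℝ}, LocallyIntegrable f → ∀ᵐ t, AEStronglyMeasurable fun x => f (t, x) :=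
    fun {f} hf => by
      have := hf.aestronglyMeasurable
      rw [Measure.volume_eq_prod] at this
      exact this.prodMk_left
  filter_upwards [ae_all_iff.2 fun j => hC h hT j, h.riesz,
    ae_all_iff.2 fun j => hm (h.locallyIntegrable_u j),
    ae_all_iff.2 fun i => hm (h.locallyIntegrable_b i)] with t h6 hr hum hbm htT
  have h6' : ∀ j, wnorm γ 6 (u j) t ≤ 3 * C * (sliceU γ u t + sliceG γ G t) := fun j => by
    refine (h6 j htT).trans ?_
    rw [Finset.sum_add_distrib]
    calc _ ≤ C * (3 * sliceU γ u t + 3 * sliceG γ G t) := by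
          gcongr
          · exact sum_fin_three_le fun _ => wnorm_le_sliceU j t
          · exact (sum_wnorm_le_sliceG j t).trans (le_mul_of_one_le_left zero_le (by norm_num))
      _ = _ := by ring
  refine ⟨fun j => (h6' j).trans (mul_le_mul_left le_self_add _), ?_⟩
  simp only [sub_zero] at hr
  refine (hA γ hγ.le hγ2 _ _ (fun i j => (hbm i).mul (hum j)) hr).trans ?_
  refine le_trans ?_ (mul_le_mul_left (le_add_self : A * (9 * (3 * C + 1)) ≤ 3 * C + _) _)
  rw [mul_assoc, mul_assoc]
  refine mul_le_mul_right ?_ _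
  have hij : ∀ i j, eLpNorm (fun x => smoothWeight γ x * (b i (t, x) * u j (t, x))) 2 volume +
      eLpNorm (fun x => smoothWeight γ x * (b i (t, x) * u j (t, x))) (6 / 5) volume ≤
      (3 * C + 1) * (sliceB γ b t * (sliceU γ u t + sliceG γ G t)) := fun i j => by
    calc _ ≤ wnorm γ 3 (b i) t * wnorm γ 6 (u j) t + wnorm γ 3 (b i) t * wnorm γ 2 (u j) t :=
          add_le_add (eLpNorm_weight_mul_le (hbm i) (hum j)) (eLpNorm_weight_mul_le (hbm i) (hum j))
      _ ≤ sliceB γ b t * (3 * C * (sliceU γ u t + sliceG γ G t)) +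
          sliceB γ b t * (sliceU γ u t + sliceG γ G t) := by
        gcongr
        · exact wnorm_le_sliceB i t
        · exact h6' j
        · exact wnorm_le_sliceB i t
        · exact (wnorm_le_sliceU j t).trans le_self_add
      _ = _ := by ring
  refine (sum_fin_three_le fun i => sum_fin_three_le fun j => hij i j).trans_eq ?_
  ring

theorem IsWeightedSolution.ae_slice_measurable {F : Fin 3 → Fin 3 → ℝ × E3 → ℝ}
    (h : IsWeightedSolution γ T b F u G p) : ∀ᵐ t,
      (∀ j, AEStronglyMeasurable fun x => u j (t, x)) ∧
      (∀ i j, AEStronglyMeasurable fun x => G i j (t, x)) ∧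
      (∀ i, AEStronglyMeasurable fun x => b i (t, x)) ∧ AEStronglyMeasurable fun x => p (t, x) := by
  have hm : ∀ {f : ℝ × E3 → ℝ}, AEStronglyMeasurable f → ∀ᵐ t, AEStronglyMeasurable fun x => f (t, x) :=
    fun {f} hf => by
      rw [Measure.volume_eq_prod] at hf
      exact hf.prodMk_left
  filter_upwards [ae_all_iff.2 fun j => hm (h.locallyIntegrable_u j).aestronglyMeasurable,
    ae_all_iff.2 fun i => ae_all_iff.2 fun j => hm (h.locallyIntegrable_G i j).aestronglyMeasurable,
    ae_all_iff.2 fun i => hm (h.locallyIntegrable_b i).aestronglyMeasurable, hm h.measurable_p] with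
    t h1 h2 h3 h4
  exact ⟨h1, h2, h3, h4⟩

/-- The error terms in the weighted energy balance, on almost every slice. -/
theorem exists_slice_terms_le (γ : ℝ) (hγ : 0 < γ) (hγ2 : γ ≤ 2) :
    ∃ C : ℝ≥0∞, C ≠ ⊤ ∧ ∀ {T : ℝ} {b : Fin 3 → ℝ × E3 → ℝ} {u : Fin 3 → ℝ × E3 → ℝ}
      {G : Fin 3 → Fin 3 → ℝ × E3 → ℝ} {p : ℝ × E3 → ℝ},
      IsWeightedSolution γ T b (fun _ _ _ => 0) u G p → 0 < T → ∀ᵐ t, t ∈ Ioo 0 T → ∀ n,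
      (∑ j, ∑ i, ∫⁻ x, ‖G i j (t, x) * (fderiv ℝ (cutWeight γ n) x (basisVec i) * u j (t, x))‖ₑ) +
      (∑ j, ∑ i, ∫⁻ x, ‖b i (t, x) * u j (t, x) *
        (fderiv ℝ (cutWeight γ n) x (basisVec i) * u j (t, x))‖ₑ) +
      (∑ j, ∫⁻ x, ‖p (t, x) * (fderiv ℝ (cutWeight γ n) x (basisVec j) * u j (t, x))‖ₑ) ≤
      C * ((1 + sliceB γ b t) * (sliceU γ u t + sliceG γ G t) * sliceU γ u t) := by
  obtain ⟨C, hCt, hC⟩ := exists_slice_six_pressure_le γ hγ hγ2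
  obtain ⟨D, hD0, hD⟩ := exists_norm_fderiv_cutWeight_le γ
  refine ⟨ENNReal.ofReal D * (9 + 12 * C), by finiteness, fun {T b u G p} h hT => ?_⟩
  filter_upwards [hC h hT, h.ae_slice_measurable] with t ht hm htT n
  obtain ⟨h6, hp⟩ := ht htT
  obtain ⟨hum, hGm, hbm, hpm⟩ := hm
  have hw := fun a => (continuous_smoothWeight a).aestronglyMeasurable (μ := (volume : Measure E3))
  set e := sliceU γ u t
  set d := sliceG γ G t
  set β := sliceB γ b t
  have key : ∀ (a c : ℝ) (f g : ℝ × E3 → ℝ) (i : Fin 3),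
      (AEStronglyMeasurable fun x => f (t, x)) → (AEStronglyMeasurable fun x => g (t, x)) →
      a + c ≤ γ + 1 →
      ∫⁻ x, ‖f (t, x) * (fderiv ℝ (cutWeight γ n) x (basisVec i) * g (t, x))‖ₑ ≤
        ENNReal.ofReal D * (eLpNorm (fun x => smoothWeight a x * f (t, x)) 2 volume *
          eLpNorm (fun x => smoothWeight c x * g (t, x)) 2 volume) := by
    intro a c f g i hf hg hac
    refine lintegral_enorm_le_of_holder ((hw a).mul hf) ((hw c).mul hg) fun x => ?_
    simp only [norm_mul, Real.norm_of_nonneg (smoothWeight_pos _ x).le]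
    have h1 : ‖fderiv ℝ (cutWeight γ n) x (basisVec i)‖ ≤ D * (smoothWeight a x * smoothWeight c x) :=
      (hD n x i).trans (mul_le_mul_of_nonneg_left
        ((smoothWeight_anti hac x).trans_eq (smoothWeight_add a c x)) hD0)
    calc _ ≤ ‖f (t, x)‖ * (D * (smoothWeight a x * smoothWeight c x) * ‖g (t, x)‖) := by gcongr
      _ = _ := by ring
  have t1 : ∀ j i, ∫⁻ x, ‖G i j (t, x) * (fderiv ℝ (cutWeight γ n) x (basisVec i) * u j (t, x))‖ₑ ≤
      ENNReal.ofReal D * ((1 + β) * (e + d) * e) := fun j i => by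
    refine (key (γ / 2) (γ / 2) (G i j) (u j) i (hGm i j) (hum j) (by linarith)).trans ?_
    gcongr
    · calc _ ≤ d := wnorm_le_sliceG i j t
        _ ≤ 1 * (e + d) := by rw [one_mul]; exact le_add_self
        _ ≤ _ := by gcongr; exact le_self_add
    · exact wnorm_le_sliceU j t
  have t2 : ∀ j i, ∫⁻ x, ‖b i (t, x) * u j (t, x) *
        (fderiv ℝ (cutWeight γ n) x (basisVec i) * u j (t, x))‖ₑ ≤
      ENNReal.ofReal D * (C * ((1 + β) * (e + d) * e)) := fun j i => by
    refine (key γ (γ / 2) (fun z => b i z * u j z) (u j) i ((hbm i).mul (hum j)) (hum j)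
      (by linarith)).trans ?_
    calc _ ≤ ENNReal.ofReal D * (wnorm γ 3 (b i) t * wnorm γ 6 (u j) t * wnorm γ 2 (u j) t) := by
          gcongr
          · exact eLpNorm_weight_mul_le (hbm i) (hum j)
          · exact le_rfl
      _ ≤ ENNReal.ofReal D * ((1 + β) * (C * (e + d)) * e) := by
          gcongr
          · exact (wnorm_le_sliceB i t).trans le_add_self
          · exact h6 j
          · exact wnorm_le_sliceU j t
      _ = _ := by ring
  have t3 : ∀ j, ∫⁻ x, ‖p (t, x) * (fderiv ℝ (cutWeight γ n) x (basisVec j) * u j (t, x))‖ₑ ≤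
      ENNReal.ofReal D * (C * ((1 + β) * (e + d) * e)) := fun j => by
    refine (key γ (γ / 2) p (u j) j hpm (hum j) (by linarith)).trans ?_
    calc _ ≤ ENNReal.ofReal D * (C * (β * (e + d)) * e) := by
          gcongr
          exact wnorm_le_sliceU j t
      _ ≤ ENNReal.ofReal D * (C * ((1 + β) * (e + d)) * e) := by
          gcongr
          exact le_add_self
      _ = _ := by ring
  refine (add_le_add (add_le_add
    (sum_fin_three_le fun j => sum_fin_three_le fun i => t1 j i)
    (sum_fin_three_le fun j => sum_fin_three_le fun i => t2 j i))
    (sum_fin_three_le fun j => t3 j)).trans_eq ?_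
  ring

end Slices

/-- Young's inequality. -/
theorem ennreal_mul_mul_le (κ x y : ℝ≥0∞) :
    κ * x * y ≤ x ^ 2 / 18 + 18 * (κ * y) ^ 2 := by
  rcases le_total (18 * (κ * y)) x with h | h
  · refine le_add_right ?_
    rw [ENNReal.le_div_iff_mul_le (by simp) (by simp)]
    calc κ * x * y * 18 = x * (18 * (κ * y)) := by ring
      _ ≤ x * x := by gcongr
      _ = x ^ 2 := (sq x).symm
  · refine le_add_left ?_
    calc κ * x * y = x * (κ * y) := by ring
      _ ≤ 18 * (κ * y) * (κ * y) := by gcongr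
      _ = _ := by ring

end AdvDiff

namespace AdvDiff

theorem wnorm_rpow (γ : ℝ) {r : ℝ≥0∞} (hr : r ≠ 0) (hr' : r ≠ ⊤) (f : ℝ × E3 → ℝ) (t : ℝ) :
    wnorm γ r f t ^ r.toReal = ∫⁻ x, ‖smoothWeight (γ / 2) x * f (t, x)‖ₑ ^ r.toReal := by
  have hr0 : 0 < r.toReal := ENNReal.toReal_pos hr hr'
  rw [wnorm, eLpNorm_eq_lintegral_rpow_enorm_toReal hr hr', ← ENNReal.rpow_mul,
    one_div_mul_cancel hr0.ne', ENNReal.rpow_one]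

theorem wnorm_two_sq (γ : ℝ) (f : ℝ × E3 → ℝ) (t : ℝ) :
    wnorm γ 2 f t ^ 2 = ∫⁻ x, ‖smoothWeight (γ / 2) x * f (t, x)‖ₑ ^ (2 : ℝ) := by
  have := wnorm_rpow γ (r := 2) (by norm_num) (by norm_num) f t
  rw [ENNReal.toReal_ofNat] at this
  rw [← this, ENNReal.rpow_two]

theorem aemeasurable_wnorm {γ : ℝ} {r : ℝ≥0∞} (hr : r ≠ 0) (hr' : r ≠ ⊤) {f : ℝ × E3 → ℝ}
    (hf : AEStronglyMeasurable fun z : ℝ × E3 => smoothWeight (γ / 2) z.2 * f z) :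
    AEMeasurable (wnorm γ r f) := by
  have h1 : AEMeasurable (fun z : ℝ × E3 => ‖smoothWeight (γ / 2) z.2 * f z‖ₑ ^ r.toReal) :=
    hf.enorm.pow_const _
  rw [Measure.volume_eq_prod] at h1
  refine (h1.lintegral_prod_right'.pow_const (1 / r.toReal)).congr (Eventually.of_forall fun t => ?_)
  simp only
  rw [wnorm, eLpNorm_eq_lintegral_rpow_enorm_toReal hr hr']

theorem lintegral_wnorm_rpow_lt_top {γ : ℝ} {r : ℝ≥0∞} (hr : r ≠ 0) (hr' : r ≠ ⊤)
    {f : ℝ × E3 → ℝ} (hf : MemLp (fun z : ℝ × E3 => smoothWeight (γ / 2) z.2 * f z) r volume) :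
    ∫⁻ t, wnorm γ r f t ^ r.toReal < ⊤ := by
  have h := (eLpNorm_lt_top_iff_lintegral_rpow_enorm_lt_top hr hr').1 hf.2
  rw [lintegral_slab (hf.1.enorm.pow_const _)] at h
  simpa only [wnorm_rpow γ hr hr'] using h

theorem ennreal_sum_sq_le (f : Fin 3 → ℝ≥0∞) : (∑ i, f i) ^ 2 ≤ 3 * ∑ i, f i ^ 2 := by
  have := ENNReal.rpow_sum_le_const_mul_sum_rpow Finset.univ f (p := 2) (by norm_num)
  norm_num at this
  exact this

theorem ennreal_sum_cube_le (f : Fin 3 → ℝ≥0∞) :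
    (∑ i, f i) ^ (3 : ℝ) ≤ 9 * ∑ i, f i ^ (3 : ℝ) := by
  have := ENNReal.rpow_sum_le_const_mul_sum_rpow Finset.univ f (p := 3) (by norm_num)
  norm_num at this
  norm_num
  exact this

/-- The energy of a slice of the solution. -/
noncomputable def energy (γ : ℝ) (u : Fin 3 → ℝ × E3 → ℝ) (t : ℝ) : ℝ≥0∞ := ∑ j, wnorm γ 2 (u j) t ^ 2

/-- The dissipation on a slice. -/
noncomputable def dissipation (γ : ℝ) (G : Fin 3 → Fin 3 → ℝ × E3 → ℝ) (t : ℝ) : ℝ≥0∞ :=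
  ∑ j, ∑ i, wnorm γ 2 (G i j) t ^ 2

theorem sliceU_sq_le (γ : ℝ) (u : Fin 3 → ℝ × E3 → ℝ) (t : ℝ) :
    sliceU γ u t ^ 2 ≤ 3 * energy γ u t := ennreal_sum_sq_le _

theorem sliceG_sq_le (γ : ℝ) (G : Fin 3 → Fin 3 → ℝ × E3 → ℝ) (t : ℝ) :
    sliceG γ G t ^ 2 ≤ 9 * dissipation γ G t := by
  refine (ennreal_sum_sq_le _).trans ?_
  calc _ ≤ 3 * ∑ j, 3 * ∑ i, wnorm γ 2 (G i j) t ^ 2 := by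
        gcongr
        exact ennreal_sum_sq_le _
    _ = _ := by rw [← Finset.mul_sum, ← mul_assoc, dissipation]; norm_num

theorem add_sq_le_two_mul (x y : ℝ≥0∞) : (x + y) ^ 2 ≤ 2 * (x ^ 2 + y ^ 2) := by
  have := ENNReal.rpow_add_le_mul_rpow_add_rpow x y (p := 2) (by norm_num)
  norm_num at this
  exact this

namespace IsWeightedSolution

variable {γ T : ℝ} {b : Fin 3 → ℝ × E3 → ℝ} {F : Fin 3 → Fin 3 → ℝ × E3 → ℝ}
  {u : Fin 3 → ℝ × E3 → ℝ} {G : Fin 3 → Fin 3 → ℝ × E3 → ℝ} {p : ℝ × E3 → ℝ}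

section

variable (h : IsWeightedSolution γ T b F u G p)

include h

theorem aemeasurable_energy : AEMeasurable (energy γ u) :=
  Finset.aemeasurable_fun_sum _ fun j _ =>
    (aemeasurable_wnorm (by norm_num) (by norm_num) (h.memLp_u j).1).pow_const 2

theorem aemeasurable_dissipation : AEMeasurable (dissipation γ G) :=
  Finset.aemeasurable_fun_sum _ fun j _ => Finset.aemeasurable_fun_sum _ fun i _ =>
    (aemeasurable_wnorm (by norm_num) (by norm_num) (h.memLp_G i j).1).pow_const 2

theorem aemeasurable_sliceB : AEMeasurable (sliceB γ b) :=
  Finset.aemeasurable_fun_sum _ fun i _ =>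
    aemeasurable_wnorm (by norm_num) (by norm_num) (h.memLp_b i).1

theorem exists_energy_le : ∃ M : ℝ≥0∞, M ≠ ⊤ ∧ ∀ᵐ t, energy γ u t ≤ M := by
  obtain ⟨M, hMt, hM⟩ := h.bounded_u
  refine ⟨3 * M, ENNReal.mul_ne_top (by norm_num) hMt, ?_⟩
  filter_upwards [ae_all_iff.2 hM] with t ht
  exact sum_fin_three_le fun j => (wnorm_two_sq γ (u j) t).trans_le (ht j)

theorem lintegral_dissipation_lt_top : ∫⁻ t, dissipation γ G t < ⊤ := by
  unfold dissipation
  have hm := fun i j => (aemeasurable_wnorm (r := 2) (by norm_num) (by norm_num)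
    (h.memLp_G i j).1).pow_const 2
  rw [lintegral_finsetSum' _ fun j _ => Finset.aemeasurable_fun_sum _ fun i _ => hm i j]
  refine ENNReal.sum_lt_top.2 fun j _ => ?_
  rw [lintegral_finsetSum' _ fun i _ => hm i j]
  refine ENNReal.sum_lt_top.2 fun i _ => ?_
  have := lintegral_wnorm_rpow_lt_top (by norm_num) (by norm_num) (h.memLp_G i j)
  simpa only [ENNReal.toReal_ofNat, ENNReal.rpow_two] using this

theorem lintegral_sliceB_lt_top : ∫⁻ t in Ioo 0 T, (1 + sliceB γ b t) ^ 2 < ⊤ := by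
  have hm := fun i => (aemeasurable_wnorm (r := 3) (by norm_num) (by norm_num)
    (h.memLp_b i).1).pow_const (3 : ℝ)
  have hle : ∀ t, (1 + sliceB γ b t) ^ 2 ≤ 4 * (1 + 9 * ∑ i, wnorm γ 3 (b i) t ^ (3 : ℝ)) := by
    intro t
    calc (1 + sliceB γ b t) ^ 2 ≤ (1 + sliceB γ b t) ^ (3 : ℝ) := by
          rw [← ENNReal.rpow_two]
          exact ENNReal.rpow_le_rpow_of_exponent_le le_self_add (by norm_num)
      _ ≤ 4 * (1 + sliceB γ b t ^ (3 : ℝ)) := by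
          have := ENNReal.rpow_add_le_mul_rpow_add_rpow 1 (sliceB γ b t) (p := 3) (by norm_num)
          norm_num at this
          norm_num
          exact this
      _ ≤ _ := by
          gcongr
          exact ennreal_sum_cube_le _
  refine lt_of_le_of_lt (lintegral_mono hle) ?_
  rw [lintegral_const_mul' _ _ (by norm_num), lintegral_add_left measurable_const,
    lintegral_const_mul' _ _ (by norm_num), lintegral_finsetSum' _ fun i _ => (hm i).restrict]
  have hb : ∀ i, ∫⁻ t in Ioo 0 T, wnorm γ 3 (b i) t ^ (3 : ℝ) < ⊤ := fun i => by
    refine (setLIntegral_le_lintegral _ _).trans_lt ?_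
    have := lintegral_wnorm_rpow_lt_top (by norm_num) (by norm_num) (h.memLp_b i)
    simpa only [ENNReal.toReal_ofNat] using this
  refine ENNReal.mul_lt_top (by norm_num) (ENNReal.add_lt_top.2 ⟨by simp, ENNReal.mul_lt_top
    (by norm_num) (ENNReal.sum_lt_top.2 fun i _ => hb i)⟩)

end

theorem mixed_pressure (h : IsWeightedSolution γ T b (fun _ _ _ => 0) u G p) (hγ : 0 < γ)
    (hγ2 : γ ≤ 2) (hT : 0 < T) {K : Set (ℝ × E3)} (hK : IsCompact K) (hKT : K ⊆ slab T) :
    ∫⁻ t, (∫⁻ x, ‖K.indicator p (t, x)‖ₑ ^ (2 : ℝ)) ^ (1 / 2 : ℝ) ≠ ⊤ := by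
  obtain ⟨C, hCt, hC⟩ := exists_slice_six_pressure_le γ hγ hγ2
  obtain ⟨D, hD0, hD⟩ := exists_norm_indicator_le γ hK
  obtain ⟨M, hMt, hM⟩ := h.exists_energy_le
  have hle : ∀ᵐ t, (∫⁻ x, ‖K.indicator p (t, x)‖ₑ ^ (2 : ℝ)) ^ (1 / 2 : ℝ) ≤
      (Ioo 0 T).indicator (fun t => ENNReal.ofReal D * (C * ((1 + sliceB γ b t) ^ 2 +
        18 * (2 * (3 * M + 9 * dissipation γ G t))))) t := by
    filter_upwards [hC h hT, hM] with t ht hMt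
    rw [← eLpNorm_two_eq fun x => K.indicator p (t, x)]
    by_cases htT : t ∈ Ioo 0 T
    · rw [indicator_of_mem htT]
      calc _ ≤ ENNReal.ofReal D * eLpNorm (fun x => smoothWeight γ x * p (t, x)) 2 volume :=
            eLpNorm_le_mul_eLpNorm_of_ae_le_mul (Eventually.of_forall fun x => hD p (t, x)) 2
        _ ≤ _ := by
          gcongr
          refine (ht htT).2.trans ?_
          gcongr
          have hy := ennreal_mul_mul_le 1 (sliceB γ b t) (sliceU γ u t + sliceG γ G t)
          rw [one_mul, one_mul] at hy
          refine hy.trans ?_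
          gcongr
          · have hβ : sliceB γ b t ≤ 1 + sliceB γ b t := le_add_self
            refine ENNReal.div_le_of_le_mul ?_
            calc sliceB γ b t ^ 2 ≤ (1 + sliceB γ b t) ^ 2 * 1 := by rw [mul_one]; gcongr
              _ ≤ (1 + sliceB γ b t) ^ 2 * 18 := by gcongr; norm_num
          · refine (add_sq_le_two_mul _ _).trans ?_
            gcongr
            · exact (sliceU_sq_le γ u t).trans (by gcongr)
            · exact sliceG_sq_le γ G t
    · rw [indicator_of_notMem htT]
      have : (fun x => K.indicator p (t, x)) = fun _ => 0 := by
        ext x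
        exact indicator_of_notMem (fun hx => htT (hKT hx).1) _
      rw [this]
      simp
  refine ((lintegral_mono_ae hle).trans_lt ?_).ne
  have hm1 : AEMeasurable (fun t => (1 + sliceB γ b t) ^ 2) (volume.restrict (Ioo 0 T)) :=
    ((measurable_const.aemeasurable.add h.aemeasurable_sliceB).pow_const 2).restrict
  rw [lintegral_indicator measurableSet_Ioo, lintegral_const_mul' _ _ ENNReal.ofReal_ne_top,
    lintegral_const_mul' _ _ hCt, lintegral_add_left' hm1, lintegral_const_mul' _ _ (by norm_num),
    lintegral_const_mul' _ _ (by norm_num), lintegral_add_left measurable_const,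
    lintegral_const_mul' _ _ (by norm_num), lintegral_const_mul' _ _ (by norm_num)]
  have h1 := h.lintegral_sliceB_lt_top
  have h2 := (setLIntegral_le_lintegral (Ioo 0 T) (dissipation γ G)).trans_lt
    h.lintegral_dissipation_lt_top
  have h3 : 3 * ∫⁻ _ in Ioo 0 T, M < ⊤ := by
    rw [lintegral_const]
    exact ENNReal.mul_lt_top (by norm_num) (ENNReal.mul_lt_top hMt.lt_top (by simp))
  exact ENNReal.mul_lt_top ENNReal.ofReal_lt_top (ENNReal.mul_lt_top hCt.lt_top
    (ENNReal.add_lt_top.2 ⟨h1, ENNReal.mul_lt_top (by norm_num) (ENNReal.mul_lt_top (by norm_num)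
    (ENNReal.add_lt_top.2 ⟨h3, ENNReal.mul_lt_top (by norm_num) h2⟩))⟩))

theorem isLocalSolution (h : IsWeightedSolution γ T b (fun _ _ _ => 0) u G p) (hγ : 0 < γ)
    (hγ2 : γ ≤ 2) (hT : 0 < T) {K : Set (ℝ × E3)} (hK : IsCompact K) (hKT : K ⊆ slab T) :
    IsLocalSolution K (fun j => K.indicator (u j)) (fun i j => K.indicator (G i j))
      (fun i => K.indicator (b i)) (K.indicator p) := by
  have hint : ∀ {f : ℝ × E3 → ℝ}, LocallyIntegrable f → Integrable (K.indicator f) := fun hf =>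
    (integrable_indicator_iff hK.measurableSet).2 (hf.integrableOn_isCompact hK)
  have htest : ∀ {ψ : ℝ × E3 → ℝ}, ContDiff ℝ ∞ ψ → HasCompactSupport ψ → tsupport ψ ⊆ K →
      IsTestSlab T ψ := fun h1 h2 h3 => ⟨h1, h2, h3.trans hKT⟩
  have hs : ∀ {ψ : ℝ × E3 → ℝ} (i : Fin 3), tsupport ψ ⊆ K → tsupport (spaceDeriv i ψ) ⊆ K :=
    fun i h3 => (tsupport_spaceDeriv_subset i _).trans h3
  refine ⟨fun j => memLp_indicator_of_weight (by norm_num) (h.memLp_u j) hK,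
    fun j => hint (h.locallyIntegrable_u j), ?_,
    fun i j => memLp_indicator_of_weight (by norm_num) (h.memLp_G i j) hK,
    fun i j => hint (h.locallyIntegrable_G i j),
    fun i => (h.locallyIntegrable_b i).aestronglyMeasurable.indicator hK.measurableSet,
    h.bounded_b K hK hKT, (integrable_indicator_iff hK.measurableSet).2 (h.integrable_p K hK hKT),
    h.mixed_pressure hγ hγ2 hT hK hKT, fun i j ψ h1 h2 h3 => ?_, fun j ψ h1 h2 h3 => ?_,
    fun ψ h1 h2 h3 => ?_, fun ψ h1 h2 h3 => ?_⟩
  · obtain ⟨M, hMt, hM⟩ := h.bounded_u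
    obtain ⟨D, hD0, hD⟩ := exists_norm_indicator_le (γ / 2) hK
    refine ⟨ENNReal.ofReal D ^ (2 : ℝ) * M, ENNReal.mul_ne_top (ENNReal.rpow_ne_top_of_nonneg
      (by norm_num) ENNReal.ofReal_ne_top) hMt, fun j => ?_⟩
    filter_upwards [hM j] with t ht
    refine le_trans ?_ (mul_le_mul_right ht _)
    rw [← lintegral_const_mul' _ _ (ENNReal.rpow_ne_top_of_nonneg (by norm_num)
      ENNReal.ofReal_ne_top)]
    refine lintegral_mono fun x => ?_
    rw [← ENNReal.mul_rpow_of_nonneg _ _ (by norm_num)]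
    refine ENNReal.rpow_le_rpow ?_ (by norm_num)
    rw [← ofReal_norm, ← ofReal_norm, ← ENNReal.ofReal_mul hD0]
    exact ENNReal.ofReal_le_ofReal (hD (u j) (t, x))
  · simp only [indicator_mul_of_tsupport_subset h3, indicator_mul_of_tsupport_subset (hs i h3)]
    exact h.gradient i j ψ (htest h1 h2 h3)
  · have e : ∀ z, (∑ i, K.indicator (b i) z * K.indicator (G i j) z) * ψ z =
        (∑ i, b i z * G i j z) * ψ z := fun z => by
      simp only [Finset.sum_mul, mul_assoc, indicator_mul_of_tsupport_subset h3]
      refine Finset.sum_congr rfl fun i _ => ?_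
      rw [mul_left_comm, indicator_mul_of_tsupport_subset h3, mul_left_comm]
    simp only [e, indicator_mul_of_tsupport_subset (hs _ h3),
      indicator_mul_of_tsupport_subset ((tsupport_timeDeriv_subset ψ).trans h3)]
    have := h.momentum j ψ (htest h1 h2 h3)
    simpa using this
  · simp only [indicator_mul_of_tsupport_subset (hs _ h3)]
    exact h.divFree_b ψ (htest h1 h2 h3)
  · simp only [indicator_mul_of_tsupport_subset (hs _ h3)]
    exact h.divFree_u ψ (htest h1 h2 h3)

/-- The local energy equality. -/
theorem energy_equality (h : IsWeightedSolution γ T b (fun _ _ _ => 0) u G p) (hγ : 0 < γ)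
    (hγ2 : γ ≤ 2) (hT : 0 < T) {φ : ℝ × E3 → ℝ} (hφ : IsTestSlab T φ) :
    -(1 / 2 * ∑ j, ∫ z, u j z * (timeDeriv φ z * u j z)) =
      -(∑ j, ∑ i, ∫ z, G i j z * (spaceDeriv i φ z * u j z))
      - (∑ j, ∑ i, ∫ z, G i j z * (φ z * G i j z))
      + 1 / 2 * (∑ j, ∑ i, ∫ z, b i z * u j z * (spaceDeriv i φ z * u j z))
      + ∑ j, ∫ z, p z * (spaceDeriv j φ z * u j z) := by
  obtain ⟨ε, hε, hεT⟩ := hφ.2.1.isCompact.exists_cthickening_subset_open (isOpen_slab T) hφ.2.2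
  have hK : IsCompact (Metric.cthickening ε (tsupport φ)) := hφ.2.1.isCompact.cthickening
  have hφK : tsupport φ ⊆ Metric.cthickening ε (tsupport φ) := Metric.self_subset_cthickening _
  have e := (h.isLocalSolution hγ hγ2 hT hK hεT).energy_equality hφ.1 hφ.2.1 hε le_rfl
  have hm : ∀ {ψ : ℝ × E3 → ℝ}, tsupport ψ ⊆ Metric.cthickening ε (tsupport φ) → ∀ f g z,
      (Metric.cthickening ε (tsupport φ)).indicator f z *
        (ψ z * (Metric.cthickening ε (tsupport φ)).indicator g z) = f z * (ψ z * g z) := by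
    intro ψ hψ f g z
    rw [mul_comm (ψ z), indicator_mul_of_tsupport_subset hψ, mul_left_comm,
      indicator_mul_of_tsupport_subset hψ]
    ring
  have hs := fun i => (tsupport_spaceDeriv_subset i φ).trans hφK
  have hm3 : ∀ i f g z, (Metric.cthickening ε (tsupport φ)).indicator f z *
      (Metric.cthickening ε (tsupport φ)).indicator g z * (spaceDeriv i φ z *
        (Metric.cthickening ε (tsupport φ)).indicator g z) =
      f z * g z * (spaceDeriv i φ z * g z) := by
    intro i f g z
    by_cases hz : z ∈ Metric.cthickening ε (tsupport φ)
    · simp only [indicator_of_mem hz]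
    · rw [image_eq_zero_of_notMem_tsupport fun h' => hz (hs i h'), zero_mul, mul_zero, zero_mul,
        mul_zero]
  simpa only [hm hφK, hm (hs _), hm ((tsupport_timeDeriv_subset φ).trans hφK), hm3] using e

end IsWeightedSolution

end AdvDiff

theorem integral_sq_eq_toReal_lintegral {α : Type*} [MeasurableSpace α] {μ : Measure α} {g : α → ℝ}
    (hg : AEStronglyMeasurable g μ) : ∫ x, g x ^ 2 ∂μ = (∫⁻ x, ‖g x‖ₑ ^ (2 : ℝ) ∂μ).toReal := by
  rw [integral_eq_lintegral_of_nonneg_ae (Eventually.of_forall fun x => sq_nonneg _) (hg.pow 2)]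
  congr 1
  refine lintegral_congr fun x => ?_
  rw [← ofReal_norm, ENNReal.ofReal_rpow_of_nonneg (norm_nonneg _) (by norm_num), Real.rpow_two,
    Real.norm_eq_abs, sq_abs]

namespace AdvDiff

theorem integrable_time_mul_sq {γ : ℝ} {f : ℝ × E3 → ℝ} {η : ℝ → ℝ}
    (hη : Continuous η) {M : ℝ} (hM : ∀ t, ‖η t‖ ≤ M)
    (hf : MemLp (fun z : ℝ × E3 => smoothWeight (γ / 2) z.2 * f z) 2 volume) :
    Integrable fun z : ℝ × E3 => η z.1 * (smoothWeight (γ / 2) z.2 * f z) ^ 2 :=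
  hf.integrable_sq.bdd_mul (c := M) (hη.comp continuous_fst).aestronglyMeasurable
    (Eventually.of_forall fun z => hM z.1)

theorem integral_time_mul_sq {γ : ℝ} {f : ℝ × E3 → ℝ} {η : ℝ → ℝ}
    (hη : Continuous η) {M : ℝ} (hM : ∀ t, ‖η t‖ ≤ M)
    (hf : MemLp (fun z : ℝ × E3 => smoothWeight (γ / 2) z.2 * f z) 2 volume) :
    ∫ z : ℝ × E3, η z.1 * (smoothWeight (γ / 2) z.2 * f z) ^ 2 =
      ∫ t, η t * (wnorm γ 2 f t ^ 2).toReal := by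
  have h1 := integrable_time_mul_sq hη hM hf
  have h2 := hf.1
  rw [Measure.volume_eq_prod] at h1 h2 ⊢
  rw [integral_prod _ h1]
  refine integral_congr_ae ?_
  filter_upwards [h2.prodMk_left] with t ht
  rw [integral_const_mul, wnorm_two_sq, integral_sq_eq_toReal_lintegral ht]

theorem integrable_time_mul_wnorm {γ : ℝ} {f : ℝ × E3 → ℝ} {η : ℝ → ℝ}
    (hη : Continuous η) {M : ℝ} (hM : ∀ t, ‖η t‖ ≤ M)
    (hf : MemLp (fun z : ℝ × E3 => smoothWeight (γ / 2) z.2 * f z) 2 volume) :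
    Integrable fun t => η t * (wnorm γ 2 f t ^ 2).toReal := by
  have h1 := integrable_time_mul_sq hη hM hf
  have h2 := hf.1
  rw [Measure.volume_eq_prod] at h1 h2
  refine h1.integral_prod_left.congr ?_
  filter_upwards [h2.prodMk_left] with t ht
  rw [integral_const_mul, wnorm_two_sq, integral_sq_eq_toReal_lintegral ht]

theorem tendsto_integral_cutWeight {γ : ℝ} {f : ℝ × E3 → ℝ} {η : ℝ → ℝ}
    (hη : Continuous η) {M : ℝ} (hM : ∀ t, ‖η t‖ ≤ M) (hfm : AEStronglyMeasurable f)
    (hf : MemLp (fun z : ℝ × E3 => smoothWeight (γ / 2) z.2 * f z) 2 volume) :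
    Tendsto (fun n => ∫ z : ℝ × E3, f z * (η z.1 * cutWeight γ n z.2 * f z)) atTop
      (𝓝 (∫ t, η t * (wnorm γ 2 f t ^ 2).toReal)) := by
  rw [← integral_time_mul_sq hη hM hf]
  refine tendsto_integral_of_dominated_convergence
    (fun z => M * (smoothWeight (γ / 2) z.2 * f z) ^ 2) (fun n => ?_)
    (hf.integrable_sq.const_mul M) (fun n => Eventually.of_forall fun z => ?_)
    (Eventually.of_forall fun z => ?_)
  · exact hfm.mul ((((hη.comp continuous_fst).mul
      ((contDiff_cutWeight γ n).continuous.comp continuous_snd)).aestronglyMeasurable).mul hfm)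
  · have e : f z * (η z.1 * cutWeight γ n z.2 * f z) = η z.1 * (cutWeight γ n z.2 * f z ^ 2) := by
      ring
    rw [e, norm_mul, mul_pow, sq (smoothWeight _ _), ← smoothWeight_eq_sq,
      Real.norm_of_nonneg (mul_nonneg (cutWeight_nonneg _ _ _) (sq_nonneg _))]
    exact mul_le_mul (hM _) (mul_le_mul_of_nonneg_right (cutWeight_le _ _ _) (sq_nonneg _))
      (mul_nonneg (cutWeight_nonneg _ _ _) (sq_nonneg _)) ((norm_nonneg _).trans (hM z.1))
  · have := ((tendsto_cutWeight γ z.2).const_mul (η z.1)).mul_const (f z) |>.const_mul (f z)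
    refine this.trans_eq ?_
    rw [smoothWeight_eq_sq]
    congr 1
    ring

theorem sum_lintegral_slab {ι : Type*} (s : Finset ι) {g : ι → ℝ × E3 → ℝ≥0∞}
    (hg : ∀ i, AEMeasurable (g i)) :
    ∑ i ∈ s, ∫⁻ z, g i z = ∫⁻ t, ∑ i ∈ s, ∫⁻ x, g i (t, x) := by
  rw [lintegral_finsetSum']
  · exact Finset.sum_congr rfl fun i _ => lintegral_slab (hg i)
  · intro i _
    have := hg i
    rw [Measure.volume_eq_prod] at this
    exact this.lintegral_prod_right'

theorem aemeasurable_sum_lintegral_slice {ι : Type*} (s : Finset ι) {g : ι → ℝ × E3 → ℝ≥0∞}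
    (hg : ∀ i, AEMeasurable (g i)) : AEMeasurable fun t => ∑ i ∈ s, ∫⁻ x, g i (t, x) :=
  Finset.aemeasurable_fun_sum _ fun i _ => by
    have := hg i
    rw [Measure.volume_eq_prod] at this
    exact this.lintegral_prod_right'

theorem enorm_sum_integral_le {α ι : Type*} [MeasurableSpace α] {μ : Measure α} (s : Finset ι)
    (g : ι → α → ℝ) : ‖∑ i ∈ s, ∫ z, g i z ∂μ‖ₑ ≤ ∑ i ∈ s, ∫⁻ z, ‖g i z‖ₑ ∂μ :=
  (enorm_sum_le _ _).trans (Finset.sum_le_sum fun _ _ => enorm_integral_le_lintegral_enorm _)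

theorem energy_young (C e d β E D : ℝ≥0∞) (he : e ^ 2 ≤ 3 * E) (hd : d ^ 2 ≤ 9 * D) (hβ : 1 ≤ β) :
    C * (β * (e + d) * e) ≤ D + (1 + 54 * C ^ 2) * β ^ 2 * E := by
  have h1 : (e + d) ^ 2 / 18 ≤ E + D := by
    refine ENNReal.div_le_of_le_mul ((add_sq_le_two_mul e d).trans ?_)
    calc 2 * (e ^ 2 + d ^ 2) ≤ 2 * (9 * E + 9 * D) := by
          gcongr
          exact he.trans (by gcongr; norm_num)
      _ = (E + D) * 18 := by ring
  have h2 : E ≤ β ^ 2 * E := le_mul_of_one_le_left zero_le (one_le_pow₀ hβ)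
  calc C * (β * (e + d) * e) = C * β * (e + d) * e := by ring
    _ ≤ (e + d) ^ 2 / 18 + 18 * (C * β * e) ^ 2 := ennreal_mul_mul_le _ _ _
    _ ≤ (β ^ 2 * E + D) + 18 * (C ^ 2 * β ^ 2 * (3 * E)) := by
        rw [mul_pow, mul_pow]
        gcongr
        exact h1.trans (by gcongr)
    _ = _ := by ring

namespace IsWeightedSolution

variable {γ T : ℝ} {b : Fin 3 → ℝ × E3 → ℝ}
  {u : Fin 3 → ℝ × E3 → ℝ} {G : Fin 3 → Fin 3 → ℝ × E3 → ℝ} {p : ℝ × E3 → ℝ}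

/-- The error terms in the local energy equality, uniformly in the space cutoff. -/
theorem exists_error_le (h : IsWeightedSolution γ T b (fun _ _ _ => 0) u G p) (hγ : 0 < γ)
    (hγ2 : γ ≤ 2) (hT : 0 < T) : ∃ C : ℝ≥0∞, C ≠ ⊤ ∧ ∀ θ : ℝ → ℝ, Continuous θ →
      tsupport θ ⊆ Ioo 0 T → (∀ t, 0 ≤ θ t) → ∀ n,
      (∑ j, ∑ i, ∫⁻ z : ℝ × E3, ‖G i j z *
        (θ z.1 * fderiv ℝ (cutWeight γ n) z.2 (basisVec i) * u j z)‖ₑ) +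
      (∑ j, ∑ i, ∫⁻ z : ℝ × E3, ‖b i z * u j z *
        (θ z.1 * fderiv ℝ (cutWeight γ n) z.2 (basisVec i) * u j z)‖ₑ) +
      (∑ j, ∫⁻ z : ℝ × E3, ‖p z *
        (θ z.1 * fderiv ℝ (cutWeight γ n) z.2 (basisVec j) * u j z)‖ₑ) ≤
      (∫⁻ t, ENNReal.ofReal (θ t) * dissipation γ G t) +
        ∫⁻ t, ENNReal.ofReal (θ t) * (C * (1 + sliceB γ b t) ^ 2 * energy γ u t) := by
  obtain ⟨C, hCt, hC⟩ := exists_slice_terms_le γ hγ hγ2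
  refine ⟨1 + 54 * C ^ 2, by finiteness, fun θ hθ hθT hθ0 n => ?_⟩
  have hum := fun j => (h.locallyIntegrable_u j).aestronglyMeasurable
  have hGm := fun i j => (h.locallyIntegrable_G i j).aestronglyMeasurable
  have hbm := fun i => (h.locallyIntegrable_b i).aestronglyMeasurable
  have hwm : ∀ i j, AEStronglyMeasurable (fun z : ℝ × E3 =>
      θ z.1 * fderiv ℝ (cutWeight γ n) z.2 (basisVec i) * u j z) := fun i j => by
    refine AEStronglyMeasurable.mul (Continuous.aestronglyMeasurable ?_) (hum j)
    have := (contDiff_cutWeight γ n).continuous_fderiv (by simp)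
    fun_prop
  have m1 : ∀ q : Fin 3 × Fin 3, AEMeasurable fun z : ℝ × E3 => ‖G q.2 q.1 z *
      (θ z.1 * fderiv ℝ (cutWeight γ n) z.2 (basisVec q.2) * u q.1 z)‖ₑ :=
    fun q => ((hGm q.2 q.1).mul (hwm q.2 q.1)).enorm
  have m2 : ∀ q : Fin 3 × Fin 3, AEMeasurable fun z : ℝ × E3 => ‖b q.2 z * u q.1 z *
      (θ z.1 * fderiv ℝ (cutWeight γ n) z.2 (basisVec q.2) * u q.1 z)‖ₑ :=
    fun q => (((hbm q.2).mul (hum q.1)).mul (hwm q.2 q.1)).enorm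
  have m3 : ∀ j : Fin 3, AEMeasurable fun z : ℝ × E3 => ‖p z *
      (θ z.1 * fderiv ℝ (cutWeight γ n) z.2 (basisVec j) * u j z)‖ₑ :=
    fun j => (h.measurable_p.mul (hwm j j)).enorm
  have hθm : AEMeasurable fun t => ENNReal.ofReal (θ t) :=
    (ENNReal.continuous_ofReal.comp hθ).aemeasurable
  have hDm : AEMeasurable fun t => ENNReal.ofReal (θ t) * dissipation γ G t :=
    hθm.mul h.aemeasurable_dissipation
  simp only [← Fintype.sum_prod_type']
  rw [sum_lintegral_slab _ m1, sum_lintegral_slab _ m2, sum_lintegral_slab _ m3,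
    ← lintegral_add_left' (aemeasurable_sum_lintegral_slice _ m1),
    ← lintegral_add_right' _ (aemeasurable_sum_lintegral_slice _ m3), ← lintegral_add_left' hDm]
  refine lintegral_mono_ae ?_
  filter_upwards [hC h hT] with t ht
  have hpull : ∀ f g : ℝ × E3 → ℝ, ∀ i, ∫⁻ x, ‖f (t, x) *
      (θ t * fderiv ℝ (cutWeight γ n) x (basisVec i) * g (t, x))‖ₑ = ENNReal.ofReal (θ t) *
      ∫⁻ x, ‖f (t, x) * (fderiv ℝ (cutWeight γ n) x (basisVec i) * g (t, x))‖ₑ := fun f g i => by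
    rw [← lintegral_const_mul' _ _ ENNReal.ofReal_ne_top]
    refine lintegral_congr fun x => ?_
    rw [← Real.enorm_of_nonneg (hθ0 t), ← enorm_mul]
    congr 1
    ring
  have hpull2 : ∀ i j, ∫⁻ x, ‖b i (t, x) * u j (t, x) *
      (θ t * fderiv ℝ (cutWeight γ n) x (basisVec i) * u j (t, x))‖ₑ = ENNReal.ofReal (θ t) *
      ∫⁻ x, ‖b i (t, x) * u j (t, x) *
        (fderiv ℝ (cutWeight γ n) x (basisVec i) * u j (t, x))‖ₑ :=
    fun i j => hpull (fun z => b i z * u j z) (u j) i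
  simp only [hpull, hpull2, Fintype.sum_prod_type, ← Finset.mul_sum, ← mul_add]
  by_cases htT : t ∈ Ioo 0 T
  · exact mul_le_mul_right ((ht htT n).trans (energy_young _ _ _ _ _ _ (sliceU_sq_le γ u t)
      (sliceG_sq_le γ G t) le_self_add)) _
  · simp [image_eq_zero_of_notMem_tsupport fun h' => htT (hθT h')]

/-- The energy inequality. -/
theorem exists_energy_inequality (h : IsWeightedSolution γ T b (fun _ _ _ => 0) u G p) (hγ : 0 < γ)
    (hγ2 : γ ≤ 2) (hT : 0 < T) : ∃ C : ℝ≥0∞, C ≠ ⊤ ∧ ∀ θ : ℝ → ℝ, ContDiff ℝ ∞ θ →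
      HasCompactSupport θ → tsupport θ ⊆ Ioo 0 T → (∀ t, 0 ≤ θ t) →
      -∫ t, deriv θ t * (energy γ u t).toReal ≤
        2 * (∫⁻ t, ENNReal.ofReal (θ t) * (C * (1 + sliceB γ b t) ^ 2 * energy γ u t)).toReal := by
  obtain ⟨C, hCt, hC⟩ := h.exists_error_le hγ hγ2 hT
  refine ⟨C, hCt, fun θ hθ hθc hθT hθ0 => ?_⟩
  obtain ⟨A, hA⟩ := hθ.continuous.bounded_above_of_compact_support hθc
  have hθ' : Continuous (deriv θ) := hθ.continuous_deriv (by simp)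
  obtain ⟨A', hA'⟩ := hθ'.bounded_above_of_compact_support hθc.deriv
  obtain ⟨M, hMt, hM⟩ := h.exists_energy_le
  have hum := fun j => (h.locallyIntegrable_u j).aestronglyMeasurable
  have hGm := fun i j => (h.locallyIntegrable_G i j).aestronglyMeasurable
  set X := ∫⁻ t, ENNReal.ofReal (θ t) * (C * (1 + sliceB γ b t) ^ 2 * energy γ u t) with hX
  have hXt : X < ⊤ := by
    have hle : ∀ᵐ t, ENNReal.ofReal (θ t) * (C * (1 + sliceB γ b t) ^ 2 * energy γ u t) ≤
        (Ioo 0 T).indicator (fun t => ENNReal.ofReal A * (C * M) * (1 + sliceB γ b t) ^ 2) t := by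
      filter_upwards [hM] with t ht
      by_cases htT : t ∈ Ioo 0 T
      · rw [indicator_of_mem htT]
        calc _ ≤ ENNReal.ofReal A * (C * (1 + sliceB γ b t) ^ 2 * M) := by
              gcongr
              exact (le_abs_self _).trans (hA t)
          _ = _ := by ring
      · simp [image_eq_zero_of_notMem_tsupport fun h' => htT (hθT h')]
    refine (lintegral_mono_ae hle).trans_lt ?_
    rw [lintegral_indicator measurableSet_Ioo, lintegral_const_mul' _ _ (by finiteness)]
    exact ENNReal.mul_lt_top (by finiteness) h.lintegral_sliceB_lt_top
  set Y := ∫⁻ t, ENNReal.ofReal (θ t) * dissipation γ G t with hY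
  have hYt : Y < ⊤ := by
    refine lt_of_le_of_lt (lintegral_mono fun t => mul_le_mul_left (ENNReal.ofReal_le_ofReal
      ((le_abs_self _).trans (hA t))) _) ?_
    rw [lintegral_const_mul' _ _ ENNReal.ofReal_ne_top]
    exact ENNReal.mul_lt_top ENNReal.ofReal_lt_top h.lintegral_dissipation_lt_top
  have hwt : ∀ {f : ℝ × E3 → ℝ}, MemLp (fun z : ℝ × E3 => smoothWeight (γ / 2) z.2 * f z) 2 volume →
      ∀ᵐ t, wnorm γ 2 f t ^ 2 ≠ ⊤ := fun {f} hf => by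
    have := lintegral_wnorm_rpow_lt_top (by norm_num) (by norm_num) hf
    simp only [ENNReal.toReal_ofNat, ENNReal.rpow_two] at this
    filter_upwards [ae_lt_top' ((aemeasurable_wnorm (by norm_num) (by norm_num) hf.1).pow_const 2)
      this.ne] with t ht using ht.ne
  have hYe : ∑ j, ∑ i, ∫ t, θ t * (wnorm γ 2 (G i j) t ^ 2).toReal = Y.toReal := by
    simp only [← Fintype.sum_prod_type']
    rw [← integral_finsetSum _ fun q _ =>
      integrable_time_mul_wnorm hθ.continuous hA (h.memLp_G q.2 q.1), hY, ← integral_toReal]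
    · refine integral_congr_ae ?_
      filter_upwards [ae_all_iff.2 fun i => ae_all_iff.2 fun j => hwt (h.memLp_G i j)] with t ht
      rw [ENNReal.toReal_mul, ENNReal.toReal_ofReal (hθ0 t), ← Finset.mul_sum, dissipation,
        ← Fintype.sum_prod_type', ENNReal.toReal_sum fun q _ => ht q.2 q.1]
    · exact ((ENNReal.continuous_ofReal.comp hθ.continuous).aemeasurable).mul
        h.aemeasurable_dissipation
    · exact ae_lt_top' (((ENNReal.continuous_ofReal.comp hθ.continuous).aemeasurable).mul
        h.aemeasurable_dissipation) hYt.ne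
  have hEe : ∑ j, ∫ t, deriv θ t * (wnorm γ 2 (u j) t ^ 2).toReal =
      ∫ t, deriv θ t * (energy γ u t).toReal := by
    rw [← integral_finsetSum _ fun j _ => integrable_time_mul_wnorm hθ' hA' (h.memLp_u j)]
    refine integral_congr_ae ?_
    filter_upwards [ae_all_iff.2 fun j => hwt (h.memLp_u j)] with t ht
    rw [← Finset.mul_sum, energy, ENNReal.toReal_sum fun j _ => ht j]
  have hlimL : Tendsto (fun n => ∑ j, ∫ z : ℝ × E3,
      u j z * (deriv θ z.1 * cutWeight γ n z.2 * u j z)) atTop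
      (𝓝 (∫ t, deriv θ t * (energy γ u t).toReal)) := by
    rw [← hEe]
    exact tendsto_finsetSum _ fun j _ => tendsto_integral_cutWeight hθ' hA' (hum j) (h.memLp_u j)
  have hlimR : Tendsto (fun n => ∑ j, ∑ i, ∫ z : ℝ × E3,
      G i j z * (θ z.1 * cutWeight γ n z.2 * G i j z)) atTop (𝓝 Y.toReal) := by
    rw [← hYe]
    exact tendsto_finsetSum _ fun j _ => tendsto_finsetSum _ fun i _ =>
      tendsto_integral_cutWeight hθ.continuous hA (hGm i j) (h.memLp_G i j)
  have hlim := (hlimL.const_mul (1 / 2)).neg.add hlimR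
  have hbound : ∀ n, -(1 / 2 * ∑ j, ∫ z : ℝ × E3,
      u j z * (deriv θ z.1 * cutWeight γ n z.2 * u j z)) + (∑ j, ∑ i, ∫ z : ℝ × E3,
      G i j z * (θ z.1 * cutWeight γ n z.2 * G i j z)) ≤ Y.toReal + X.toReal := by
    intro n
    have e := h.energy_equality hγ hγ2 hT
      (isTestSlab_time_mul_space hθ hθc hθT (contDiff_cutWeight γ n) (hasCompactSupport_cutWeight γ n))
    simp only [spaceDeriv_time_mul_space hθ (contDiff_cutWeight γ n),
      timeDeriv_time_mul_space hθ (contDiff_cutWeight γ n)] at e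
    have hR := hC θ hθ.continuous hθT hθ0 n
    simp only [← Fintype.sum_prod_type'] at e hR ⊢
    rw [e]
    have b1 := enorm_sum_integral_le Finset.univ (μ := (volume : Measure (ℝ × E3)))
      fun (q : Fin 3 × Fin 3) z => G q.2 q.1 z *
        (θ z.1 * fderiv ℝ (cutWeight γ n) z.2 (basisVec q.2) * u q.1 z)
    have b2 := enorm_sum_integral_le Finset.univ (μ := (volume : Measure (ℝ × E3)))
      fun (q : Fin 3 × Fin 3) z => b q.2 z * u q.1 z *
        (θ z.1 * fderiv ℝ (cutWeight γ n) z.2 (basisVec q.2) * u q.1 z)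
    have b3 := enorm_sum_integral_le Finset.univ (μ := (volume : Measure (ℝ × E3)))
      fun (j : Fin 3) z => p z *
        (θ z.1 * fderiv ℝ (cutWeight γ n) z.2 (basisVec j) * u j z)
    have hsum := ((add_le_add (add_le_add b1 b2) b3).trans hR)
    have hreal := ENNReal.toReal_mono (ENNReal.add_lt_top.2 ⟨hYt, hXt⟩).ne hsum
    rw [ENNReal.toReal_add hYt.ne hXt.ne, ENNReal.toReal_add (by finiteness) (by finiteness),
      ENNReal.toReal_add (by finiteness) (by finiteness), toReal_enorm, toReal_enorm,
      toReal_enorm, Real.norm_eq_abs, Real.norm_eq_abs, Real.norm_eq_abs] at hreal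
    refine le_trans ?_ hreal
    have a1 := neg_abs_le (∑ q : Fin 3 × Fin 3, ∫ z : ℝ × E3, G q.2 q.1 z *
        (θ z.1 * fderiv ℝ (cutWeight γ n) z.2 (basisVec q.2) * u q.1 z))
    have a2 := le_abs_self (∑ q : Fin 3 × Fin 3, ∫ z : ℝ × E3, b q.2 z * u q.1 z *
        (θ z.1 * fderiv ℝ (cutWeight γ n) z.2 (basisVec q.2) * u q.1 z))
    have a2' := abs_nonneg (∑ q : Fin 3 × Fin 3, ∫ z : ℝ × E3, b q.2 z * u q.1 z *
        (θ z.1 * fderiv ℝ (cutWeight γ n) z.2 (basisVec q.2) * u q.1 z))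
    have a3 := le_abs_self (∑ j : Fin 3, ∫ z : ℝ × E3, p z *
        (θ z.1 * fderiv ℝ (cutWeight γ n) z.2 (basisVec j) * u j z))
    linarith
  have := le_of_tendsto' hlim hbound
  linarith

end IsWeightedSolution

end AdvDiff

theorem moll_indicator_Ioc (k : ℕ) {s t : ℝ} (hst : s ≤ t) (r : ℝ) :
    moll k ((Ioc s t).indicator 1) r = ∫ y in (r - t)..(r - s), mollifier k y := by
  rw [← intervalIntegral.integral_comp_sub_left, intervalIntegral.integral_of_le hst,
    ← integral_indicator measurableSet_Ioc, moll]
  refine integral_congr_ae (Eventually.of_forall fun y => ?_)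
  by_cases hy : y ∈ Ioc s t <;> simp [hy]

theorem integrable_indicator_Ioc (s t : ℝ) : Integrable ((Ioc s t).indicator (1 : ℝ → ℝ)) :=
  (integrable_indicator_iff measurableSet_Ioc).2 (integrableOn_const (by simp))

theorem deriv_moll_indicator_Ioc (k : ℕ) {s t : ℝ} (hst : s ≤ t) (r : ℝ) :
    deriv (moll k ((Ioc s t).indicator (1 : ℝ → ℝ))) r = mollifier k (r - s) - mollifier k (r - t) := by
  have hc : Continuous (mollifier k : ℝ → ℝ) := continuous_mollifier k
  have e : moll k ((Ioc s t).indicator (1 : ℝ → ℝ)) = fun r =>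
      (∫ y in (0 : ℝ)..(r - s), mollifier k y) - ∫ y in (0 : ℝ)..(r - t), mollifier k y := by
    ext r
    rw [moll_indicator_Ioc k hst, intervalIntegral.integral_interval_sub_left]
    · exact hc.intervalIntegrable _ _
    · exact hc.intervalIntegrable _ _
  have h1 : ∀ c, HasDerivAt (fun r => ∫ y in (0 : ℝ)..(r - c), mollifier k y)
      (mollifier k (r - c)) r := fun c => (hc.integral_hasStrictDerivAt 0 (r - c)).hasDerivAt.comp_sub_const r c
  rw [e]
  exact ((h1 s).sub (h1 t)).deriv

theorem moll_indicator_Ioc_nonneg (k : ℕ) (s t r : ℝ) :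
    0 ≤ moll k ((Ioc s t).indicator (1 : ℝ → ℝ)) r :=
  integral_nonneg fun _ => mul_nonneg (indicator_nonneg (fun _ _ => zero_le_one) _)
    (mollifier_nonneg _ _)

theorem moll_indicator_Ioc_le_one (k : ℕ) {s t : ℝ} (hst : s ≤ t) (r : ℝ) :
    moll k ((Ioc s t).indicator (1 : ℝ → ℝ)) r ≤ 1 := by
  rw [moll_indicator_Ioc k hst, intervalIntegral.integral_of_le (by linarith),
    ← integral_mollifier (V := ℝ) k]
  exact setIntegral_le_integral (integrable_mollifier k)
    (Eventually.of_forall fun z => mollifier_nonneg k z)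

theorem moll_indicator_Ioc_eq_zero (k : ℕ) {s t r : ℝ}
    (hr : r ∉ Icc (s - 1 / ((k : ℝ) + 1)) (t + 1 / ((k : ℝ) + 1))) :
    moll k ((Ioc s t).indicator (1 : ℝ → ℝ)) r = 0 := by
  have : ∀ y, (Ioc s t).indicator (1 : ℝ → ℝ) y * mollifier k (r - y) = 0 := fun y => by
    by_cases hy : y ∈ Ioc s t
    · rw [mollifier_eq_zero, mul_zero]
      rw [Real.norm_eq_abs]
      by_contra! hlt
      rw [abs_lt] at hlt
      exact hr ⟨by linarith [hy.1], by linarith [hy.2]⟩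
    · rw [indicator_of_notMem hy, zero_mul]
  simp [moll, this]

theorem tsupport_moll_indicator_Ioc_subset (k : ℕ) (s t : ℝ) :
    tsupport (moll k ((Ioc s t).indicator (1 : ℝ → ℝ))) ⊆
      Icc (s - 1 / ((k : ℝ) + 1)) (t + 1 / ((k : ℝ) + 1)) :=
  closure_minimal (fun _ hr => by_contra fun h => hr (moll_indicator_Ioc_eq_zero k h)) isClosed_Icc

theorem frequently_nhdsGT_of_ae {P : ℝ → Prop} (h : ∀ᵐ s, P s) (x : ℝ) : ∃ᶠ s in 𝓝[>] x, P s := by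
  intro hn
  obtain ⟨y, hy, hsub⟩ := mem_nhdsGT_iff_exists_Ioo_subset.1 hn
  have h0 : volume (Ioo x y) = 0 := measure_mono_null hsub (by simpa [ae_iff] using h)
  rw [Real.volume_Ioo, ENNReal.ofReal_eq_zero] at h0
  have : x < y := hy
  linarith

section Gronwall

variable {T : ℝ} {E a : ℝ → ℝ≥0∞} {M : ℝ≥0∞}

theorem memLp_two_indicator_toReal (hE : AEMeasurable E) (hM : M ≠ ⊤) (hEM : ∀ᵐ t, E t ≤ M) :
    MemLp ((Ioo 0 T).indicator fun t => (E t).toReal) 2 volume := by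
  rw [memLp_indicator_iff_restrict measurableSet_Ioo]
  refine MemLp.of_bound hE.ennreal_toReal.aestronglyMeasurable.restrict M.toReal ?_
  refine ae_restrict_of_ae ?_
  filter_upwards [hEM] with t ht
  rw [Real.norm_of_nonneg ENNReal.toReal_nonneg]
  exact ENNReal.toReal_mono hM ht

theorem moll_sub_moll_le (hineq : ∀ θ : ℝ → ℝ, ContDiff ℝ ∞ θ → HasCompactSupport θ →
      tsupport θ ⊆ Ioo 0 T → (∀ t, 0 ≤ θ t) →
      -∫ t, deriv θ t * (E t).toReal ≤ (∫⁻ t, ENNReal.ofReal (θ t) * (a t * E t)).toReal)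
    (hE : AEMeasurable E) (hM : M ≠ ⊤) (hEM : ∀ᵐ t, E t ≤ M)
    {s t t₁ : ℝ} (hst : s ≤ t) (ht₁ : t₁ < T) {k : ℕ} (hs : 1 / ((k : ℝ) + 1) < s)
    (ht : 1 / ((k : ℝ) + 1) < t₁ - t) (hfin : ∫⁻ r in Ioo 0 t₁, a r * E r ≠ ⊤) :
    moll k ((Ioo 0 T).indicator fun t => (E t).toReal) t -
      moll k ((Ioo 0 T).indicator fun t => (E t).toReal) s ≤
      (∫⁻ r in Ioo 0 t₁, a r * E r).toReal := by
  set g := (Ioo 0 T).indicator fun t => (E t).toReal with hg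
  have hsupp : Icc (s - 1 / ((k : ℝ) + 1)) (t + 1 / ((k : ℝ) + 1)) ⊆ Ioo 0 t₁ := fun r hr =>
    ⟨by linarith [hr.1], by linarith [hr.2]⟩
  have hsub := (tsupport_moll_indicator_Ioc_subset k s t).trans hsupp
  have hT : Ioo 0 t₁ ⊆ Ioo 0 T := Ioo_subset_Ioo_right ht₁.le
  have hsm := contDiff_moll k (integrable_indicator_Ioc s t).locallyIntegrable
  have h := hineq _ hsm (HasCompactSupport.of_support_subset_isCompact isCompact_Icc
    ((subset_tsupport _).trans (tsupport_moll_indicator_Ioc_subset k s t))) (hsub.trans hT)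
    (moll_indicator_Ioc_nonneg k s t)
  have hgi : Integrable g := ((integrable_indicator_iff measurableSet_Ioo).2
    (((memLp_indicator_iff_restrict measurableSet_Ioo).1
      (memLp_two_indicator_toReal hE hM hEM)).integrable (by norm_num)))
  obtain ⟨C, hC⟩ := exists_mollifier_le (V := ℝ) k
  have hint : ∀ x, Integrable fun r => g r * mollifier k (x - r) := fun x =>
    hgi.mul_bdd (c := C) ((continuous_mollifier k).comp (by fun_prop)).aestronglyMeasurable
      (Eventually.of_forall fun r => hC _)
  have e : -∫ r, deriv (moll k ((Ioc s t).indicator (1 : ℝ → ℝ))) r * (E r).toReal =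
      moll k g t - moll k g s := by
    rw [moll, moll, ← integral_sub (hint t) (hint s), ← integral_neg]
    refine integral_congr_ae (Eventually.of_forall fun r => ?_)
    simp only
    by_cases hr : r ∈ Ioo 0 T
    · rw [deriv_moll_indicator_Ioc k hst, hg, indicator_of_mem hr, mollifier_sub_comm k t,
        mollifier_sub_comm k s]
      ring
    · rw [hg, indicator_of_notMem hr, image_eq_zero_of_notMem_tsupport fun h' =>
        hr (hT (hsub (closure_minimal support_deriv_subset (isClosed_tsupport _) h')))]
      simp
  rw [← e]
  refine h.trans (ENNReal.toReal_mono hfin ?_)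
  rw [← lintegral_indicator measurableSet_Ioo]
  refine lintegral_mono fun r => ?_
  by_cases hr : r ∈ Ioo 0 t₁
  · rw [indicator_of_mem hr]
    exact mul_le_of_le_one_left zero_le (ENNReal.ofReal_le_one.2 (moll_indicator_Ioc_le_one k hst r))
  · simp [image_eq_zero_of_notMem_tsupport fun h' => hr (hsub h')]

theorem ae_le_lintegral_of_weak_inequality (hineq : ∀ θ : ℝ → ℝ, ContDiff ℝ ∞ θ →
      HasCompactSupport θ → tsupport θ ⊆ Ioo 0 T → (∀ t, 0 ≤ θ t) →
      -∫ t, deriv θ t * (E t).toReal ≤ (∫⁻ t, ENNReal.ofReal (θ t) * (a t * E t)).toReal)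
    (hE : AEMeasurable E) (hM : M ≠ ⊤) (hEM : ∀ᵐ t, E t ≤ M) (hE0 : Tendsto E (𝓝[>] 0) (𝓝 0))
    (hfin : ∫⁻ r in Ioo 0 T, a r * E r ≠ ⊤) {t₁ : ℝ} (ht₁ : t₁ < T) :
    ∀ᵐ t, t ∈ Ioo 0 t₁ → E t ≤ ∫⁻ r in Ioo 0 t₁, a r * E r := by
  set g := (Ioo 0 T).indicator fun t => (E t).toReal with hg
  have hg2 : MemLp g 2 volume := memLp_two_indicator_toReal hE hM hEM
  have hfin' : ∫⁻ r in Ioo 0 t₁, a r * E r ≠ ⊤ := ne_top_of_le_ne_top hfin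
    (lintegral_mono_set (Ioo_subset_Ioo_right ht₁.le))
  obtain ⟨ns, hns, hlim⟩ := (tendstoInMeasure_of_tendsto_eLpNorm (by norm_num)
    (fun k => (contDiff_moll k (hg2.locallyIntegrable (by norm_num))).continuous.aestronglyMeasurable)
    hg2.1 (tendsto_eLpNorm_moll_sub hg2)).exists_seq_tendsto_ae
  have hsmall : ∀ ε : ℝ, 0 < ε → ∀ᶠ k in atTop, 1 / ((ns k : ℝ) + 1) < ε := fun ε hε =>
    (tendsto_one_div_add_atTop_nhds_zero_nat.comp hns.tendsto_atTop).eventually_lt_const hε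
  have hgE : Tendsto g (𝓝[>] 0) (𝓝 0) := by
    have h1 : Tendsto (fun t => (E t).toReal) (𝓝[>] 0) (𝓝 0) := by
      have := (ENNReal.tendsto_toReal ENNReal.zero_ne_top).comp hE0
      rwa [ENNReal.toReal_zero] at this
    refine squeeze_zero (fun t => indicator_nonneg (fun _ _ => ENNReal.toReal_nonneg) _)
      (fun t => ?_) h1
    exact indicator_le_self' (fun _ _ => ENNReal.toReal_nonneg) _
  filter_upwards [hlim, hEM] with t ht htM htt
  have hle : ∃ᶠ s in 𝓝[>] 0, g t ≤ g s + (∫⁻ r in Ioo 0 t₁, a r * E r).toReal := by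
    have hev : ∀ᶠ s in 𝓝[>] (0 : ℝ), s ∈ Ioo 0 t := Ioo_mem_nhdsGT htt.1
    refine ((frequently_nhdsGT_of_ae hlim 0).and_eventually hev).mono fun s ⟨hs, hst⟩ => ?_
    rw [← sub_le_iff_le_add']
    refine le_of_tendsto (ht.sub hs) ?_
    filter_upwards [hsmall s hst.1, hsmall (t₁ - t) (sub_pos.2 htt.2)] with k h1 h2
    exact moll_sub_moll_le hineq hE hM hEM hst.2.le ht₁ h1 h2 hfin'
  have h1 := ge_of_tendsto_of_frequently (hgE.add_const _) hle
  rw [zero_add, hg, indicator_of_mem (Ioo_subset_Ioo_right ht₁.le htt)] at h1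
  exact (ENNReal.toReal_le_toReal (ne_top_of_le_ne_top hM htM) hfin').1 h1

/-- A Gronwall lemma: a bounded function satisfying `E' ≤ a E` in the sense of distributions, with
`a` integrable and `E → 0` at the origin, vanishes. -/
theorem ae_eq_zero_of_weak_gronwall (hineq : ∀ θ : ℝ → ℝ, ContDiff ℝ ∞ θ →
      HasCompactSupport θ → tsupport θ ⊆ Ioo 0 T → (∀ t, 0 ≤ θ t) →
      -∫ t, deriv θ t * (E t).toReal ≤ (∫⁻ t, ENNReal.ofReal (θ t) * (a t * E t)).toReal)
    (hE : AEMeasurable E) (hM : M ≠ ⊤) (hEM : ∀ᵐ t, E t ≤ M) (hE0 : Tendsto E (𝓝[>] 0) (𝓝 0))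
    (ha : ∫⁻ r in Ioo 0 T, a r ≠ ⊤) : ∀ᵐ t, t ∈ Ioo 0 T → E t = 0 := by
  have hfin : ∫⁻ r in Ioo 0 T, a r * E r ≠ ⊤ := by
    refine ne_top_of_le_ne_top (ENNReal.mul_ne_top ha hM) ?_
    rw [← lintegral_mul_const' _ _ hM]
    refine lintegral_mono_ae (ae_restrict_of_ae ?_)
    filter_upwards [hEM] with t ht
    gcongr
  have key := fun t₁ (ht₁ : t₁ < T) =>
    ae_le_lintegral_of_weak_inequality hineq hE hM hEM hE0 hfin ht₁
  obtain ⟨δ, hδ, hδa⟩ := exists_pos_setLIntegral_lt_of_measure_lt ha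
    (ε := 1 / 2) (by norm_num)
  obtain ⟨η, hη, hηδ⟩ : ∃ η : ℝ, 0 < η ∧ ENNReal.ofReal η < δ := by
    obtain ⟨q, hq0, hq⟩ := ENNReal.lt_iff_exists_nnreal_btwn.1 hδ
    exact ⟨q, by exact_mod_cast hq0, by simpa using hq⟩
  have step : ∀ t₀ t₁, t₁ < T → t₁ - t₀ ≤ η → ∫⁻ r in Ioo 0 t₀, a r * E r = 0 →
      ∫⁻ r in Ioo 0 t₁, a r * E r = 0 := by
    intro t₀ t₁ ht₁ h01 h0
    have hsub : Ioo 0 t₁ ⊆ Ioo 0 t₀ ∪ (Ico t₀ t₁ ∩ Ioo 0 T) := fun r hr => by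
      rcases lt_or_ge r t₀ with h | h
      · exact Or.inl ⟨hr.1, h⟩
      · exact Or.inr ⟨⟨h, hr.2⟩, hr.1, hr.2.trans ht₁⟩
    have hne : ∫⁻ r in Ioo 0 t₁, a r * E r ≠ ⊤ := ne_top_of_le_ne_top hfin
      (lintegral_mono_set (Ioo_subset_Ioo_right ht₁.le))
    have hhalf : ∫⁻ r in Ioo 0 t₁, a r * E r ≤ 1 / 2 * ∫⁻ r in Ioo 0 t₁, a r * E r := by
      calc ∫⁻ r in Ioo 0 t₁, a r * E r
          ≤ (∫⁻ r in Ioo 0 t₀, a r * E r) + ∫⁻ r in Ico t₀ t₁ ∩ Ioo 0 T, a r * E r :=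
            (lintegral_mono_set hsub).trans (lintegral_union_le _ _ _)
        _ ≤ ∫⁻ r in Ico t₀ t₁ ∩ Ioo 0 T, a r * ∫⁻ r in Ioo 0 t₁, a r * E r := by
            rw [h0, zero_add]
            refine lintegral_mono_ae ?_
            filter_upwards [ae_restrict_of_ae (key t₁ ht₁),
              ae_restrict_mem (measurableSet_Ico.inter measurableSet_Ioo)] with r hr hmem
            gcongr
            exact hr ⟨hmem.2.1, hmem.1.2⟩
        _ ≤ _ := by
            rw [lintegral_mul_const' _ _ hne]
            gcongr
            have := hδa (Ico t₀ t₁) (by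
              refine (Measure.restrict_apply_le _ _).trans_lt ?_
              rw [Real.volume_Ico]
              exact (ENNReal.ofReal_le_ofReal h01).trans_lt hηδ)
            rw [Measure.restrict_restrict measurableSet_Ico] at this
            exact this.le
    by_contra hpos
    have : 1 / 2 * ∫⁻ r in Ioo 0 t₁, a r * E r < ∫⁻ r in Ioo 0 t₁, a r * E r := by
      rw [one_div, mul_comm, ← div_eq_mul_inv]
      exact ENNReal.half_lt_self hpos hne
    exact absurd hhalf (not_le.2 this)
  have hzero : ∀ t₁ < T, ∫⁻ r in Ioo 0 t₁, a r * E r = 0 := by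
    intro t₁ ht₁
    have hind : ∀ n : ℕ, ∫⁻ r in Ioo 0 (min (n * η) t₁), a r * E r = 0 := by
      intro n
      induction n with
      | zero =>
        rw [Ioo_eq_empty (by simp), Measure.restrict_empty, lintegral_zero_measure]
      | succ n ih =>
        refine step _ _ ((min_le_right _ _).trans_lt ht₁) ?_ ih
        push_cast
        rcases le_total ((n : ℝ) * η) t₁ with h | h
        · rw [min_eq_left h]
          linarith [min_le_left (((n : ℝ) + 1) * η) t₁]
        · rw [min_eq_right h]
          linarith [min_le_right (((n : ℝ) + 1) * η) t₁]
    obtain ⟨n, hn⟩ := exists_nat_ge (t₁ / η)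
    have := hind n
    rwa [min_eq_right ((div_le_iff₀ hη).1 hn)] at this
  obtain ⟨τ, -, hτT, hτ⟩ := exists_seq_strictMono_tendsto T
  filter_upwards [ae_all_iff.2 fun n => key (τ n) (hτT n)] with t ht htT
  obtain ⟨n, hn⟩ := (hτ.eventually (lt_mem_nhds htT.2)).exists
  have := ht n ⟨htT.1, hn⟩
  rw [hzero _ (hτT n)] at this
  exact le_zero_iff.1 this

end Gronwall

namespace AdvDiff

theorem absolutelyContinuous_weightedVolume (δ : ℝ) :
    (volume : Measure E3) ≪ weightedVolume δ := by
  have hc : Continuous (weight δ) := continuous_const.div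
    ((continuous_const.add continuous_norm).rpow_const fun x =>
      Or.inl (show 1 + ‖x‖ ≠ 0 by positivity))
    fun x => by positivity
  refine withDensity_absolutelyContinuous'
    (ENNReal.continuous_ofReal.comp hc).aemeasurable (Eventually.of_forall fun x => ?_)
  have : 0 < weight δ x := by unfold weight; positivity
  exact (ENNReal.ofReal_pos.2 this).ne'

theorem integrable_inner_of_memLp_two {μ : Measure E3} {f g : E3 → E3} (hf : MemLp f 2 μ)
    (hg : MemLp g 2 μ) : Integrable (fun x => inner ℝ (f x) (g x)) μ :=
  (hf.norm.integrable_mul hg.norm).mono' (hf.1.inner hg.1)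
    (Eventually.of_forall fun _ => norm_inner_le_norm _ _)

theorem wnorm_two_le {γ : ℝ} (hγ : 0 < γ) {f : ℝ × E3 → ℝ} {v : E3 → E3} {t : ℝ}
    (hf : ∀ x, ‖f (t, x)‖ ≤ ‖v x‖) :
    wnorm γ 2 f t ≤ ENNReal.ofReal (2 ^ γ) ^ (1 / 2 : ℝ) * eLpNorm v 2 (weightedVolume γ) := by
  have := eLpNorm_smoothWeight_mul_le (r := 2) (by norm_num) (by norm_num) hγ.le
    (f := fun x => f (t, x)) (g := v) hf
  rwa [ENNReal.toReal_ofNat] at this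

theorem energy_cut_sub_le {γ T : ℝ} (hγ : 0 < γ) (u₁ u₂ : ℝ → E3 → E3) {t : ℝ} (ht : t ∈ Ioo 0 T) :
    energy γ (fun j z => cut T (fun z => u₁ z.1 z.2 j) z - cut T (fun z => u₂ z.1 z.2 j) z) t ≤
      3 * (ENNReal.ofReal (2 ^ γ) ^ (1 / 2 : ℝ) *
        eLpNorm (fun x => u₁ t x - u₂ t x) 2 (weightedVolume γ)) ^ 2 := by
  refine sum_fin_three_le fun j => ?_
  gcongr
  refine wnorm_two_le hγ fun x => ?_
  simp only [cut_slice_of_mem ht]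
  exact norm_coord_le (u₁ t x - u₂ t x) j

section Uniqueness

variable {γ T : ℝ} {u₀ : E3 → E3} {F : ℝ → E3 → Fin 3 → Fin 3 → ℝ}
  {b u₁ u₂ : ℝ → E3 → E3} {p₁ p₂ : ℝ → E3 → ℝ}

theorem tendsto_energy_sub (hγ : 0 < γ) (hT : 0 < T) (hu₀ : MemLp u₀ 2 (weightedVolume γ))
    (h₁ : IsSolution γ T u₀ F b u₁ p₁) (h₂ : IsSolution γ T u₀ F b u₂ p₂) :
    Tendsto (energy γ fun j z =>
      cut T (fun z => u₁ z.1 z.2 j) z - cut T (fun z => u₂ z.1 z.2 j) z) (𝓝[>] 0) (𝓝 0) := by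
  have hlim : Tendsto (fun t => 3 * (ENNReal.ofReal (2 ^ γ) ^ (1 / 2 : ℝ) *
      (eLpNorm (fun x => u₁ t x - u₀ x) 2 (weightedVolume γ) +
        eLpNorm (fun x => u₂ t x - u₀ x) 2 (weightedVolume γ))) ^ 2) (𝓝[>] 0) (𝓝 0) := by
    have h := h₁.strongContinuousAtZero.add h₂.strongContinuousAtZero
    have hc : ENNReal.ofReal (2 ^ γ) ^ (1 / 2 : ℝ) ≠ ⊤ :=
      ENNReal.rpow_ne_top_of_nonneg (by norm_num) ENNReal.ofReal_ne_top
    have h' := ENNReal.Tendsto.const_mul ((ENNReal.continuous_pow 2).tendsto _ |>.comp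
      (ENNReal.Tendsto.const_mul h (Or.inr hc))) (Or.inr (by norm_num : (3 : ℝ≥0∞) ≠ ⊤))
    simpa using h'
  refine tendsto_of_tendsto_of_tendsto_of_le_of_le' tendsto_const_nhds hlim
    (Eventually.of_forall fun _ => zero_le) ?_
  filter_upwards [Ioo_mem_nhdsGT hT] with t ht
  refine (energy_cut_sub_le hγ u₁ u₂ ht).trans ?_
  gcongr
  have hm : ∀ {v : ℝ → E3 → E3}, WeaklyContinuousL2 γ T v →
      AEStronglyMeasurable (fun x => v t x - u₀ x) (weightedVolume γ) := fun hv =>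
    (hv.1 t ⟨ht.1.le, ht.2⟩).1.sub hu₀.1
  have e : (fun x => u₁ t x - u₂ t x) = (fun x => u₁ t x - u₀ x) - fun x => u₂ t x - u₀ x := by
    ext x
    simp
  rw [e]
  exact eLpNorm_sub_le (hm h₁.weaklyContinuous) (hm h₂.weaklyContinuous) (by norm_num)

theorem ae_slice_eq (hγ : 0 < γ) (hγ2 : γ ≤ 2) (hT : 0 < T) (hu₀ : MemLp u₀ 2 (weightedVolume γ))
    (hF : ∀ i j, MemLqLr T 2 2 (weightedVolume γ) (fun t x => F t x i j))
    (hb : MemLqLr T 3 3 (weightedVolume (3 * γ / 2)) b) (hbdiv : DivFreeSlab T b)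
    (hbloc : MemLocL2LInfty T b)
    (h₁ : IsSolution γ T u₀ F b u₁ p₁) (h₂ : IsSolution γ T u₀ F b u₂ p₂) :
    ∀ᵐ t, t ∈ Ioo 0 T → u₁ t =ᵐ[volume] u₂ t := by
  obtain ⟨G₁, hG₁⟩ := h₁.exists_isWeightedSolution hγ hF hb hbdiv hbloc
  obtain ⟨G₂, hG₂⟩ := h₂.exists_isWeightedSolution hγ hF hb hbdiv hbloc
  have h := hG₁.sub hG₂
  obtain ⟨C, hCt, hC⟩ := h.exists_energy_inequality hγ hγ2 hT
  obtain ⟨M, hMt, hM⟩ := h.exists_energy_le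
  have hzero := ae_eq_zero_of_weak_gronwall (T := T)
    (a := fun t => 2 * (C * (1 + sliceB γ (fun i => cut T fun z => b z.1 z.2 i) t) ^ 2))
    (fun θ h1 h2 h3 h4 => by
      refine (hC θ h1 h2 h3 h4).trans_eq ?_
      rw [← ENNReal.toReal_ofNat, ← ENNReal.toReal_mul,
        ← lintegral_const_mul' _ _ (by norm_num)]
      congr 1
      refine lintegral_congr fun t => ?_
      ring)
    h.aemeasurable_energy hMt hM (tendsto_energy_sub hγ hT hu₀ h₁ h₂) (by
      rw [lintegral_const_mul' _ _ (by norm_num), lintegral_const_mul' _ _ hCt]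
      exact (ENNReal.mul_lt_top (by norm_num)
        (ENNReal.mul_lt_top hCt.lt_top h.lintegral_sliceB_lt_top)).ne)
  filter_upwards [hzero, h.ae_slice_measurable] with t ht hm htT
  have hj : ∀ j, ∀ᵐ x : E3, u₁ t x j = u₂ t x j := fun j => by
    have h0 := (Finset.sum_eq_zero_iff.1 (ht htT)) j (Finset.mem_univ j)
    rw [sq_eq_zero_iff] at h0
    have h1 := (eLpNorm_eq_zero_iff ((continuous_smoothWeight _).aestronglyMeasurable.mul (hm.1 j))
      (by norm_num)).1 h0
    filter_upwards [h1] with x hx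
    simp only [Pi.mul_apply, cut_slice_of_mem htT] at hx
    exact sub_eq_zero.1 ((mul_eq_zero.1 hx).resolve_left (smoothWeight_pos _ _).ne')
  filter_upwards [ae_all_iff.2 hj] with x hx
  ext j
  exact hx j

theorem slice_eq_of_ae_slice_eq (hu₁ : WeaklyContinuousL2 γ T u₁) (hu₂ : WeaklyContinuousL2 γ T u₂)
    (h : ∀ᵐ t, t ∈ Ioo 0 T → u₁ t =ᵐ[volume] u₂ t) {t : ℝ} (ht : t ∈ Ico 0 T) :
    u₁ t =ᵐ[volume] u₂ t := by
  have hm1 := hu₁.1 t ht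
  have hm2 := hu₂.1 t ht
  have hg : MemLp (fun x => u₁ t x - u₂ t x) 2 (weightedVolume γ) := hm1.sub hm2
  have hac : weightedVolume γ ≪ volume := withDensity_absolutelyContinuous _ _
  have hmem : ∀ᶠ s in 𝓝[>] t, s ∈ Ioo t T := Ioo_mem_nhdsGT ht.2
  have hle : 𝓝[>] t ≤ 𝓝[Ico 0 T] t := by
    rw [nhdsWithin, nhdsWithin]
    refine le_inf inf_le_left (le_principal_iff.2 ?_)
    filter_upwards [hmem] with s hs
    exact ⟨ht.1.trans hs.1.le, hs.2⟩
  have hlim := (((hu₁.2 _ hg).sub (hu₂.2 _ hg)) t ht).mono_left hle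
  have hfreq : ∃ᶠ s in 𝓝[>] t, (∫ x, inner ℝ (u₁ s x) (u₁ t x - u₂ t x) ∂weightedVolume γ) -
      (∫ x, inner ℝ (u₂ s x) (u₁ t x - u₂ t x) ∂weightedVolume γ) = 0 := by
    refine ((frequently_nhdsGT_of_ae h t).and_eventually hmem).mono fun s ⟨hs, hst⟩ => ?_
    rw [sub_eq_zero]
    refine integral_congr_ae ?_
    filter_upwards [hac.ae_le (hs ⟨ht.1.trans_lt hst.1, hst.2⟩)] with x hx
    rw [hx]
  have hinner := tendsto_nhds_unique_of_frequently_eq hlim (tendsto_const_nhds (x := (0 : ℝ))) hfreq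
  rw [Pi.sub_apply, ← integral_sub (integrable_inner_of_memLp_two hm1 hg)
    (integrable_inner_of_memLp_two hm2 hg)] at hinner
  simp only [← inner_sub_left, real_inner_self_eq_norm_sq] at hinner
  rw [integral_eq_zero_iff_of_nonneg (fun x => by positivity)
    (hg.integrable_norm_pow (by norm_num))] at hinner
  filter_upwards [(absolutelyContinuous_weightedVolume γ).ae_le hinner] with x hx
  exact sub_eq_zero.1 (norm_eq_zero.1 (pow_eq_zero_iff (two_ne_zero)|>.1 hx))

end Uniqueness

end AdvDiff

theorem mainTheorem8 (γ T : ℝ) (hγ : 0 < γ) (hγ2 : γ ≤ 2) (hT : 0 < T)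
    (u₀ : AdvDiff.E3 → AdvDiff.E3)
    (hu₀ : MemLp u₀ 2 (AdvDiff.weightedVolume γ)) (hu₀div : AdvDiff.DivFreeSpace u₀)
    (F : ℝ → AdvDiff.E3 → Fin 3 → Fin 3 → ℝ)
    (hF : ∀ i j, AdvDiff.MemLqLr T 2 2 (AdvDiff.weightedVolume γ) (fun t x => F t x i j))
    (b : ℝ → AdvDiff.E3 → AdvDiff.E3)
    (hb : AdvDiff.MemLqLr T 3 3 (AdvDiff.weightedVolume (3 * γ / 2)) b)
    (hbdiv : AdvDiff.DivFreeSlab T b)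
    (hbloc : AdvDiff.MemLocL2LInfty T b)
    (u₁ u₂ : ℝ → AdvDiff.E3 → AdvDiff.E3) (p₁ p₂ : ℝ → AdvDiff.E3 → ℝ)
    (h₁ : AdvDiff.IsSolution γ T u₀ F b u₁ p₁)
    (h₂ : AdvDiff.IsSolution γ T u₀ F b u₂ p₂) :
    ∀ t ∈ Ico 0 T, u₁ t =ᵐ[volume] u₂ t := fun _ ht =>
  AdvDiff.slice_eq_of_ae_slice_eq h₁.weaklyContinuous h₂.weaklyContinuous
    (AdvDiff.ae_slice_eq hγ hγ2 hT hu₀ hF hb hbdiv hbloc h₁ h₂) ht
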